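/- Let $M^2$ be a smooth surface, $(N^3,g)$ a smooth Riemannian $3$-manifold with Levi-Civita connection $D$, and $f\colon M^2\to N^3$ a front with unit normal $\nu$: $f$ is smooth, $\nu$ is a smooth unit vector field along $f$ with $g(df(X),\nu)=0$ for all $X\in TM^2$, and $(f,\nu)\colon M^2\to T_1N^3$ is an immersion. Put $ds^2(X,Y)=g(df(X),df(Y))$ and $h(X,Y)=-g(df(X),D_Y\nu)$ (first and second fundamental forms). Let $\Sigma_f$ be the set of singular points, i.e. points where $f$ is not an immersion. On $M^2\setminus\Sigma_f$ let $K$ be the Gaussian curvature of the metric $ds^2$ and $K_{\rm ext}$ the extrinsic curvature, i.e. the determinant of the shape operator (the product of the principal curvatures). Locally choose orientations, let $\mu_g$ be the volume element of $g$, and let $\lambda=\mu_g(f_u,f_v,\nu)$ for positively oriented local coordinates $(u,v)$ of $M^2$; a singular point is non-degenerate if $d\lambda\neq0$ there. Let $\gamma\colon I\to M^2$, with $I\subset\mathbf R$ an open interval, be a smooth regular curve all of whose points are non-degenerate singular points of $f$. A point $\gamma(t)$ is a cuspidal edge if and only if $\ker df_{\gamma(t)}$ is transversal to $\gamma'(t)$.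 In that case, with $\hat\gamma=f\circ\gamma$ and a vector $\eta\in\ker df_{\gamma(t)}$ such that $(\gamma'(t),\eta)$ is positively oriented, the singular curvature is $$\kappa_s(t)=\operatorname{sgn}\bigl(d\lambda(\eta)\bigr)\,\frac{\mu_g\bigl(\hat\gamma'(t),D_t\hat\gamma'(t),\nu\bigr)}{|\hat\gamma'(t)|^3};$$ it does not depend on the choices of orientation. Then: 1. $K$ is bounded near $\gamma$ (that is, for every compact $J\subset I$ there is a neighborhood $U$ of $\gamma(J)$ such that $K$ is bounded on $U\setminus\Sigma_f$) if and only if $h$ vanishes at all points of $\gamma(I)$. 2. If $U\subset M^2$ is open and $K_{\rm ext}\ge0$ on $U\setminus\Sigma_f$, then $\kappa_s(t)\le0$ at every cuspidal edge $\gamma(t)\in U$. 3. If $U\subset M^2$ is open and $K_{\rm ext}\ge\delta$ on $U\setminus\Sigma_f$ for a constant $\delta>0$, then $\kappa_s(t)<0$ at every cuspidal edge $\gamma(t)\in U$. 4. If $\gamma(t_0)$ is not a cuspidal edge, i.e. $df(\gamma'(t_0))=0$, then $\kappa_s(t)\to-\infty$ as $t\to t_0$ through those $t$ for which $\gamma(t)$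 is a cuspidal edge (so that also there the singular curvature is to be regarded as negative). 5. In particular, if $(N^3,g)$ is Euclidean $\mathbf R^3$, $U\subset M^2$ is open and $K\ge0$ on $U\setminus\Sigma_f$, then $\kappa_s(t)\le0$ at every cuspidal edge $\gamma(t)\in U$. -/

import Mathlib

open Set Filter Topology Bundle
open scoped Manifold ContDiff

noncomputable section

namespace Front

/-! ### Coordinate Riemannian geometry

A metric on (an open set of) `ℝⁿ` is given by its coefficient matrix `G : ℝⁿ → Matrix`. -/

/-- The partial derivative `∂ᵢ u` at `x`. -/
def pderiv {n : ℕ} (i : Fin n) (u : EuclideanSpace ℝ (Fin n) → ℝ)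
    (x : EuclideanSpace ℝ (Fin n)) : ℝ :=
  fderiv ℝ u x (EuclideanSpace.single i 1)

/-- The Christoffel symbol `Γᵏᵢⱼ = ½ ∑ₗ gᵏˡ (∂ᵢ gⱼₗ + ∂ⱼ gᵢₗ - ∂ₗ gᵢⱼ)` at `x`. -/
def christoffel {n : ℕ} (G : EuclideanSpace ℝ (Fin n) → Matrix (Fin n) (Fin n) ℝ)
    (k i j : Fin n) (x : EuclideanSpace ℝ (Fin n)) : ℝ :=
  (1 / 2) * ∑ l, (G x)⁻¹ k l *
    (pderiv i (fun y => G y j l) x + pderiv j (fun y => G y i l) x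
      - pderiv l (fun y => G y i j) x)

/-- The component `Rˡ` in `R(∂ᵢ, ∂ⱼ) ∂ₖ = ∑ₗ Rˡ ∂ₗ` of the curvature tensor
`R(X, Y) Z = ∇_X ∇_Y Z - ∇_Y ∇_X Z - ∇_[X, Y] Z`. -/
def curvatureCoeff {n : ℕ} (G : EuclideanSpace ℝ (Fin n) → Matrix (Fin n) (Fin n) ℝ)
    (i j k l : Fin n) (x : EuclideanSpace ℝ (Fin n)) : ℝ :=
  pderiv i (christoffel G l j k) x - pderiv j (christoffel G l i k) x
    + ∑ m, (christoffel G l i m x * christoffel G m j k x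
      - christoffel G l j m x * christoffel G m i k x)

/-- The Gaussian curvature `g(R(∂₁, ∂₂) ∂₂, ∂₁) / det g` of a metric in two variables. -/
def coordGaussCurvature (G : EuclideanSpace ℝ (Fin 2) → Matrix (Fin 2) (Fin 2) ℝ)
    (x : EuclideanSpace ℝ (Fin 2)) : ℝ :=
  (∑ l, G x l 0 * curvatureCoeff G 0 1 1 l x) / (G x).det

/-- The derivative `X(u) = du(X)` of a real function `u` on a manifold. -/
def dirDeriv {E H : Type*} [NormedAddCommGroup E] [NormedSpace ℝ E] [TopologicalSpace H]
    (J : ModelWithCorners ℝ E H) {P : Type*} [TopologicalSpace P] [ChartedSpace H P]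
    (u : P → ℝ) (s : P) (X : TangentSpace J s) : ℝ :=
  mfderiv J 𝓘(ℝ, ℝ) u s X

/-! ### Charts of a manifold

All coordinate expressions at a point `q₀` are computed in the preferred chart at `q₀`.
The manifolds are not required to be orientable: `q₀` being fixed, a neighbourhood of `q₀` is
oriented by that chart. -/

section Charts

variable {n : ℕ} {M : Type*} [TopologicalSpace M] [ChartedSpace (EuclideanSpace ℝ (Fin n)) M]

/-- The coordinate vector field `∂/∂xᵢ` of the chart at `q₀`, at the point `q`. -/
def coordVec (q₀ : M) (i : Fin n) (q : M) : TangentSpace (𝓡 n) q :=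
  mfderiv (𝓡 n) (𝓡 n) (fun x : EuclideanSpace ℝ (Fin n) => (extChartAt (𝓡 n) q₀).symm x)
    (extChartAt (𝓡 n) q₀ q) (EuclideanSpace.single i 1)

/-- The components of a tangent vector at `q` in the chart at `q₀`. -/
def components (q₀ q : M) (X : TangentSpace (𝓡 n) q) : EuclideanSpace ℝ (Fin n) :=
  mfderiv (𝓡 n) (𝓡 n) (fun y : M => extChartAt (𝓡 n) q₀ y) q X

/-- The coefficient matrix `B(∂/∂xᵢ, ∂/∂xⱼ)` of a field `B` of bilinear forms in the chart at
`q₀`, as a function of the coordinates. -/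
def chartMatrix (B : ∀ q : M, TangentSpace (𝓡 n) q → TangentSpace (𝓡 n) q → ℝ) (q₀ : M)
    (x : EuclideanSpace ℝ (Fin n)) : Matrix (Fin n) (Fin n) ℝ :=
  Matrix.of fun i j =>
    B ((extChartAt (𝓡 n) q₀).symm x) (coordVec q₀ i ((extChartAt (𝓡 n) q₀).symm x))
      (coordVec q₀ j ((extChartAt (𝓡 n) q₀).symm x))

/-- `(X, Y)` is a positively oriented basis of the tangent plane at `q`
(for the orientation of the chart at `q`). -/
def PositivePair {M : Type*} [TopologicalSpace M] [ChartedSpace (EuclideanSpace ℝ (Fin 2)) M]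
    {q : M} (X Y : TangentSpace (𝓡 2) q) : Prop :=
  0 < (Matrix.of ![components q q X, components q q Y]).det

end Charts

/-! ### The ambient Riemannian 3-manifold -/

section Ambient

variable {N : Type*} [TopologicalSpace N] [ChartedSpace (EuclideanSpace ℝ (Fin 3)) N]
  [IsManifold (𝓡 3) ∞ N]
  (g : ContMDiffRiemannianMetric (𝓡 3) ∞ (EuclideanSpace ℝ (Fin 3))
    (fun y : N => TangentSpace (𝓡 3) y))

/-- The coefficient matrix of the metric `g` in the chart at `y₀`. -/
def metricMatrix (y₀ : N) : EuclideanSpace ℝ (Fin 3) → Matrix (Fin 3) (Fin 3) ℝ :=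
  chartMatrix (fun (y : N) (X Y : TangentSpace (𝓡 3) y) => g.inner y X Y) y₀

/-- The Riemannian volume element `μ_g = √(det g) dx₁ ∧ dx₂ ∧ dx₃` near `y₀`, evaluated on three
vectors at `y`. -/
def volumeElement (y₀ y : N) (a b c : TangentSpace (𝓡 3) y) : ℝ :=
  √((metricMatrix g y₀ (extChartAt (𝓡 3) y₀ y)).det) *
    (Matrix.of ![components y₀ y a, components y₀ y b, components y₀ y c]).det

/-- The Levi-Civita covariant derivative `D_X V` at `s` of a vector field `V` along a map
`c : P → N`. In the chart at `c s` its components are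
`X(Vᵏ) + ∑ᵢⱼ Γᵏᵢⱼ dcⁱ(X) Vʲ`. -/
def covDerivAlong {E H : Type*} [NormedAddCommGroup E] [NormedSpace ℝ E] [TopologicalSpace H]
    (J : ModelWithCorners ℝ E H) {P : Type*} [TopologicalSpace P] [ChartedSpace H P]
    (c : P → N) (V : ∀ s, TangentSpace (𝓡 3) (c s)) (s : P) (X : TangentSpace J s) :
    TangentSpace (𝓡 3) (c s) :=
  ∑ k, (dirDeriv J (fun r : P => components (c s) (c r) (V r) k) s X
      + ∑ i, ∑ j, christoffel (metricMatrix g (c s)) k i j (extChartAt (𝓡 3) (c s) (c s))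
          * components (c s) (c s) (mfderiv J (𝓡 3) c s X) i
          * components (c s) (c s) (V s) j) • coordVec (c s) k (c s)

end Ambient

/-! ### Fronts -/

section Fronts

variable {M : Type*} [TopologicalSpace M] [ChartedSpace (EuclideanSpace ℝ (Fin 2)) M]
  {N : Type*} [TopologicalSpace N] [ChartedSpace (EuclideanSpace ℝ (Fin 3)) N]
  [IsManifold (𝓡 3) ∞ N]
  (g : ContMDiffRiemannianMetric (𝓡 3) ∞ (EuclideanSpace ℝ (Fin 3))
    (fun y : N => TangentSpace (𝓡 3) y))
  (f : M → N) (ν : ∀ q : M, TangentSpace (𝓡 3) (f q))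

/-- The lift `L = (f, ν)` of `f` to the tangent bundle. -/
def lift (q : M) : TangentBundle (𝓡 3) N := ⟨f q, ν q⟩

/-- `f` is a front with unit normal vector field `ν`: the lift `L = (f, ν)` is an immersion into
the unit tangent bundle and is isotropic for the canonical contact form,
that is, `ν` is orthogonal to the image of `df`. -/
structure IsFront : Prop where
  smooth : ContMDiff (𝓡 2) (𝓡 3) ∞ f
  smooth_lift : ContMDiff (𝓡 2) (𝓡 3).tangent ∞ (lift f ν)
  unit : ∀ q, g.inner (f q) (ν q) (ν q) = 1
  orthogonal : ∀ (q : M) (X : TangentSpace (𝓡 2) q),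
    g.inner (f q) (mfderiv (𝓡 2) (𝓡 3) f q X) (ν q) = 0
  immersion : ∀ q, Function.Injective (mfderiv (𝓡 2) (𝓡 3).tangent (lift f ν) q)

/-- `q` is a singular point: `f` is not an immersion at `q`. -/
def IsSingularPoint (q : M) : Prop :=
  ¬ Function.Injective (mfderiv (𝓡 2) (𝓡 3) f q)

/-- The first fundamental form `ds²(X, Y) = g(df X, df Y)`. -/
def firstForm (q : M) (X Y : TangentSpace (𝓡 2) q) : ℝ :=
  g.inner (f q) (mfderiv (𝓡 2) (𝓡 3) f q X) (mfderiv (𝓡 2) (𝓡 3) f q Y)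

/-- The second fundamental form `h(X, Y) = -g(df X, D_Y ν)`. -/
def secondForm (q : M) (X Y : TangentSpace (𝓡 2) q) : ℝ :=
  - g.inner (f q) (mfderiv (𝓡 2) (𝓡 3) f q X) (covDerivAlong g (𝓡 2) f ν q Y)

/-- The Gaussian curvature at `q` of the metric `ds²` induced on the regular set
(only meaningful at regular points). -/
def gaussCurvature (q : M) : ℝ :=
  coordGaussCurvature (chartMatrix (firstForm g f) q) (extChartAt (𝓡 2) q q)

/-- The matrix `S` of the shape operator in the chart at `q`, determined by the Weingarten equation
`D_j ν = - ∑ᵢ Sⁱⱼ ∂ᵢ f` (only meaningful at regular points). -/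
def shapeOperator (q : M) : Matrix (Fin 2) (Fin 2) ℝ :=
  (chartMatrix (firstForm g f) q (extChartAt (𝓡 2) q q))⁻¹ *
    chartMatrix (secondForm g f ν) q (extChartAt (𝓡 2) q q)

/-- The extrinsic curvature: the determinant of the shape operator, that is, the product of the
principal curvatures (only meaningful at regular points). -/
def extrinsicCurvature (q : M) : ℝ := (shapeOperator g f ν q).det

/-- The signed area density function `λ = μ_g(f_u, f_v, ν)`, where `(u, v)` is the chart at `q₀`,
as a function near `q₀`. -/
def signedAreaDensity (q₀ q : M) : ℝ :=
  volumeElement g (f q₀) (f q) (mfderiv (𝓡 2) (𝓡 3) f q (coordVec q₀ 0 q))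
    (mfderiv (𝓡 2) (𝓡 3) f q (coordVec q₀ 1 q)) (ν q)

/-- The differential `dλ` at `q`. -/
def dAreaDensity (q : M) (X : TangentSpace (𝓡 2) q) : ℝ :=
  dirDeriv (𝓡 2) (signedAreaDensity g f ν q) q X

/-- A singular point is non-degenerate if `dλ ≠ 0` there. -/
def IsNondegenerateSingularPoint (q : M) : Prop :=
  IsSingularPoint f q ∧ ∃ X, dAreaDensity g f ν q X ≠ 0

/-- The velocity `γ'(t)` of a curve in `M`. -/
def velocity (γ : ℝ → M) (t : ℝ) : TangentSpace (𝓡 2) (γ t) :=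
  mfderiv 𝓘(ℝ, ℝ) (𝓡 2) γ t (1 : ℝ)

/-- A singular curve consisting of non-degenerate singular points, defined on an open interval
`I`: a smooth regular curve in `M` all of whose points are non-degenerate singular points. -/
structure IsSingularCurve (I : Set ℝ) (γ : ℝ → M) : Prop where
  isOpen : IsOpen I
  ordConnected : I.OrdConnected
  smooth : ContMDiffOn 𝓘(ℝ, ℝ) (𝓡 2) ∞ γ I
  regular : ∀ t ∈ I, velocity γ t ≠ 0
  nondegenerate : ∀ t ∈ I, IsNondegenerateSingularPoint g f ν (γ t)

/-- The velocity `γ̂'(t)` of the image curve `γ̂ = f ∘ γ`. -/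
def imageVelocity (γ : ℝ → M) (t : ℝ) : TangentSpace (𝓡 3) (f (γ t)) :=
  mfderiv 𝓘(ℝ, ℝ) (𝓡 3) (fun s => f (γ s)) t (1 : ℝ)

/-- The acceleration `γ̂''(t) = D_t γ̂'(t)` of the image curve `γ̂ = f ∘ γ`. -/
def imageAcceleration (γ : ℝ → M) (t : ℝ) : TangentSpace (𝓡 3) (f (γ t)) :=
  covDerivAlong g 𝓘(ℝ, ℝ) (fun s => f (γ s)) (imageVelocity f γ) t (1 : ℝ)

/-- `η` is a null vector at `γ t` such that `(γ'(t), η)` is positively oriented. Such an `η`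
exists exactly when the null direction is transversal to the singular direction,
that is, when `γ t` is a cuspidal edge. -/
def IsPositiveNullVector (γ : ℝ → M) (t : ℝ) (η : TangentSpace (𝓡 2) (γ t)) : Prop :=
  mfderiv (𝓡 2) (𝓡 3) f (γ t) η = 0 ∧ PositivePair (velocity γ t) η

/-- The singular curvature `sgn(dλ(η)) μ_g(γ̂', γ̂'', ν) / |γ̂'|³` at `γ t`, for a null vector `η` at
`γ t` such that `(γ'(t), η)` is positively oriented. -/
def singularCurvature (γ : ℝ → M) (t : ℝ) (η : TangentSpace (𝓡 2) (γ t)) : ℝ :=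
  Real.sign (dAreaDensity g f ν (γ t) η) *
    (volumeElement g (f (γ t)) (f (γ t)) (imageVelocity f γ t) (imageAcceleration g f γ t)
        (ν (γ t)) /
      √(g.inner (f (γ t)) (imageVelocity f γ t) (imageVelocity f γ t)) ^ 3)

end Fronts

/-- The Euclidean metric `g₀` of `ℝ³`. -/
def euclideanMetric : ContMDiffRiemannianMetric (𝓡 3) ∞ (EuclideanSpace ℝ (Fin 3))
    (fun y : EuclideanSpace ℝ (Fin 3) => TangentSpace (𝓡 3) y) where
  inner := (riemannianMetricVectorSpace (EuclideanSpace ℝ (Fin 3))).inner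
  symm := (riemannianMetricVectorSpace (EuclideanSpace ℝ (Fin 3))).symm
  pos := (riemannianMetricVectorSpace (EuclideanSpace ℝ (Fin 3))).pos
  isVonNBounded := (riemannianMetricVectorSpace (EuclideanSpace ℝ (Fin 3))).isVonNBounded
  contMDiff := (riemannianMetricVectorSpace (EuclideanSpace ℝ (Fin 3))).contMDiff.of_le le_top

end Front

end

open scoped Matrix
set_option linter.unusedSectionVars false

noncomputable section

/-! In charts a front is a pair `F`, `N` with a metric `Gm` on ℝ³, and two smooth functions control
it: λ = vol(F_u, F_v, N) (`density`) and μ = vol(D_u N, D_v N, N) (`normalDensity`). The Lagrange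
identity for vectors orthogonal to the unit vector N gives λ² = det ds² and λμ = det h, so K_ext =
μ/λ at regular points. By the Gauss equation, K − K_ext is the ambient sectional curvature of the
plane ν^⊥, which extends continuously across the singular set (`planeCurvature`).

Hence K is bounded near γ exactly when μ/λ is. Since λ = 0 and dλ ≠ 0 on γ, this means that μ = 0 on
γ (`exists_abs_le_of_eq_zero_on_curve`, `eq_zero_of_bounded_quotient`). Let η be a null vector and ξ
transversal to it. As (f, ν) is an immersion, D_η ν ≠ 0; it is orthogonal to df(ξ) because h(ξ, η) =
0. So μ is a nonzero multiple of h(ξ, ξ), the only entry of h that can survive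
(`normalDensity_eq_zero_iff`).

If K_ext ≥ δ ≥ 0, then λμ ≥ 0. As dλ ≠ 0, λ takes both signs near each point of γ, so μ and with it
h vanish on γ. Take ξ = γ'. The second-order part of det h ≥ δλ² in the direction η reads ∂_η h(ξ,ξ)
∂_η h(η,η) − (∂_η h(ξ,η))² ≥ δ (∂_η λ)², up to the area factor of (ξ, η). Here ∂_η h(η,η) = −⟨∇_η
df(η), D_η ν⟩ is a multiple of dλ(η). Covariant derivatives commute in the null direction, so ∂_η
h(ξ,ξ) = ⟨∇_ξ df(ξ), D_η ν⟩ is a multiple of the numerator of κ_s. The inequality thus decides the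
sign of κ_s (`vol_mul_vol_nonpos`).

Where γ' itself is null, write γ̂' = a·df(ξ) with a → 0. The numerator of κ_s is a² times a function
with nonzero limit and the denominator is of order |a|³, so |κ_s| → ∞; the identity between dλ and
that limit makes the sign negative (`eventually_localSingularCurvature_lt`).

All invariants of the statement are read in the preferred chart at the point of evaluation. To
differentiate along γ they are first rewritten in one fixed pair of charts, which needs the
transformation law of the Christoffel symbols and the fact that an orientation sign enters κ_s
twice. -/

namespace Front

/-! ### Instance shortcuts for spaces of bilinear and trilinear maps. -/

section Shortcuts

variable {W : Type*} [NormedAddCommGroup W] [NormedSpace ℝ W]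

instance : NormedAddCommGroup (W →L[ℝ] ℝ) := inferInstance
instance : NormedSpace ℝ (W →L[ℝ] ℝ) := inferInstance
instance : TopologicalSpace (W →L[ℝ] ℝ) := inferInstance
instance : AddCommGroup (W →L[ℝ] ℝ) := inferInstance
instance : AddCommMonoid (W →L[ℝ] ℝ) := inferInstance
instance : Module ℝ (W →L[ℝ] ℝ) := inferInstance
instance : NormedAddCommGroup (W →L[ℝ] W →L[ℝ] ℝ) := inferInstance
instance : NormedSpace ℝ (W →L[ℝ] W →L[ℝ] ℝ) := inferInstance
instance : SeminormedAddCommGroup (W →L[ℝ] W →L[ℝ] ℝ) := inferInstance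
instance : TopologicalSpace (W →L[ℝ] W →L[ℝ] ℝ) := inferInstance
instance : AddCommGroup (W →L[ℝ] W →L[ℝ] ℝ) := inferInstance
instance : AddCommMonoid (W →L[ℝ] W →L[ℝ] ℝ) := inferInstance
instance : Module ℝ (W →L[ℝ] W →L[ℝ] ℝ) := inferInstance
instance : NormedAddCommGroup (W →L[ℝ] W →L[ℝ] W →L[ℝ] ℝ) := inferInstance
instance : NormedSpace ℝ (W →L[ℝ] W →L[ℝ] W →L[ℝ] ℝ) := inferInstance
instance : SeminormedAddCommGroup (W →L[ℝ] W →L[ℝ] W →L[ℝ] ℝ) := inferInstance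
instance : TopologicalSpace (W →L[ℝ] W →L[ℝ] W →L[ℝ] ℝ) := inferInstance
instance : AddCommGroup (W →L[ℝ] W →L[ℝ] W →L[ℝ] ℝ) := inferInstance
instance : AddCommMonoid (W →L[ℝ] W →L[ℝ] W →L[ℝ] ℝ) := inferInstance
instance : Module ℝ (W →L[ℝ] W →L[ℝ] W →L[ℝ] ℝ) := inferInstance
instance : NormedAddCommGroup (W →L[ℝ] W →L[ℝ] W) := inferInstance
instance : NormedSpace ℝ (W →L[ℝ] W →L[ℝ] W) := inferInstance
instance : TopologicalSpace (W →L[ℝ] W →L[ℝ] W) := inferInstance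
instance : AddCommGroup (W →L[ℝ] W →L[ℝ] W) := inferInstance
instance : AddCommMonoid (W →L[ℝ] W →L[ℝ] W) := inferInstance
instance : Module ℝ (W →L[ℝ] W →L[ℝ] W) := inferInstance

end Shortcuts

/-! ### Levi-Civita calculus of a metric on a normed space, without indices. -/

section LocalGeometry

variable {V W : Type*} [NormedAddCommGroup V] [NormedSpace ℝ V]
  [NormedAddCommGroup W] [NormedSpace ℝ W]

/-- The linear map sending the derivative `D` of a metric to its Christoffel symbols of the
first kind `½ (D u v w + D v u w - D w u v)`. -/
def koszulMap (W : Type*) [NormedAddCommGroup W] [NormedSpace ℝ W] :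
    (W →L[ℝ] W →L[ℝ] W →L[ℝ] ℝ) →L[ℝ] (W →L[ℝ] W →L[ℝ] W →L[ℝ] ℝ) :=
  let S : (W →L[ℝ] W →L[ℝ] W →L[ℝ] ℝ) →L[ℝ] (W →L[ℝ] W →L[ℝ] W →L[ℝ] ℝ) :=
    (ContinuousLinearMap.flipₗᵢ ℝ W W (W →L[ℝ] ℝ)).toContinuousLinearEquiv.toContinuousLinearMap
  let T : (W →L[ℝ] W →L[ℝ] ℝ) →L[ℝ] (W →L[ℝ] W →L[ℝ] ℝ) :=
    (ContinuousLinearMap.flipₗᵢ ℝ W W ℝ).toContinuousLinearEquiv.toContinuousLinearMap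
  (1 / 2 : ℝ) • (ContinuousLinearMap.id ℝ _ + S -
    (ContinuousLinearMap.compL ℝ W (W →L[ℝ] W →L[ℝ] ℝ) (W →L[ℝ] W →L[ℝ] ℝ) T) ∘L S)

theorem koszulMap_apply (D : W →L[ℝ] W →L[ℝ] W →L[ℝ] ℝ) (u v w : W) :
    koszulMap W D u v w = 1 / 2 * (D u v w + D v u w - D w u v) := by
  simp [koszulMap]

/-- The Christoffel symbols of the first kind of a metric. -/
def christ1 (G : W → W →L[ℝ] W →L[ℝ] ℝ) (y : W) : W →L[ℝ] W →L[ℝ] W →L[ℝ] ℝ :=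
  koszulMap W (fderiv ℝ G y)

/-- The Christoffel symbols of the second kind of a metric. -/
def levi (G : W → W →L[ℝ] W →L[ℝ] ℝ) (y : W) : W →L[ℝ] W →L[ℝ] W :=
  (ContinuousLinearMap.compL ℝ W (W →L[ℝ] ℝ) W (G y).inverse) ∘L (christ1 G y)

/-- The lowered curvature tensor `g(R(u, v) z, w)`. -/
def riem (G : W → W →L[ℝ] W →L[ℝ] ℝ) (y u v z w : W) : ℝ :=
  fderiv ℝ (christ1 G) y u v z w - fderiv ℝ (christ1 G) y v u z w
    - christ1 G y u w (levi G y v z) + christ1 G y v w (levi G y u z)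

/-- `G` is a smooth nondegenerate metric near `y`. -/
def IsLocalMetric (G : W → W →L[ℝ] W →L[ℝ] ℝ) (y : W) : Prop :=
  ∀ᶠ z in 𝓝 y, ContDiffAt ℝ ∞ G z ∧ (∀ u v, G z u v = G z v u) ∧ (G z).IsInvertible

/-- `F` is smooth near `x`. -/
def SmoothNear (F : V → W) (x : V) : Prop := ∀ᶠ z in 𝓝 x, ContDiffAt ℝ ∞ F z

theorem SmoothNear.contDiffAt {F : V → W} {x : V} (h : SmoothNear F x) : ContDiffAt ℝ ∞ F x :=
  h.self_of_nhds

theorem SmoothNear.differentiableAt {F : V → W} {x : V} (h : SmoothNear F x) :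
    DifferentiableAt ℝ F x :=
  h.contDiffAt.differentiableAt (by simp)

theorem SmoothNear.nearby {F : V → W} {x : V} (h : SmoothNear F x) :
    ∀ᶠ z in 𝓝 x, SmoothNear F z :=
  h.eventually_nhds

theorem SmoothNear.continuousAt {F : V → W} {x : V} (h : SmoothNear F x) : ContinuousAt F x :=
  h.contDiffAt.continuousAt

theorem SmoothNear.fderiv {F : V → W} {x : V} (h : SmoothNear F x) :
    SmoothNear (fderiv ℝ F) x :=
  h.mono fun _ hz => hz.fderiv_right (m := ∞) (by simp)

variable {G : W → W →L[ℝ] W →L[ℝ] ℝ} {y : W}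

theorem IsLocalMetric.nearby (h : IsLocalMetric G y) : ∀ᶠ z in 𝓝 y, IsLocalMetric G z :=
  h.eventually_nhds

theorem IsLocalMetric.smooth (h : IsLocalMetric G y) : SmoothNear G y :=
  h.mono fun _ hz => hz.1

theorem IsLocalMetric.symm (h : IsLocalMetric G y) (u v : W) : G y u v = G y v u :=
  h.self_of_nhds.2.1 u v

theorem IsLocalMetric.isInvertible (h : IsLocalMetric G y) : (G y).IsInvertible :=
  h.self_of_nhds.2.2

theorem fderiv_apply₂ (hG : DifferentiableAt ℝ G y) (u v w : W) :
    fderiv ℝ G y u v w = fderiv ℝ (fun z => G z v w) y u := by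
  have h : HasFDerivAt (fun z => G z v w) _ y :=
    (hG.hasFDerivAt.clm_apply (hasFDerivAt_const v y)).clm_apply (hasFDerivAt_const w y)
  rw [h.fderiv]; simp

theorem IsLocalMetric.fderiv_symm (h : IsLocalMetric G y) (u v w : W) :
    fderiv ℝ G y u v w = fderiv ℝ G y u w v := by
  have hd := h.smooth.differentiableAt
  rw [fderiv_apply₂ hd, fderiv_apply₂ hd]
  have : (fun z => G z v w) =ᶠ[𝓝 y] fun z => G z w v := h.mono fun z hz => hz.2.1 v w
  rw [this.fderiv_eq]

theorem christ1_apply (u v w : W) : christ1 G y u v w =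
    1 / 2 * (fderiv ℝ G y u v w + fderiv ℝ G y v u w - fderiv ℝ G y w u v) :=
  koszulMap_apply _ _ _ _

theorem IsLocalMetric.christ1_symm (h : IsLocalMetric G y) (u v w : W) :
    christ1 G y u v w = christ1 G y v u w := by
  rw [christ1_apply, christ1_apply, h.fderiv_symm w u v]; ring

/-- Metric compatibility: the Koszul formula inverted. It lets derivatives of the metric be traded
for Christoffel symbols. -/
theorem IsLocalMetric.fderiv_eq (h : IsLocalMetric G y) (u v w : W) :
    fderiv ℝ G y u v w = christ1 G y u v w + christ1 G y u w v := by
  rw [christ1_apply, christ1_apply, h.fderiv_symm u w v, h.fderiv_symm w u v,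
    h.fderiv_symm v u w]; ring

theorem IsLocalMetric.levi_spec (h : IsLocalMetric G y) (u v w : W) :
    G y (levi G y u v) w = christ1 G y u v w := by
  obtain ⟨e, he⟩ := h.isInvertible
  simp [levi, ← he]

theorem IsLocalMetric.injective (h : IsLocalMetric G y) {a b : W} (hab : ∀ w, G y a w = G y b w) :
    a = b := by
  obtain ⟨e, he⟩ := h.isInvertible
  apply e.injective
  ext w
  have := hab w
  rw [← he] at this
  exact this

theorem IsLocalMetric.levi_symm (h : IsLocalMetric G y) (u v : W) :
    levi G y u v = levi G y v u :=
  h.injective fun w => by rw [h.levi_spec, h.levi_spec, h.christ1_symm]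

theorem IsLocalMetric.smooth_christ1 (h : IsLocalMetric G y) : SmoothNear (christ1 G) y :=
  h.smooth.fderiv.mono fun _ hz => (koszulMap W).contDiff.contDiffAt.comp _ hz

theorem IsLocalMetric.smooth_levi [CompleteSpace W] (h : IsLocalMetric G y) :
    SmoothNear (levi G) y := by
  filter_upwards [h, h.smooth_christ1] with z hz hc
  obtain ⟨e, he⟩ := hz.2.2
  have h1 : ContDiffAt ℝ ∞ (fun z => (G z).inverse) z := by
    have := contDiffAt_map_inverse (n := ∞) e
    rw [he] at this
    exact this.comp z hz.1
  exact ((ContinuousLinearMap.compL ℝ W (W →L[ℝ] ℝ) W).contDiff.contDiffAt.comp z h1).clm_comp hc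

theorem fderiv_metric_apply {F A B : V → W} {x : V} (hG : DifferentiableAt ℝ G (F x))
    (hF : DifferentiableAt ℝ F x) (hA : DifferentiableAt ℝ A x) (hB : DifferentiableAt ℝ B x)
    (u : V) :
    fderiv ℝ (fun z => G (F z) (A z) (B z)) x u =
      fderiv ℝ G (F x) (fderiv ℝ F x u) (A x) (B x) + G (F x) (fderiv ℝ A x u) (B x)
        + G (F x) (A x) (fderiv ℝ B x u) := by
  have hGF : HasFDerivAt (fun z => G (F z)) ((fderiv ℝ G (F x)) ∘L (fderiv ℝ F x)) x :=
    hG.hasFDerivAt.comp x hF.hasFDerivAt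
  have h := (hGF.clm_apply hA.hasFDerivAt).clm_apply hB.hasFDerivAt
  rw [h.fderiv]; simp; ring

end LocalGeometry

/-! ### Pullback of metrics, second-order covariant calculus along a map, curvature. -/

section Pullback

variable {V W : Type*} [NormedAddCommGroup V] [NormedSpace ℝ V]
  [NormedAddCommGroup W] [NormedSpace ℝ W]
  {G : W → W →L[ℝ] W →L[ℝ] ℝ} {G' : V → V →L[ℝ] V →L[ℝ] ℝ} {F : V → W} {x : V}

theorem SmoothNear.fderiv_fderiv_symm (h : SmoothNear F x) (u v : V) :
    _root_.fderiv ℝ (_root_.fderiv ℝ F) x u v = _root_.fderiv ℝ (_root_.fderiv ℝ F) x v u :=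
  (h.contDiffAt.isSymmSndFDerivAt (by simpa using WithTop.coe_le_coe.2 (le_top : (2 : ℕ∞) ≤ ⊤))) u v

theorem SmoothNear.apply_const {A : V → V →L[ℝ] W} (h : SmoothNear A x) (u : V) :
    SmoothNear (fun z => A z u) x :=
  h.mono fun _ hz => hz.clm_apply contDiffAt_const

theorem SmoothNear.comp {U : Type*} [NormedAddCommGroup U] [NormedSpace ℝ U] {K : W → U}
    (hK : SmoothNear K (F x)) (hF : SmoothNear F x) : SmoothNear (fun z => K (F z)) x := by
  filter_upwards [hF, hF.continuousAt.eventually hK] with z h1 h2 using h2.comp z h1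

theorem fderiv_clm_apply' {U : Type*} [NormedAddCommGroup U] [NormedSpace ℝ U]
    {L : V → W →L[ℝ] U} {A : V → W} (hL : DifferentiableAt ℝ L x) (hA : DifferentiableAt ℝ A x)
    (u : V) : fderiv ℝ (fun z => L z (A z)) x u = fderiv ℝ L x u (A x) + L x (fderiv ℝ A x u) := by
  rw [fderiv_clm_apply hL hA]; simp [add_comm]

theorem fderiv_clm_apply_const {U : Type*} [NormedAddCommGroup U] [NormedSpace ℝ U]
    {L : V → W →L[ℝ] U} (hL : DifferentiableAt ℝ L x) (a : W)
    (u : V) : fderiv ℝ (fun z => L z a) x u = fderiv ℝ L x u a := by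
  rw [fderiv_clm_apply' hL (differentiableAt_const a)]; simp

theorem fderiv_comp_apply {U : Type*} [NormedAddCommGroup U] [NormedSpace ℝ U]
    {K : W → U} (hK : DifferentiableAt ℝ K (F x)) (hF : DifferentiableAt ℝ F x)
    (u : V) : fderiv ℝ (fun z => K (F z)) x u = fderiv ℝ K (F x) (fderiv ℝ F x u) := by
  rw [show (fun z => K (F z)) = K ∘ F from rfl, fderiv_comp x hK hF]; rfl

/-- The covariant Hessian `∇dF` of a map into a space with a metric. -/
def hess (G : W → W →L[ℝ] W →L[ℝ] ℝ) (F : V → W) (x u v : V) : W :=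
  fderiv ℝ (fderiv ℝ F) x u v + levi G (F x) (fderiv ℝ F x u) (fderiv ℝ F x v)

/-- The covariant derivative of a vector field `A` along a map `F`. -/
def cov (G : W → W →L[ℝ] W →L[ℝ] ℝ) (F A : V → W) (x u : V) : W :=
  fderiv ℝ A x u + levi G (F x) (fderiv ℝ F x u) (A x)

/-- `G'` is near `x` the pullback of the metric `G` by `F`. -/
def IsPullbackNear (G : W → W →L[ℝ] W →L[ℝ] ℝ) (F : V → W) (G' : V → V →L[ℝ] V →L[ℝ] ℝ) (x : V) :
    Prop :=
  ∀ᶠ z in 𝓝 x, ∀ u v, G' z u v = G (F z) (fderiv ℝ F z u) (fderiv ℝ F z v)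

theorem hess_symm (hG : IsLocalMetric G (F x)) (hF : SmoothNear F x) (u v : V) :
    hess G F x u v = hess G F x v u := by
  rw [hess, hess, hF.fderiv_fderiv_symm, hG.levi_symm]

theorem cov_fderiv (hF : SmoothNear F x) (u v : V) :
    cov G F (fun z => fderiv ℝ F z v) x u = hess G F x u v := by
  rw [cov, hess, fderiv_clm_apply_const hF.fderiv.differentiableAt]

theorem fderiv_pullback (hG : IsLocalMetric G (F x)) (hF : SmoothNear F x)
    (hG' : DifferentiableAt ℝ G' x) (hp : IsPullbackNear G F G' x) (u v w : V) :
    fderiv ℝ G' x u v w = fderiv ℝ G (F x) (fderiv ℝ F x u) (fderiv ℝ F x v) (fderiv ℝ F x w)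
      + G (F x) (fderiv ℝ (fderiv ℝ F) x u v) (fderiv ℝ F x w)
      + G (F x) (fderiv ℝ F x v) (fderiv ℝ (fderiv ℝ F) x u w) := by
  rw [fderiv_apply₂ hG']
  have : (fun z => G' z v w) =ᶠ[𝓝 x] fun z => G (F z) (fderiv ℝ F z v) (fderiv ℝ F z w) :=
    hp.mono fun z hz => hz v w
  have h2 := hF.fderiv.differentiableAt
  rw [this.fderiv_eq, fderiv_metric_apply hG.smooth.differentiableAt hF.differentiableAt
    (hF.fderiv.apply_const v).differentiableAt (hF.fderiv.apply_const w).differentiableAt,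
    fderiv_clm_apply_const h2, fderiv_clm_apply_const h2]

/-- In the Koszul combination of `fderiv_pullback`, symmetry of D²F cancels all second-order terms
but one. No invertibility of `G'` is used, so this form can be differentiated once more without
raising indices. -/
theorem christ1_pullback' (hG : IsLocalMetric G (F x)) (hF : SmoothNear F x)
    (hG' : DifferentiableAt ℝ G' x) (hp : IsPullbackNear G F G' x) (u v w : V) :
    christ1 G' x u v w = christ1 G (F x) (fderiv ℝ F x u) (fderiv ℝ F x v) (fderiv ℝ F x w)
      + G (F x) (fderiv ℝ (fderiv ℝ F) x u v) (fderiv ℝ F x w) := by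
  simp only [christ1_apply, fderiv_pullback hG hF hG' hp]
  rw [hF.fderiv_fderiv_symm v u, hF.fderiv_fderiv_symm w u, hF.fderiv_fderiv_symm w v,
    hG.symm (fderiv ℝ F x v), hG.symm (fderiv ℝ F x u)]
  ring

/-- The tangential part of ∇dF is intrinsic. Applied to a chart transition this is the
transformation law of the Christoffel symbols; applied to a front it is half of the Gauss formula.
-/
theorem christ1_pullback (hG : IsLocalMetric G (F x)) (hF : SmoothNear F x)
    (hG' : DifferentiableAt ℝ G' x) (hp : IsPullbackNear G F G' x) (u v w : V) :
    christ1 G' x u v w = G (F x) (hess G F x u v) (fderiv ℝ F x w) := by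
  rw [christ1_pullback' hG hF hG' hp, hess, map_add, add_apply, hG.levi_spec, add_comm]

theorem fderiv_christ1_pullback (hG : IsLocalMetric G (F x)) (hF : SmoothNear F x)
    (hG' : IsLocalMetric G' x) (hp : IsPullbackNear G F G' x) (u v z w : V) :
    fderiv ℝ (christ1 G') x u v z w =
      fderiv ℝ (christ1 G) (F x) (fderiv ℝ F x u) (fderiv ℝ F x v) (fderiv ℝ F x z)
          (fderiv ℝ F x w)
      + christ1 G (F x) (fderiv ℝ (fderiv ℝ F) x u v) (fderiv ℝ F x z) (fderiv ℝ F x w)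
      + christ1 G (F x) (fderiv ℝ F x v) (fderiv ℝ (fderiv ℝ F) x u z) (fderiv ℝ F x w)
      + christ1 G (F x) (fderiv ℝ F x v) (fderiv ℝ F x z) (fderiv ℝ (fderiv ℝ F) x u w)
      + fderiv ℝ G (F x) (fderiv ℝ F x u) (fderiv ℝ (fderiv ℝ F) x v z) (fderiv ℝ F x w)
      + G (F x) (fderiv ℝ (fderiv ℝ (fderiv ℝ F)) x u v z) (fderiv ℝ F x w)
      + G (F x) (fderiv ℝ (fderiv ℝ F) x v z) (fderiv ℝ (fderiv ℝ F) x u w) := by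
  have d0 := hF.differentiableAt
  have d1 := hF.fderiv.differentiableAt
  have d2 := hF.fderiv.fderiv.differentiableAt
  have a1 : ∀ a, DifferentiableAt ℝ (fun z => fderiv ℝ F z a) x := fun a =>
    (hF.fderiv.apply_const a).differentiableAt
  have a2 : ∀ a b, DifferentiableAt ℝ (fun z => fderiv ℝ (fderiv ℝ F) z a b) x := fun a b =>
    ((hF.fderiv.fderiv.apply_const a).apply_const b).differentiableAt
  have dC' := hG'.smooth_christ1.differentiableAt
  have dC : DifferentiableAt ℝ (fun z => christ1 G (F z)) x :=
    (hG.smooth_christ1.comp hF).differentiableAt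
  have dCa := dC.clm_apply (a1 v)
  have dCab := dCa.clm_apply (a1 z)
  rw [← fderiv_clm_apply_const dC', ← fderiv_clm_apply_const
    (hG'.smooth_christ1.apply_const v).differentiableAt, ← fderiv_clm_apply_const
    ((hG'.smooth_christ1.apply_const v).apply_const z).differentiableAt]
  have e : (fun y => christ1 G' y v z w) =ᶠ[𝓝 x] fun y =>
      christ1 G (F y) (fderiv ℝ F y v) (fderiv ℝ F y z) (fderiv ℝ F y w)
      + G (F y) (fderiv ℝ (fderiv ℝ F) y v z) (fderiv ℝ F y w) := by
    filter_upwards [hF.continuousAt.eventually hG.nearby, hF.nearby, hG'.smooth.nearby,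
      hp.eventually_nhds] with y h1 h2 h3 h4
    exact christ1_pullback' h1 h2 h3.differentiableAt h4 v z w
  rw [e.fderiv_eq, fderiv_fun_add (dCab.clm_apply (a1 w))
    ((((hG.smooth.comp hF).differentiableAt).clm_apply (a2 v z)).clm_apply (a1 w)),
    add_apply, fderiv_metric_apply hG.smooth.differentiableAt d0 (a2 v z) (a1 w),
    fderiv_clm_apply' dCab (a1 w), fderiv_clm_apply' dCa (a1 z), fderiv_clm_apply' dC (a1 v),
    fderiv_comp_apply hG.smooth_christ1.differentiableAt d0,
    fderiv_clm_apply_const d1, fderiv_clm_apply_const d1, fderiv_clm_apply_const d1,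
    fderiv_clm_apply_const (hF.fderiv.fderiv.apply_const v).differentiableAt,
    fderiv_clm_apply_const d2]
  simp only [add_apply]
  ring

/-- The Gauss equation for a pulled back metric. -/
theorem riem_pullback (hG : IsLocalMetric G (F x)) (hF : SmoothNear F x)
    (hG' : IsLocalMetric G' x) (hp : IsPullbackNear G F G' x) (u v z w : V) :
    riem G' x u v z w =
      riem G (F x) (fderiv ℝ F x u) (fderiv ℝ F x v) (fderiv ℝ F x z) (fderiv ℝ F x w)
      + G (F x) (hess G F x v z) (hess G F x u w) - G (F x) (hess G F x u z) (hess G F x v w)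
      - G' x (levi G' x v z) (levi G' x u w) + G' x (levi G' x u z) (levi G' x v w) := by
  have dG' := hG'.smooth.differentiableAt
  -- The third derivatives of `F` drop out of the antisymmetrization in `u`, `v`.
  have s3 : fderiv ℝ (fderiv ℝ (fderiv ℝ F)) x u v = fderiv ℝ (fderiv ℝ (fderiv ℝ F)) x v u :=
    hF.fderiv.fderiv_fderiv_symm u v
  rw [riem, fderiv_christ1_pullback hG hF hG' hp, fderiv_christ1_pullback hG hF hG' hp, s3,
    hF.fderiv_fderiv_symm u v, hG'.symm (levi G' x v z), hG'.symm (levi G' x u z), hG'.levi_spec,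
    hG'.levi_spec, riem]
  simp only [hess, map_add, add_apply, hG.levi_spec, hG.fderiv_eq]
  rw [hG.symm (fderiv ℝ (fderiv ℝ F) x v z) (levi _ _ _ _),
    hG.symm (fderiv ℝ (fderiv ℝ F) x u z) (levi _ _ _ _)]
  simp only [hG.levi_spec]
  rw [hG.symm (fderiv ℝ (fderiv ℝ F) x u z) (fderiv ℝ (fderiv ℝ F) x v w)]
  generalize fderiv ℝ (fderiv ℝ F) x u z = Fuz
  generalize fderiv ℝ (fderiv ℝ F) x v z = Fvz
  -- Both sides are the inner product of the Christoffel vectors of (a, b) and (c, d).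
  have hΓ : ∀ a b c d, christ1 G (F x) a b (levi G (F x) c d) =
      christ1 G (F x) c d (levi G (F x) a b) := fun a b c d => by
    rw [← hG.levi_spec, hG.symm, hG.levi_spec]
  rw [hΓ (fderiv ℝ F x u) (fderiv ℝ F x w), hΓ (fderiv ℝ F x v) (fderiv ℝ F x w)]
  ring

/-- Symmetrizing the derivative of `christ1` in `z`, `w` gives a second derivative of the metric by
`IsLocalMetric.fderiv_eq`, and that is symmetric in `u`, `v`. -/
theorem riem_add_swap {y u v z w : W} (hG : IsLocalMetric G y) :
    riem G y u v z w = - riem G y u v w z := by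
  have key : ∀ u v, fderiv ℝ (christ1 G) y u v z w + fderiv ℝ (christ1 G) y u v w z =
      fderiv ℝ (fderiv ℝ G) y u v z w := by
    intro u v
    have dG := hG.smooth.fderiv
    have dC := hG.smooth_christ1
    have e : (fun y => fderiv ℝ G y v z w) =ᶠ[𝓝 y] fun y =>
        christ1 G y v z w + christ1 G y v w z := hG.nearby.mono fun y hy => hy.fderiv_eq v z w
    have hC : ∀ a b, fderiv ℝ (christ1 G) y u v a b = fderiv ℝ (fun y => christ1 G y v a b) y u := by
      intro a b
      rw [fderiv_clm_apply_const ((dC.apply_const v).apply_const a).differentiableAt,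
        fderiv_clm_apply_const (dC.apply_const v).differentiableAt,
        fderiv_clm_apply_const dC.differentiableAt]
    rw [hC, hC, ← fderiv_clm_apply_const dG.differentiableAt, ← fderiv_clm_apply_const
      (dG.apply_const v).differentiableAt, ← fderiv_clm_apply_const
      ((dG.apply_const v).apply_const z).differentiableAt, e.fderiv_eq, fderiv_fun_add
      (((dC.apply_const v).apply_const z).apply_const w).differentiableAt
      (((dC.apply_const v).apply_const w).apply_const z).differentiableAt, add_apply]
  have k1 := key u v
  have k2 := key v u
  have hs : fderiv ℝ (fderiv ℝ G) y u v = fderiv ℝ (fderiv ℝ G) y v u :=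
    hG.smooth.fderiv_fderiv_symm u v
  rw [hs] at k1
  have hu : christ1 G y u w (levi G y v z) = christ1 G y v z (levi G y u w) := by
    rw [← hG.levi_spec, hG.symm, hG.levi_spec]
  have hv : christ1 G y v w (levi G y u z) = christ1 G y u z (levi G y v w) := by
    rw [← hG.levi_spec, hG.symm, hG.levi_spec]
  rw [riem, riem, hu, hv]
  linarith

/-- Metric compatibility of the covariant derivative along a map. -/
theorem fderiv_metric_eq_cov {A B : V → W} (hG : IsLocalMetric G (F x))
    (hF : DifferentiableAt ℝ F x) (hA : DifferentiableAt ℝ A x) (hB : DifferentiableAt ℝ B x)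
    (u : V) :
    fderiv ℝ (fun z => G (F z) (A z) (B z)) x u =
      G (F x) (cov G F A x u) (B x) + G (F x) (A x) (cov G F B x u) := by
  rw [fderiv_metric_apply hG.smooth.differentiableAt hF hA hB, hG.fderiv_eq]
  simp only [cov, map_add, add_apply]
  rw [hG.symm (A x) (levi _ _ _ _), hG.levi_spec, hG.levi_spec]
  ring

/-- Covariant derivatives commute at a point in a direction killed by `dF`. -/
theorem cov_cov_comm [CompleteSpace W] {A : V → W} (hG : IsLocalMetric G (F x))
    (hF : SmoothNear F x) (hA : SmoothNear A x) {η : V} (hη : fderiv ℝ F x η = 0) (ξ : V) :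
    cov G F (fun z => cov G F A z ξ) x η = cov G F (fun z => cov G F A z η) x ξ := by
  have d0 := hF.differentiableAt
  have d1 := hF.fderiv.differentiableAt
  have a1 : ∀ a, DifferentiableAt ℝ (fun z => fderiv ℝ F z a) x := fun a =>
    (hF.fderiv.apply_const a).differentiableAt
  have dL : DifferentiableAt ℝ (fun z => levi G (F z)) x :=
    (hG.smooth_levi.comp hF).differentiableAt
  have key : ∀ a b, fderiv ℝ (fun z => cov G F A z a) x b = fderiv ℝ (fderiv ℝ A) x b a +
      (fderiv ℝ (levi G) (F x) (fderiv ℝ F x b) (fderiv ℝ F x a) (A x)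
      + levi G (F x) (fderiv ℝ (fderiv ℝ F) x b a) (A x)
      + levi G (F x) (fderiv ℝ F x a) (fderiv ℝ A x b)) := by
    intro a b
    simp only [cov]
    rw [fderiv_fun_add (hA.fderiv.apply_const a).differentiableAt
      ((dL.clm_apply (a1 a)).clm_apply hA.differentiableAt), add_apply,
      fderiv_clm_apply_const hA.fderiv.differentiableAt,
      fderiv_clm_apply' (dL.clm_apply (a1 a)) hA.differentiableAt,
      fderiv_clm_apply' dL (a1 a), fderiv_comp_apply hG.smooth_levi.differentiableAt d0,
      fderiv_clm_apply_const d1, add_apply]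
  change fderiv ℝ (fun z => cov G F A z ξ) x η
      + levi G (F x) (fderiv ℝ F x η) (cov G F A x ξ) =
    fderiv ℝ (fun z => cov G F A z η) x ξ + levi G (F x) (fderiv ℝ F x ξ) (cov G F A x η)
  -- The commutator is the curvature term R(dF η, dF ξ)A, which vanishes with dF η; the second
  -- derivatives of `A` and `F` agree by symmetry.
  rw [key, key, hA.fderiv_fderiv_symm η ξ, hF.fderiv_fderiv_symm η ξ]
  simp only [cov, hη, map_zero, zero_apply, zero_add, add_zero]
  abel

/-- The form of the curvature with raised index, which is the one that `curvatureCoeff` spells out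
in components. -/
theorem riem_eq [CompleteSpace W] {y u v z w : W} (hG : IsLocalMetric G y) :
    riem G y u v z w = G y (fderiv ℝ (levi G) y u v z - fderiv ℝ (levi G) y v u z
      + levi G y u (levi G y v z) - levi G y v (levi G y u z)) w := by
  have dL := hG.smooth_levi
  have dC := hG.smooth_christ1
  have key : ∀ u v, fderiv ℝ (christ1 G) y u v z w =
      G y (fderiv ℝ (levi G) y u v z + levi G y u (levi G y v z)) w
        + christ1 G y u w (levi G y v z) := by
    intro u v
    have e : (fun y => christ1 G y v z w) =ᶠ[𝓝 y] fun y => G (id y) (levi G y v z) w :=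
      hG.nearby.mono fun y hy => (hy.levi_spec v z w).symm
    rw [← fderiv_clm_apply_const dC.differentiableAt, ← fderiv_clm_apply_const
      (dC.apply_const v).differentiableAt, ← fderiv_clm_apply_const
      ((dC.apply_const v).apply_const z).differentiableAt, e.fderiv_eq,
      fderiv_metric_apply (F := id) hG.smooth.differentiableAt differentiableAt_id
      ((dL.apply_const v).apply_const z).differentiableAt (differentiableAt_const w),
      fderiv_clm_apply_const (dL.apply_const v).differentiableAt,
      fderiv_clm_apply_const dL.differentiableAt]
    simp only [id, fderiv_id, ContinuousLinearMap.id_apply, hG.fderiv_eq, map_add, add_apply,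
      hG.levi_spec, fderiv_fun_const, Pi.zero_apply, zero_apply, map_zero]
    ring
  rw [riem, key, key]
  simp only [map_add, map_sub, add_apply, sub_apply]
  ring

end Pullback

/-! ### Metrics given by matrices: from index formulas to the index-free calculus. -/

section MatrixMetric

variable {n : ℕ}

/-- The `i`-th coordinate. -/
def coordL (i : Fin n) : EuclideanSpace ℝ (Fin n) →L[ℝ] ℝ := EuclideanSpace.proj i

@[simp] theorem coordL_apply (i : Fin n) (u : EuclideanSpace ℝ (Fin n)) : coordL i u = u i := rfl

/-- The bilinear form with a given matrix. -/
def bil (A : Matrix (Fin n) (Fin n) ℝ) :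
    EuclideanSpace ℝ (Fin n) →L[ℝ] EuclideanSpace ℝ (Fin n) →L[ℝ] ℝ :=
  ∑ i, ∑ j, A i j • (coordL i).smulRight (coordL j)

theorem bil_apply (A : Matrix (Fin n) (Fin n) ℝ) (u v : EuclideanSpace ℝ (Fin n)) :
    bil A u v = ∑ i, ∑ j, A i j * (u i * v j) := by
  simp [bil]

theorem bil_single (A : Matrix (Fin n) (Fin n) ℝ) (i j : Fin n) :
    bil A (EuclideanSpace.single i 1) (EuclideanSpace.single j 1) = A i j := by
  simp [bil_apply, PiLp.single_apply]

theorem euclidean_sum_single (u : EuclideanSpace ℝ (Fin n)) :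
    u = ∑ i, u i • EuclideanSpace.single i (1 : ℝ) := by
  ext k; simp [Pi.single_apply]

theorem bil_eq_dotProduct (A : Matrix (Fin n) (Fin n) ℝ) (u v : EuclideanSpace ℝ (Fin n)) :
    bil A u v = u.ofLp ⬝ᵥ (A *ᵥ v.ofLp) := by
  simp only [bil_apply, dotProduct, Matrix.mulVec, Finset.mul_sum]
  refine Finset.sum_congr rfl fun i _ => Finset.sum_congr rfl fun j _ => ?_
  ring

theorem bil_pos {A : Matrix (Fin n) (Fin n) ℝ} (hA : A.PosDef) {u : EuclideanSpace ℝ (Fin n)}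
    (hu : u ≠ 0) : 0 < bil A u u := by
  have h := hA.dotProduct_mulVec_pos (x := u.ofLp) (fun h => hu (by ext i; simp [h]))
  rw [bil_eq_dotProduct]
  simpa using h

theorem posDef_of_bil {A : Matrix (Fin n) (Fin n) ℝ} (hs : ∀ i j, A i j = A j i)
    (hp : ∀ u, u ≠ 0 → 0 < bil A u u) : A.PosDef := by
  refine Matrix.PosDef.of_dotProduct_mulVec_pos (by ext i j; simpa using hs j i) fun x hx => ?_
  have h := hp (WithLp.toLp 2 x) (fun h => hx (by simpa using congrArg WithLp.ofLp h))
  rw [bil_eq_dotProduct] at h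
  simpa using h

theorem posDef_entry_symm {A : Matrix (Fin n) (Fin n) ℝ} (hA : A.PosDef) (i j : Fin n) :
    A i j = A j i := by
  simpa using hA.1.apply j i

theorem bil_symm {A : Matrix (Fin n) (Fin n) ℝ} (hA : A.PosDef)
    (u v : EuclideanSpace ℝ (Fin n)) : bil A u v = bil A v u := by
  rw [bil_apply, bil_apply, Finset.sum_comm]
  refine Finset.sum_congr rfl fun i _ => Finset.sum_congr rfl fun j _ => ?_
  rw [posDef_entry_symm hA j i]; ring

theorem bil_isInvertible {A : Matrix (Fin n) (Fin n) ℝ} (hA : A.PosDef) :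
    (bil A).IsInvertible := by
  have hinj : Function.Injective (bil A) := by
    rw [injective_iff_map_eq_zero]
    intro u hu
    by_contra h
    have := bil_pos hA h
    rw [hu] at this
    simp at this
  have hfin : Module.finrank ℝ (EuclideanSpace ℝ (Fin n)) =
      Module.finrank ℝ (EuclideanSpace ℝ (Fin n) →L[ℝ] ℝ) := by
    rw [← (LinearMap.toContinuousLinearMap (𝕜 := ℝ) (E := EuclideanSpace ℝ (Fin n))
      (F' := ℝ)).finrank_eq]
    exact (Subspace.dual_finrank_eq (K := ℝ) (V := EuclideanSpace ℝ (Fin n))).symm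
  let e := (LinearEquiv.ofInjectiveOfFinrankEq (bil A).toLinearMap hinj hfin)
  exact ⟨e.toContinuousLinearEquiv, by ext; rfl⟩

/-- `Gm` is a smooth field of positive definite matrices near `x`. -/
def IsMatrixMetric (Gm : EuclideanSpace ℝ (Fin n) → Matrix (Fin n) (Fin n) ℝ)
    (x : EuclideanSpace ℝ (Fin n)) : Prop :=
  ∀ᶠ z in 𝓝 x, (∀ i j, ContDiffAt ℝ ∞ (fun y => Gm y i j) z) ∧ (Gm z).PosDef

variable {Gm : EuclideanSpace ℝ (Fin n) → Matrix (Fin n) (Fin n) ℝ}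
  {x : EuclideanSpace ℝ (Fin n)}

theorem IsMatrixMetric.nearby (h : IsMatrixMetric Gm x) : ∀ᶠ z in 𝓝 x, IsMatrixMetric Gm z :=
  h.eventually_nhds

theorem IsMatrixMetric.posDef (h : IsMatrixMetric Gm x) : (Gm x).PosDef := h.self_of_nhds.2

theorem IsMatrixMetric.smooth (h : IsMatrixMetric Gm x) (i j : Fin n) :
    SmoothNear (fun y => Gm y i j) x := h.mono fun _ hz => hz.1 i j

theorem IsMatrixMetric.isLocalMetric (h : IsMatrixMetric Gm x) :
    IsLocalMetric (fun y => bil (Gm y)) x := by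
  filter_upwards [h] with z hz
  refine ⟨?_, bil_symm hz.2, bil_isInvertible hz.2⟩
  simp only [bil]
  exact ContDiffAt.sum fun i _ => ContDiffAt.sum fun j _ => (hz.1 i j).smul contDiffAt_const

theorem IsMatrixMetric.fderiv_single (h : IsMatrixMetric Gm x) (i j l : Fin n) :
    fderiv ℝ (fun y => bil (Gm y)) x (EuclideanSpace.single i 1) (EuclideanSpace.single j 1)
      (EuclideanSpace.single l 1) = pderiv i (fun y => Gm y j l) x := by
  rw [fderiv_apply₂ h.isLocalMetric.smooth.differentiableAt]
  simp only [bil_single, pderiv]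

/-- The half-sum of partial derivatives is `Gm x` applied to the Christoffel vector, and the factor
(G⁻¹)ᵏˡ of the definition undoes that matrix. -/
theorem christoffel_eq (h : IsMatrixMetric Gm x) (k i j : Fin n) :
    christoffel Gm k i j x = levi (fun y => bil (Gm y)) x (EuclideanSpace.single i 1)
      (EuclideanSpace.single j 1) k := by
  have hL := h.isLocalMetric
  set Γ := levi (fun y => bil (Gm y)) x (EuclideanSpace.single i 1)
      (EuclideanSpace.single j 1) with hΓ
  have hl : ∀ l, (1 / 2) * (pderiv i (fun y => Gm y j l) x + pderiv j (fun y => Gm y i l) x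
      - pderiv l (fun y => Gm y i j) x) = ∑ m, Gm x l m * Γ m := by
    intro l
    rw [← h.fderiv_single, ← h.fderiv_single, ← h.fderiv_single, ← christ1_apply, ← hL.levi_spec,
      ← hΓ, bil_symm h.posDef, bil_apply]
    rw [Finset.sum_eq_single l]
    · simp
    · intro b _ hb; simp [hb]
    · simp
  rw [christoffel, Finset.mul_sum]
  calc _ = ∑ l, (Gm x)⁻¹ k l * ∑ m, Gm x l m * Γ m := by
        refine Finset.sum_congr rfl fun l _ => ?_
        rw [← hl]; ring
    _ = ((Gm x)⁻¹ *ᵥ (Gm x *ᵥ Γ.ofLp)) k := rfl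
    _ = Γ k := by
        rw [Matrix.mulVec_mulVec, Matrix.nonsing_inv_mul _ h.posDef.det_pos.ne'.isUnit]
        simp

theorem levi_apply (h : IsMatrixMetric Gm x) (u v : EuclideanSpace ℝ (Fin n)) (k : Fin n) :
    levi (fun y => bil (Gm y)) x u v k = ∑ i, ∑ j, christoffel Gm k i j x * u i * v j := by
  conv_lhs => rw [euclidean_sum_single u, euclidean_sum_single v]
  simp only [map_sum, map_smul, sum_apply, smul_apply, WithLp.ofLp_sum,
    Finset.sum_apply, WithLp.ofLp_smul, Pi.smul_apply, smul_eq_mul, christoffel_eq h]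
  rw [Finset.sum_comm]
  simp only [Finset.mul_sum]
  refine Finset.sum_congr rfl fun i _ => Finset.sum_congr rfl fun j _ => ?_
  ring

theorem sum_curvatureCoeff (h : IsMatrixMetric Gm x) (i j k m : Fin n) :
    ∑ l, Gm x l m * curvatureCoeff Gm i j k l x =
      riem (fun y => bil (Gm y)) x (EuclideanSpace.single i 1) (EuclideanSpace.single j 1)
        (EuclideanSpace.single k 1) (EuclideanSpace.single m 1) := by
  have hL := h.isLocalMetric
  set G := fun y => bil (Gm y) with hG
  set Γ := levi G with hΓ
  have dΓ := hL.smooth_levi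
  let e : Fin n → EuclideanSpace ℝ (Fin n) := fun i => EuclideanSpace.single i 1
  have hder : ∀ i l j k, pderiv i (christoffel Gm l j k) x = fderiv ℝ Γ x (e i) (e j) (e k) l := by
    intro i l j k
    have he : christoffel Gm l j k =ᶠ[𝓝 x] fun y => coordL l (Γ y (e j) (e k)) :=
      h.nearby.mono fun y hy => christoffel_eq hy l j k
    rw [pderiv, he.fderiv_eq, fderiv_comp_apply (K := coordL l) (coordL l).differentiableAt
      ((dΓ.apply_const (e j)).apply_const (e k)).differentiableAt,
      fderiv_clm_apply_const (dΓ.apply_const (e j)).differentiableAt,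
      fderiv_clm_apply_const dΓ.differentiableAt, ContinuousLinearMap.fderiv]
    rfl
  have hΓΓ : ∀ i j l, (Γ x (e i) (Γ x (e j) (e k))) l =
      ∑ m, christoffel Gm l i m x * christoffel Gm m j k x := by
    intro i j l
    conv_lhs => rw [euclidean_sum_single (Γ x (e j) (e k))]
    simp only [map_sum, map_smul, WithLp.ofLp_sum, Finset.sum_apply, WithLp.ofLp_smul,
      Pi.smul_apply, smul_eq_mul, christoffel_eq h]
    exact Finset.sum_congr rfl fun m _ => mul_comm _ _
  rw [riem_eq hL]
  change _ = bil (Gm x) (fderiv ℝ Γ x (e i) (e j) (e k) - fderiv ℝ Γ x (e j) (e i) (e k)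
    + Γ x (e i) (Γ x (e j) (e k)) - Γ x (e j) (Γ x (e i) (e k))) (e m)
  rw [bil_symm h.posDef, bil_apply, Finset.sum_comm]
  refine Finset.sum_congr rfl fun l _ => ?_
  rw [Finset.sum_eq_single m (fun b _ hb => by simp [e, hb]) (by simp), curvatureCoeff,
    Finset.sum_sub_distrib, hder, hder, ← hΓΓ, ← hΓΓ, posDef_entry_symm h.posDef]
  simp only [e, PiLp.single_apply, if_true, one_mul, WithLp.ofLp_sub, WithLp.ofLp_add,
    Pi.sub_apply, Pi.add_apply]
  ring

end MatrixMetric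

/-! ### Volume forms and determinants in dimensions two and three. -/

section Volume

/-- The determinant of three vectors in `ℝ³`. -/
def det3 (a b c : EuclideanSpace ℝ (Fin 3)) : ℝ := (Matrix.of ![a.ofLp, b.ofLp, c.ofLp]).det

/-- The determinant of two vectors in `ℝ²`. -/
def det2 (u v : EuclideanSpace ℝ (Fin 2)) : ℝ := u 0 * v 1 - u 1 * v 0

/-- The volume form of the inner product with matrix `A`. -/
def vol (A : Matrix (Fin 3) (Fin 3) ℝ) (a b c : EuclideanSpace ℝ (Fin 3)) : ℝ :=
  √A.det * det3 a b c

theorem det3_eq (a b c : EuclideanSpace ℝ (Fin 3)) : det3 a b c =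
    b 0 * (a 2 * c 1 - a 1 * c 2) + b 1 * (a 0 * c 2 - a 2 * c 0)
      + b 2 * (a 1 * c 0 - a 0 * c 1) := by
  simp [det3, Matrix.det_fin_three]; ring

/-- Gram determinant: the two factors √det A combine to det A, and P A P'ᵀ is the matrix of mutual
inner products. -/
theorem vol_mul_vol {A : Matrix (Fin 3) (Fin 3) ℝ} (hA : A.PosDef)
    (a b c a' b' c' : EuclideanSpace ℝ (Fin 3)) :
    vol A a b c * vol A a' b' c' =
      bil A a a' * (bil A b b' * bil A c c' - bil A b c' * bil A c b')
      - bil A a b' * (bil A b a' * bil A c c' - bil A b c' * bil A c a')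
      + bil A a c' * (bil A b a' * bil A c b' - bil A b b' * bil A c a') := by
  have h1 : vol A a b c * vol A a' b' c' = (Matrix.of ![a.ofLp, b.ofLp, c.ofLp] * A *
      (Matrix.of ![a'.ofLp, b'.ofLp, c'.ofLp])ᵀ).det := by
    rw [Matrix.det_mul, Matrix.det_mul, Matrix.det_transpose, vol, vol, det3, det3]
    have := Real.mul_self_sqrt hA.det_pos.le
    linear_combination (Matrix.of ![a.ofLp, b.ofLp, c.ofLp]).det *
      (Matrix.of ![a'.ofLp, b'.ofLp, c'.ofLp]).det * this
  have h2 : Matrix.of ![a.ofLp, b.ofLp, c.ofLp] * A *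
      (Matrix.of ![a'.ofLp, b'.ofLp, c'.ofLp])ᵀ =
      !![bil A a a', bil A a b', bil A a c'; bil A b a', bil A b b', bil A b c';
        bil A c a', bil A c b', bil A c c'] := by
    ext i j
    fin_cases i <;> fin_cases j <;>
      simp [Matrix.mul_apply, Matrix.vecMul, dotProduct, bil_apply, Fin.sum_univ_three] <;> ring
  rw [h1, h2, Matrix.det_fin_three]
  simp
  ring

/-- The Lagrange identity in the plane orthogonal to `c`. It yields λ² = det ds², λμ = det h and all
later conversions between inner products and volumes; `a'` and `b'` need not be orthogonal to `c`.
-/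
theorem vol_mul_vol_of_unit {A : Matrix (Fin 3) (Fin 3) ℝ} (hA : A.PosDef)
    {a b c : EuclideanSpace ℝ (Fin 3)} (hc : bil A c c = 1) (ha : bil A a c = 0)
    (hb : bil A b c = 0) (a' b' : EuclideanSpace ℝ (Fin 3)) :
    vol A a b c * vol A a' b' c = bil A a a' * bil A b b' - bil A a b' * bil A b a' := by
  rw [vol_mul_vol hA, hc, ha, hb]; ring

theorem vol_add_middle (A : Matrix (Fin 3) (Fin 3) ℝ) (a b b' c : EuclideanSpace ℝ (Fin 3)) :
    vol A a (b + b') c = vol A a b c + vol A a b' c := by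
  simp only [vol, det3_eq, PiLp.add_apply]; ring

theorem vol_smul_middle (A : Matrix (Fin 3) (Fin 3) ℝ) (r : ℝ) (a b c : EuclideanSpace ℝ (Fin 3)) :
    vol A a (r • b) c = r * vol A a b c := by
  simp only [vol, det3_eq, PiLp.smul_apply, smul_eq_mul]; ring

theorem vol_smul_left (A : Matrix (Fin 3) (Fin 3) ℝ) (r : ℝ) (a b c : EuclideanSpace ℝ (Fin 3)) :
    vol A (r • a) b c = r * vol A a b c := by
  simp only [vol, det3_eq, PiLp.smul_apply, smul_eq_mul]; ring

theorem vol_self (A : Matrix (Fin 3) (Fin 3) ℝ) (a c : EuclideanSpace ℝ (Fin 3)) :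
    vol A a a c = 0 := by
  simp only [vol, det3_eq]; ring

theorem vol_zero_left (A : Matrix (Fin 3) (Fin 3) ℝ) (b c : EuclideanSpace ℝ (Fin 3)) :
    vol A 0 b c = 0 := by
  simp [vol, det3_eq]

theorem vol_linear_pair (A : Matrix (Fin 3) (Fin 3) ℝ)
    (L : EuclideanSpace ℝ (Fin 2) →L[ℝ] EuclideanSpace ℝ (Fin 3)) (c : EuclideanSpace ℝ (Fin 3))
    (u v : EuclideanSpace ℝ (Fin 2)) : vol A (L u) (L v) c =
      det2 u v * vol A (L (EuclideanSpace.single 0 1)) (L (EuclideanSpace.single 1 1)) c := by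
  conv_lhs => rw [euclidean_sum_single u, euclidean_sum_single v]
  simp only [Fin.sum_univ_two, map_add, map_smul, vol, det3_eq, PiLp.add_apply, PiLp.smul_apply,
    smul_eq_mul, det2]
  ring

theorem exists_det2_ne_zero {u : EuclideanSpace ℝ (Fin 2)} (hu : u ≠ 0) : ∃ v, det2 v u ≠ 0 := by
  by_contra! h
  apply hu
  have h0 := h (EuclideanSpace.single 0 1)
  have h1 := h (EuclideanSpace.single 1 1)
  simp [det2] at h0 h1
  ext i; fin_cases i <;> simp [h0, h1]

theorem det2_smul_eq (ξ η u : EuclideanSpace ℝ (Fin 2)) :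
    det2 ξ η • u = det2 u η • ξ + det2 ξ u • η := by
  ext i; fin_cases i <;> simp [det2] <;> ring

theorem eq_det2_combination {ξ η : EuclideanSpace ℝ (Fin 2)} (h : det2 ξ η ≠ 0)
    (u : EuclideanSpace ℝ (Fin 2)) :
    u = (det2 u η / det2 ξ η) • ξ + (det2 ξ u / det2 ξ η) • η := by
  have := det2_smul_eq ξ η u
  rw [div_eq_inv_mul, div_eq_inv_mul, mul_smul, mul_smul, ← smul_add, ← this, smul_smul,
    inv_mul_cancel₀ h, one_smul]

variable {V : Type*} [NormedAddCommGroup V] [NormedSpace ℝ V]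

theorem SmoothNear.vol {A : V → Matrix (Fin 3) (Fin 3) ℝ} {a b c : V → EuclideanSpace ℝ (Fin 3)}
    {x : V} (hA : ∀ i j, SmoothNear (fun z => A z i j) x) (hp : ∀ᶠ z in 𝓝 x, (A z).PosDef)
    (ha : SmoothNear a x) (hb : SmoothNear b x) (hc : SmoothNear c x) :
    SmoothNear (fun z => Front.vol (A z) (a z) (b z) (c z)) x := by
  have hA' : ∀ᶠ z in 𝓝 x, ∀ i j, ContDiffAt ℝ ∞ (fun z => A z i j) z :=
    eventually_all.2 fun i => eventually_all.2 fun j => hA i j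
  filter_upwards [hA', hp, ha, hb, hc] with z hAz hpz haz hbz hcz
  have co : ∀ {a : V → EuclideanSpace ℝ (Fin 3)} (_ : ContDiffAt ℝ ∞ a z) (i : Fin 3),
      ContDiffAt ℝ ∞ (fun y => a y i) z := fun h i => (coordL i).contDiff.contDiffAt.comp z h
  simp only [Front.vol, det3_eq]
  refine ContDiffAt.mul (ContDiffAt.sqrt ?_ hpz.det_pos.ne') ?_
  · simp only [Matrix.det_fin_three]
    have := hAz
    fun_prop
  · have h1 := co haz
    have h2 := co hbz
    have h3 := co hcz
    fun_prop

theorem differentiableAt_det {A : V → Matrix (Fin 3) (Fin 3) ℝ} {x : V}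
    (hA : ∀ i j, DifferentiableAt ℝ (fun z => A z i j) x) :
    DifferentiableAt ℝ (fun z => (A z).det) x := by
  simp only [Matrix.det_fin_three]
  fun_prop

theorem fderiv_mul_of_eq_zero {p q : V → ℝ} {x : V} (hp : DifferentiableAt ℝ p x)
    (hq : DifferentiableAt ℝ q x) (h0 : p x = 0) (u : V) :
    fderiv ℝ (fun z => p z * q z) x u = fderiv ℝ p x u * q x := by
  rw [fderiv_fun_mul hp hq]; simp [h0, mul_comm]

/-- The volume is linear in its middle argument, so where that argument vanishes only its own
derivative contributes; those of the metric and of the other vectors do not enter. -/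
theorem fderiv_vol_of_eq_zero {A : V → Matrix (Fin 3) (Fin 3) ℝ}
    {a b c : V → EuclideanSpace ℝ (Fin 3)} {x : V}
    (hA : DifferentiableAt ℝ (fun z => √(A z).det) x) (ha : DifferentiableAt ℝ a x)
    (hb : DifferentiableAt ℝ b x) (hc : DifferentiableAt ℝ c x) (h0 : b x = 0) (u : V) :
    fderiv ℝ (fun z => vol (A z) (a z) (b z) (c z)) x u =
      vol (A x) (a x) (fderiv ℝ b x u) (c x) := by
  have co : ∀ {a : V → EuclideanSpace ℝ (Fin 3)} (_ : DifferentiableAt ℝ a x) (i : Fin 3),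
      DifferentiableAt ℝ (fun y => a y i) x := fun h i => (coordL i).differentiableAt.comp x h
  have h1 := co ha
  have h2 := co hb
  have h3 := co hc
  have hb0 : ∀ i, fderiv ℝ (fun z => b z i) x u = (fderiv ℝ b x u) i := fun i => by
    have := fderiv_comp_apply (K := coordL i) (coordL i).differentiableAt hb u
    simpa using this
  have e : (fun z => vol (A z) (a z) (b z) (c z)) = fun z =>
      b z 0 * (√(A z).det * (a z 2 * c z 1 - a z 1 * c z 2))
      + b z 1 * (√(A z).det * (a z 0 * c z 2 - a z 2 * c z 0))
      + b z 2 * (√(A z).det * (a z 1 * c z 0 - a z 0 * c z 1)) := by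
    ext z; simp only [vol, det3_eq]; ring
  have z0 : ∀ i, b x i = 0 := fun i => by rw [h0]; rfl
  rw [e, fderiv_fun_add (by fun_prop) (by fun_prop), fderiv_fun_add (by fun_prop) (by fun_prop),
    add_apply, add_apply, fderiv_mul_of_eq_zero (h2 0) (by fun_prop) (z0 0),
    fderiv_mul_of_eq_zero (h2 1) (by fun_prop) (z0 1),
    fderiv_mul_of_eq_zero (h2 2) (by fun_prop) (z0 2), hb0, hb0, hb0, vol, det3_eq]
  ring

end Volume

/-! ### Fronts in coordinates: the densities λ and μ and the second fundamental form. -/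

section LocalFront

/-- The front conditions for a map `F` with normal `N` in coordinates, near a point. -/
structure IsLocalFront (Gm : EuclideanSpace ℝ (Fin 3) → Matrix (Fin 3) (Fin 3) ℝ)
    (F N : EuclideanSpace ℝ (Fin 2) → EuclideanSpace ℝ (Fin 3)) (x : EuclideanSpace ℝ (Fin 2)) :
    Prop where
  metric : IsMatrixMetric Gm (F x)
  smooth : SmoothNear F x
  smooth_normal : SmoothNear N x
  unit : ∀ᶠ z in 𝓝 x, bil (Gm (F z)) (N z) (N z) = 1
  orthogonal : ∀ᶠ z in 𝓝 x, ∀ u, bil (Gm (F z)) (fderiv ℝ F z u) (N z) = 0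
  immersion : ∀ᶠ z in 𝓝 x, ∀ u, fderiv ℝ F z u = 0 → fderiv ℝ N z u = 0 → u = 0

variable (Gm : EuclideanSpace ℝ (Fin 3) → Matrix (Fin 3) (Fin 3) ℝ)
  (F N : EuclideanSpace ℝ (Fin 2) → EuclideanSpace ℝ (Fin 3)) (x : EuclideanSpace ℝ (Fin 2))

/-- The covariant derivative of the normal. -/
def covN (u : EuclideanSpace ℝ (Fin 2)) : EuclideanSpace ℝ (Fin 3) :=
  cov (fun y => bil (Gm y)) F N x u

/-- The second fundamental form in coordinates. -/
def sff (u v : EuclideanSpace ℝ (Fin 2)) : ℝ :=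
  - bil (Gm (F x)) (fderiv ℝ F x u) (covN Gm F N x v)

/-- The signed area density in coordinates. -/
def density : ℝ :=
  vol (Gm (F x)) (fderiv ℝ F x (EuclideanSpace.single 0 1))
    (fderiv ℝ F x (EuclideanSpace.single 1 1)) (N x)

/-- The signed area density of the normal in coordinates. -/
def normalDensity : ℝ :=
  vol (Gm (F x)) (covN Gm F N x (EuclideanSpace.single 0 1))
    (covN Gm F N x (EuclideanSpace.single 1 1)) (N x)

variable {Gm F N x}

theorem vol_fderiv (ξ η : EuclideanSpace ℝ (Fin 2)) :
    vol (Gm (F x)) (fderiv ℝ F x ξ) (fderiv ℝ F x η) (N x) = det2 ξ η * density Gm F N x :=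
  vol_linear_pair _ _ _ _ _

/-- The covariant derivative of the normal as a linear map. -/
def covNL (Gm : EuclideanSpace ℝ (Fin 3) → Matrix (Fin 3) (Fin 3) ℝ)
    (F N : EuclideanSpace ℝ (Fin 2) → EuclideanSpace ℝ (Fin 3)) (x : EuclideanSpace ℝ (Fin 2)) :
    EuclideanSpace ℝ (Fin 2) →L[ℝ] EuclideanSpace ℝ (Fin 3) :=
  fderiv ℝ N x + ((levi (fun y => bil (Gm y)) (F x)).flip (N x)) ∘L fderiv ℝ F x

theorem covN_eq (u : EuclideanSpace ℝ (Fin 2)) : covN Gm F N x u = covNL Gm F N x u := rfl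

theorem vol_covN (ξ η : EuclideanSpace ℝ (Fin 2)) :
    vol (Gm (F x)) (covN Gm F N x ξ) (covN Gm F N x η) (N x) =
      det2 ξ η * normalDensity Gm F N x :=
  vol_linear_pair _ (covNL Gm F N x) _ _ _

theorem sff_combination (a b c d : ℝ) (u v : EuclideanSpace ℝ (Fin 2)) :
    sff Gm F N x (a • u + b • v) (c • u + d • v) =
      a * c * sff Gm F N x u u + a * d * sff Gm F N x u v + b * c * sff Gm F N x v u
        + b * d * sff Gm F N x v v := by
  simp only [sff, covN_eq, map_add, map_smul, add_apply, smul_apply, smul_eq_mul]; ring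

namespace IsLocalFront

theorem nearby (h : IsLocalFront Gm F N x) : ∀ᶠ z in 𝓝 x, IsLocalFront Gm F N z := by
  filter_upwards [h.smooth.continuousAt.eventually h.metric.nearby, h.smooth.nearby,
    h.smooth_normal.nearby, h.unit.eventually_nhds, h.orthogonal.eventually_nhds,
    h.immersion.eventually_nhds] with z h1 h2 h3 h4 h5 h6 using ⟨h1, h2, h3, h4, h5, h6⟩

theorem posDef (h : IsLocalFront Gm F N x) : (Gm (F x)).PosDef := h.metric.posDef

theorem normal_unit (h : IsLocalFront Gm F N x) : bil (Gm (F x)) (N x) (N x) = 1 :=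
  h.unit.self_of_nhds

theorem orth (h : IsLocalFront Gm F N x) (u : EuclideanSpace ℝ (Fin 2)) :
    bil (Gm (F x)) (fderiv ℝ F x u) (N x) = 0 := h.orthogonal.self_of_nhds u

theorem covN_orth (h : IsLocalFront Gm F N x) (u : EuclideanSpace ℝ (Fin 2)) :
    bil (Gm (F x)) (covN Gm F N x u) (N x) = 0 := by
  have h1 := fderiv_metric_eq_cov h.metric.isLocalMetric h.smooth.differentiableAt
    h.smooth_normal.differentiableAt h.smooth_normal.differentiableAt u
  have h2 : (fun z => bil (Gm (F z)) (N z) (N z)) =ᶠ[𝓝 x] fun _ => 1 := h.unit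
  rw [h2.fderiv_eq] at h1
  simp only [fderiv_fun_const, Pi.zero_apply, zero_apply] at h1
  rw [bil_symm h.posDef (N x)] at h1
  change bil (Gm (F x)) (cov _ F N x u) (N x) = 0
  linarith

/-- Differentiate ⟨dF u, N⟩ = 0 in the direction `v`. Symmetry of h follows, at singular points too.
-/
theorem sff_eq_hess (h : IsLocalFront Gm F N x) (u v : EuclideanSpace ℝ (Fin 2)) :
    sff Gm F N x u v = bil (Gm (F x)) (hess (fun y => bil (Gm y)) F x u v) (N x) := by
  have h1 := fderiv_metric_eq_cov h.metric.isLocalMetric h.smooth.differentiableAt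
    (h.smooth.fderiv.apply_const u).differentiableAt h.smooth_normal.differentiableAt v
  have h2 : (fun z => bil (Gm (F z)) (fderiv ℝ F z u) (N z)) =ᶠ[𝓝 x] fun _ => 0 :=
    h.orthogonal.mono fun z hz => hz u
  rw [h2.fderiv_eq, cov_fderiv h.smooth, hess_symm h.metric.isLocalMetric h.smooth] at h1
  simp only [fderiv_fun_const, Pi.zero_apply, zero_apply] at h1
  rw [sff, covN]
  linarith

theorem sff_symm (h : IsLocalFront Gm F N x) (u v : EuclideanSpace ℝ (Fin 2)) :
    sff Gm F N x u v = sff Gm F N x v u := by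
  rw [h.sff_eq_hess, h.sff_eq_hess, hess_symm h.metric.isLocalMetric h.smooth]

/-- The identity λμ = det h, by the Lagrange identity for dF and DN, both orthogonal to the normal.
Division by λ² = det ds² gives K_ext = μ/λ at regular points. -/
theorem density_mul_normalDensity (h : IsLocalFront Gm F N x) :
    density Gm F N x * normalDensity Gm F N x =
      sff Gm F N x (EuclideanSpace.single 0 1) (EuclideanSpace.single 0 1) *
        sff Gm F N x (EuclideanSpace.single 1 1) (EuclideanSpace.single 1 1) -
      sff Gm F N x (EuclideanSpace.single 0 1) (EuclideanSpace.single 1 1) *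
        sff Gm F N x (EuclideanSpace.single 1 1) (EuclideanSpace.single 0 1) := by
  rw [density, normalDensity, vol_mul_vol_of_unit h.posDef h.normal_unit (h.orth _) (h.orth _)]
  simp only [sff]; ring

theorem sq_density (h : IsLocalFront Gm F N x) :
    density Gm F N x ^ 2 =
      bil (Gm (F x)) (fderiv ℝ F x (EuclideanSpace.single 0 1))
          (fderiv ℝ F x (EuclideanSpace.single 0 1)) *
        bil (Gm (F x)) (fderiv ℝ F x (EuclideanSpace.single 1 1))
          (fderiv ℝ F x (EuclideanSpace.single 1 1)) -
      bil (Gm (F x)) (fderiv ℝ F x (EuclideanSpace.single 0 1))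
          (fderiv ℝ F x (EuclideanSpace.single 1 1)) *
        bil (Gm (F x)) (fderiv ℝ F x (EuclideanSpace.single 1 1))
          (fderiv ℝ F x (EuclideanSpace.single 0 1)) := by
  rw [sq, density, vol_mul_vol_of_unit h.posDef h.normal_unit (h.orth _) (h.orth _)]

theorem density_eq_zero_iff (h : IsLocalFront Gm F N x) :
    density Gm F N x = 0 ↔ ¬ Function.Injective (fderiv ℝ F x) := by
  constructor
  · intro h0 hinj
    set a := fderiv ℝ F x (EuclideanSpace.single 0 1) with ha
    set b := fderiv ℝ F x (EuclideanSpace.single 1 1) with hb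
    set A := Gm (F x) with hA
    have hp : A.PosDef := h.posDef
    have hsq : bil A a a * bil A b b - bil A a b * bil A b a = 0 := by
      rw [← h.sq_density, h0]; ring
    have hne : a ≠ 0 := by
      intro ha0
      have := hinj (ha0.trans (map_zero (fderiv ℝ F x)).symm)
      simp at this
    -- The squared length of this vector is |a|² times the Gram determinant of a, b, hence zero. It
    -- is the image of a vector whose second coordinate is |a|² ≠ 0, contradicting injectivity.
    have hw : bil A a a • b - bil A a b • a = 0 := by
      by_contra hw
      have := bil_pos hp hw
      simp only [map_sub, map_smul, sub_apply, smul_apply, smul_eq_mul] at this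
      rw [bil_symm hp b a] at this hsq
      have e : bil A a a * (bil A a a * (bil A b b) - bil A a b * bil A a b) = 0 := by
        rw [mul_comm (bil A a b)] at hsq ⊢; rw [hsq, mul_zero]
      nlinarith
    have h2 : fderiv ℝ F x (bil A a a • EuclideanSpace.single 1 1
        - bil A a b • EuclideanSpace.single 0 1) = 0 := by
      rw [map_sub, map_smul, map_smul, ← ha, ← hb, hw]
    have h3 := hinj (h2.trans (map_zero (fderiv ℝ F x)).symm)
    have h4 := congrArg (coordL 1) h3
    simp at h4
    exact (bil_pos hp hne).ne' h4
  · intro hinj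
    rw [injective_iff_map_eq_zero] at hinj
    push Not at hinj
    obtain ⟨u, hu, hu0⟩ := hinj
    obtain ⟨v, hv⟩ := exists_det2_ne_zero hu0
    have := vol_fderiv (Gm := Gm) (F := F) (N := N) (x := x) u v
    rw [hu, vol_zero_left] at this
    have hv' : det2 u v ≠ 0 := fun e => hv (by simp only [det2] at e ⊢; linarith)
    exact (mul_eq_zero.1 this.symm).resolve_left hv'

theorem metric_entries (h : IsLocalFront Gm F N x) (i j : Fin 3) :
    SmoothNear (fun z => Gm (F z) i j) x :=
  SmoothNear.comp (K := fun y => Gm y i j) (h.metric.smooth i j) h.smooth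

theorem eventually_posDef (h : IsLocalFront Gm F N x) : ∀ᶠ z in 𝓝 x, (Gm (F z)).PosDef :=
  h.nearby.mono fun _ hz => hz.posDef

theorem smooth_metric (h : IsLocalFront Gm F N x) :
    SmoothNear (fun z => bil (Gm (F z))) x :=
  SmoothNear.comp (K := fun y => bil (Gm y)) h.metric.isLocalMetric.smooth h.smooth

theorem smooth_covN (h : IsLocalFront Gm F N x) (u : EuclideanSpace ℝ (Fin 2)) :
    SmoothNear (fun z => covN Gm F N z u) x := by
  have hΓ := SmoothNear.comp (K := levi fun y => bil (Gm y))
    h.metric.isLocalMetric.smooth_levi h.smooth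
  filter_upwards [hΓ, h.smooth.fderiv.apply_const u, h.smooth_normal,
    h.smooth_normal.fderiv.apply_const u] with z h1 h2 h3 h4
  exact h4.add ((h1.clm_apply h2).clm_apply h3)

theorem smooth_density (h : IsLocalFront Gm F N x) : SmoothNear (density Gm F N) x :=
  SmoothNear.vol h.metric_entries h.eventually_posDef (h.smooth.fderiv.apply_const _)
    (h.smooth.fderiv.apply_const _) h.smooth_normal

theorem smooth_normalDensity (h : IsLocalFront Gm F N x) : SmoothNear (normalDensity Gm F N) x :=
  SmoothNear.vol h.metric_entries h.eventually_posDef (h.smooth_covN _) (h.smooth_covN _)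
    h.smooth_normal

theorem smooth_sff (h : IsLocalFront Gm F N x) (u v : EuclideanSpace ℝ (Fin 2)) :
    SmoothNear (fun z => sff Gm F N z u v) x := by
  filter_upwards [h.smooth_metric, h.smooth.fderiv.apply_const u, h.smooth_covN v] with z h1 h2 h3
  exact ((h1.clm_apply h2).clm_apply h3).neg

theorem hess_of_null {G : EuclideanSpace ℝ (Fin 3) → _} {η : EuclideanSpace ℝ (Fin 2)}
    (hη : fderiv ℝ F x η = 0) (u : EuclideanSpace ℝ (Fin 2)) :
    hess G F x u η = fderiv ℝ (fderiv ℝ F) x u η := by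
  simp [hess, hη]

/-- Near x, det(ξ, η)·λ is the volume of (dF ξ, dF η, N) with constant ξ, η. As dF η vanishes at x,
only its derivative survives, and there it is the covariant one. -/
theorem fderiv_density (h : IsLocalFront Gm F N x) {η : EuclideanSpace ℝ (Fin 2)}
    (hη : fderiv ℝ F x η = 0) (ξ u : EuclideanSpace ℝ (Fin 2)) :
    det2 ξ η * fderiv ℝ (density Gm F N) x u =
      vol (Gm (F x)) (fderiv ℝ F x ξ) (hess (fun y => bil (Gm y)) F x u η) (N x) := by
  have hA : DifferentiableAt ℝ (fun z => √(Gm (F z)).det) x := by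
    have hd : DifferentiableAt ℝ (fun z => (Gm (F z)).det) x :=
      differentiableAt_det (A := fun z => Gm (F z))
        fun i j => (h.metric_entries i j).differentiableAt
    exact hd.sqrt h.posDef.det_pos.ne'
  have h1 := fderiv_vol_of_eq_zero hA (h.smooth.fderiv.apply_const ξ).differentiableAt
    (h.smooth.fderiv.apply_const η).differentiableAt h.smooth_normal.differentiableAt hη u
  rw [fderiv_clm_apply_const h.smooth.fderiv.differentiableAt, ← hess_of_null hη
    (G := fun y => bil (Gm y))] at h1
  rw [← h1]
  simp only [vol_fderiv]
  rw [fderiv_const_mul h.smooth_density.differentiableAt]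
  rfl

/-- Non-degeneracy forces dF to have rank one: if dF vanished on ξ too, dλ would be zero. -/
theorem fderiv_ne_zero (h : IsLocalFront Gm F N x) {η ξ u : EuclideanSpace ℝ (Fin 2)}
    (hη : fderiv ℝ F x η = 0) (hξ : det2 ξ η ≠ 0) (hu : fderiv ℝ (density Gm F N) x u ≠ 0) :
    fderiv ℝ F x ξ ≠ 0 := by
  intro h0
  have := h.fderiv_density hη ξ u
  rw [h0, vol_zero_left] at this
  exact mul_ne_zero hξ hu this

/-- This is where the immersion property of (f, ν) enters: in a null direction the covariant and the
ordinary derivative of the normal coincide. -/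
theorem covN_ne_zero (h : IsLocalFront Gm F N x) {η : EuclideanSpace ℝ (Fin 2)}
    (hη : fderiv ℝ F x η = 0) (hη0 : η ≠ 0) : covN Gm F N x η ≠ 0 := by
  intro h0
  refine hη0 (h.immersion.self_of_nhds η hη ?_)
  rw [← h0, covN, cov, hη]
  simp

theorem exists_null (h : IsLocalFront Gm F N x) (h0 : density Gm F N x = 0) :
    ∃ η, η ≠ 0 ∧ fderiv ℝ F x η = 0 := by
  rw [h.density_eq_zero_iff, injective_iff_map_eq_zero] at h0
  push Not at h0
  obtain ⟨u, hu, hu0⟩ := h0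
  exact ⟨u, hu0, hu⟩

theorem sff_null_right (h : IsLocalFront Gm F N x) {η : EuclideanSpace ℝ (Fin 2)}
    (hη : fderiv ℝ F x η = 0) (u : EuclideanSpace ℝ (Fin 2)) : sff Gm F N x u η = 0 := by
  rw [h.sff_symm, sff, hη]; simp

/-- Since h(ξ, η) = 0, dF ξ and D_η N are orthogonal, so the Lagrange identity has a single product.
It turns inner products with D_η N, which arise from derivatives of h, into volumes with dF ξ, which
occur in dλ and in κ_s. -/
theorem vol_covN_null (h : IsLocalFront Gm F N x) {η : EuclideanSpace ℝ (Fin 2)}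
    (hη : fderiv ℝ F x η = 0) (ξ : EuclideanSpace ℝ (Fin 2)) (w : EuclideanSpace ℝ (Fin 3)) :
    vol (Gm (F x)) (fderiv ℝ F x ξ) (covN Gm F N x η) (N x) *
      vol (Gm (F x)) (fderiv ℝ F x ξ) w (N x) =
    bil (Gm (F x)) (fderiv ℝ F x ξ) (fderiv ℝ F x ξ) * bil (Gm (F x)) w (covN Gm F N x η) := by
  have h1 : bil (Gm (F x)) (fderiv ℝ F x ξ) (covN Gm F N x η) = 0 := by
    have := h.sff_null_right hη ξ
    rw [sff] at this; linarith
  rw [vol_mul_vol_of_unit h.posDef h.normal_unit (h.orth _) (h.covN_orth _),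
    bil_symm h.posDef _ (fderiv ℝ F x ξ),
    bil_symm h.posDef (covN Gm F N x η) (fderiv ℝ F x ξ), h1, bil_symm h.posDef w]
  ring

/-- The two densities vanish simultaneously at a non-degenerate singular point exactly when the
second fundamental form vanishes. -/
theorem normalDensity_eq_zero_iff (h : IsLocalFront Gm F N x) (h0 : density Gm F N x = 0)
    {u : EuclideanSpace ℝ (Fin 2)} (hu : fderiv ℝ (density Gm F N) x u ≠ 0) :
    normalDensity Gm F N x = 0 ↔ ∀ v w, sff Gm F N x v w = 0 := by
  obtain ⟨η, hη0, hη⟩ := h.exists_null h0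
  obtain ⟨ξ, hξ⟩ := exists_det2_ne_zero hη0
  have ha := bil_pos h.posDef (h.fderiv_ne_zero hη hξ hu)
  have hm := bil_pos h.posDef (h.covN_ne_zero hη hη0)
  have h1 : bil (Gm (F x)) (fderiv ℝ F x ξ) (covN Gm F N x η) = 0 := by
    have := h.sff_null_right hη ξ
    rw [sff] at this; linarith
  -- The second factor is det(ξ, η)·μ, so μ and h(ξ, ξ) vanish together once the first factor is
  -- known to be nonzero. All entries of h involving η vanish anyway.
  have h2 : vol (Gm (F x)) (fderiv ℝ F x ξ) (covN Gm F N x η) (N x) *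
      vol (Gm (F x)) (covN Gm F N x ξ) (covN Gm F N x η) (N x) =
      - sff Gm F N x ξ ξ * bil (Gm (F x)) (covN Gm F N x η) (covN Gm F N x η) := by
    rw [vol_mul_vol_of_unit h.posDef h.normal_unit (h.orth _) (h.covN_orth _), h1, sff]; ring
  have h3 := h.vol_covN_null hη ξ (covN Gm F N x η)
  have h4 : vol (Gm (F x)) (fderiv ℝ F x ξ) (covN Gm F N x η) (N x) ≠ 0 := by
    intro e; rw [e, zero_mul] at h3; exact (mul_pos ha hm).ne h3
  rw [vol_covN] at h2
  constructor
  · intro hn v w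
    rw [hn, mul_zero, mul_zero] at h2
    have h5 : sff Gm F N x ξ ξ = 0 := by
      rcases mul_eq_zero.1 h2.symm with e | e
      · linarith
      · exact absurd e hm.ne'
    rw [eq_det2_combination hξ v, eq_det2_combination hξ w, sff_combination, h5,
      h.sff_null_right hη, h.sff_null_right hη, h.sff_symm η ξ, h.sff_null_right hη]
    ring
  · intro hs
    rw [hs] at h2
    simpa [h4, hξ] using h2

end IsLocalFront
end LocalFront

/-! ### Real functions of two variables near a regular zero. -/

section PlaneAnalysis

variable {l m : EuclideanSpace ℝ (Fin 2) → ℝ} {x : EuclideanSpace ℝ (Fin 2)}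

theorem det2_ne_zero_of_linear (L : EuclideanSpace ℝ (Fin 2) →L[ℝ] ℝ)
    {ξ u : EuclideanSpace ℝ (Fin 2)} (hξ : ξ ≠ 0) (h0 : L ξ = 0) (hu : L u ≠ 0) :
    det2 ξ u ≠ 0 := by
  intro hd
  obtain ⟨v, hv⟩ := exists_det2_ne_zero hξ
  have h1 := congrArg L (det2_smul_eq v ξ u)
  have : det2 u ξ = 0 := by simp only [det2] at hd ⊢; linarith
  simp only [map_smul, map_add, h0, this, smul_eq_mul] at h1
  exact mul_ne_zero hv hu (by linarith)

theorem hasDerivAt_line (hl : DifferentiableAt ℝ l x) (u : EuclideanSpace ℝ (Fin 2)) :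
    HasDerivAt (fun s : ℝ => l (x + s • u)) (fderiv ℝ l x u) 0 := by
  have h1 : HasDerivAt (fun s : ℝ => x + s • u) u 0 := by
    simpa using ((hasDerivAt_id (0 : ℝ)).smul_const u).const_add x
  have h2 : HasFDerivAt l (fderiv ℝ l x) (x + (0 : ℝ) • u) := by simpa using hl.hasFDerivAt
  exact h2.comp_hasDerivAt 0 h1

theorem tendsto_line (x u : EuclideanSpace ℝ (Fin 2)) :
    Tendsto (fun s : ℝ => x + s • u) (𝓝[≠] 0) (𝓝 x) := by
  have : Continuous (fun s : ℝ => x + s • u) := by fun_prop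
  have h := this.tendsto 0
  simp only [zero_smul, add_zero] at h
  exact h.mono_left nhdsWithin_le_nhds

/-- A function vanishing along the regular zero curve of `l` is bounded by a multiple of `l`. -/
theorem exists_abs_le_of_eq_zero_on_curve (hl : ContDiffAt ℝ ∞ l x) (hm : ContDiffAt ℝ ∞ m x)
    {c : ℝ → EuclideanSpace ℝ (Fin 2)} {t : ℝ} (hc : ContDiffAt ℝ ∞ c t) (hcx : c t = x)
    (hc' : deriv c t ≠ 0) {u : EuclideanSpace ℝ (Fin 2)} (hu : fderiv ℝ l x u ≠ 0)
    (hlc : ∀ᶠ s in 𝓝 t, l (c s) = 0) (hmc : ∀ᶠ s in 𝓝 t, m (c s) = 0) :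
    ∃ C, ∀ᶠ y in 𝓝 x, |m y| ≤ C * |l y| := by
  have hls := hl.hasStrictFDerivAt (by simp)
  have hms := hm.hasStrictFDerivAt (by simp)
  have hcs := hc.hasStrictDerivAt (by simp)
  have hdl : fderiv ℝ l x (deriv c t) = 0 := by
    have h1 : HasDerivAt (fun s => l (c s)) (fderiv ℝ l x (deriv c t)) t := by
      have h2 : HasFDerivAt l (fderiv ℝ l x) (c t) := by rw [hcx]; exact hls.hasFDerivAt
      exact h2.comp_hasDerivAt t hcs.hasDerivAt
    have h3 : (fun s => l (c s)) =ᶠ[𝓝 t] fun _ => 0 := hlc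
    exact h1.unique ((hasDerivAt_const t (0 : ℝ)).congr_of_eventuallyEq h3)
  have hdet := det2_ne_zero_of_linear _ hc' hdl hu
  have hu0 : 0 < ‖u‖ := by
    rw [norm_pos_iff]; rintro rfl; simp at hu
  -- The map (s, r) ↦ c(s) + r u has surjective derivative because `u` is transversal to the curve,
  -- so every point near x has this form. Both functions are then estimated along the segment from
  -- c(s).
  have hΦ : HasStrictFDerivAt (fun p : ℝ × ℝ => c p.1 + p.2 • u)
      (((ContinuousLinearMap.fst ℝ ℝ ℝ).smulRight (deriv c t)) +
        (ContinuousLinearMap.snd ℝ ℝ ℝ).smulRight u) (t, 0) := by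
    refine HasStrictFDerivAt.add ?_ ?_
    · have := hcs.hasStrictFDerivAt.comp (t, (0 : ℝ)) (hasStrictFDerivAt_fst (𝕜 := ℝ))
      convert this using 1
      ext <;> simp
    · exact (ContinuousLinearMap.snd ℝ ℝ ℝ).hasStrictFDerivAt.smul_const u
  have hmap := hΦ.map_nhds_eq_of_surj (by
    rw [LinearMap.range_eq_top]
    intro y
    refine ⟨(det2 y u / det2 (deriv c t) u, det2 (deriv c t) y / det2 (deriv c t) u), ?_⟩
    exact (eq_det2_combination hdet y).symm)
  simp only [zero_smul, add_zero, hcx] at hmap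
  set k := |fderiv ℝ l x u| with hk
  have hk0 : 0 < k := abs_pos.2 hu
  -- With this error constant the linear term keeps half its size: |l(c(s) + r u)| ≥ (k/2)|r|. The
  -- Lipschitz bound gives |m(c(s) + r u)| ≤ K‖u‖|r|, whence the constant K‖u‖·2/k.
  have e1 := hls.isLittleO.def (c := k / (2 * ‖u‖)) (by positivity)
  obtain ⟨K, s, hs, hK⟩ := hms.exists_lipschitzOnWith
  have e2 : ∀ᶠ p : EuclideanSpace ℝ (Fin 2) × EuclideanSpace ℝ (Fin 2) in 𝓝 (x, x),
      p.1 ∈ s ∧ p.2 ∈ s := by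
    rw [nhds_prod_eq]; exact Filter.prod_mem_prod hs hs
  have hcont : Tendsto (fun p : ℝ × ℝ => (c p.1 + p.2 • u, c p.1)) (𝓝 (t, 0)) (𝓝 (x, x)) := by
    have h1 : ContinuousAt (fun p : ℝ × ℝ => c p.1 + p.2 • u) (t, 0) :=
      hΦ.hasFDerivAt.continuousAt
    have h2 : ContinuousAt (fun p : ℝ × ℝ => c p.1) (t, 0) :=
      ContinuousAt.comp (f := Prod.fst) (g := c) hc.continuousAt continuousAt_fst
    have := h1.prodMk h2
    simpa [ContinuousAt, hcx] using this
  have hfst : Tendsto (fun p : ℝ × ℝ => p.1) (𝓝 (t, 0)) (𝓝 t) := continuousAt_fst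
  refine ⟨K * ‖u‖ * (2 / k), ?_⟩
  rw [← hmap, eventually_map]
  filter_upwards [hcont.eventually e1, hcont.eventually e2, hfst.eventually hlc,
    hfst.eventually hmc] with p h1 h2 h3 h4
  simp only [h3, add_sub_cancel_left, sub_zero, map_smul, smul_eq_mul, norm_smul,
    Real.norm_eq_abs] at h1
  have h5 := hK.dist_le_mul _ h2.1 _ h2.2
  rw [h4, Real.dist_eq, dist_eq_norm, add_sub_cancel_left, norm_smul, sub_zero,
    Real.norm_eq_abs] at h5
  have h6 : k / (2 * ‖u‖) * (|p.2| * ‖u‖) = k / 2 * |p.2| := by field_simp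
  rw [h6] at h1
  have h7 : |p.2| * k ≤ |l (c p.1 + p.2 • u)| + k / 2 * |p.2| := by
    have h8 := abs_sub_abs_le_abs_sub (p.2 * fderiv ℝ l x u) (l (c p.1 + p.2 • u))
    rw [abs_mul, abs_sub_comm] at h8
    rw [hk] at h1 ⊢
    linarith
  have h9 : |p.2| ≤ 2 / k * |l (c p.1 + p.2 • u)| := by
    rw [div_mul_eq_mul_div, le_div_iff₀ hk0]; linarith
  calc _ ≤ K * (|p.2| * ‖u‖) := h5
    _ ≤ K * (2 / k * |l (c p.1 + p.2 • u)| * ‖u‖) := by gcongr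
    _ = _ := by ring

/-- Along the line through x in direction `u`, `l` is nonzero off x and tends to 0, so the bound
forces m to tend to 0. -/
theorem eq_zero_of_bounded_quotient (hl : DifferentiableAt ℝ l x) (hm : ContinuousAt m x)
    (h0 : l x = 0) {u : EuclideanSpace ℝ (Fin 2)} (hu : fderiv ℝ l x u ≠ 0) {C : ℝ}
    (hb : ∀ᶠ y in 𝓝 x, l y ≠ 0 → |m y| ≤ C * |l y|) : m x = 0 := by
  have hne : ∀ᶠ s : ℝ in 𝓝[≠] 0, l (x + s • u) ≠ 0 := (hasDerivAt_line hl u).eventually_ne hu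
  have hT := tendsto_line x u
  have h1 : Tendsto (fun s : ℝ => |m (x + s • u)|) (𝓝[≠] 0) (𝓝 |m x|) := (hm.tendsto.comp hT).abs
  have h2 : Tendsto (fun s : ℝ => C * |l (x + s • u)|) (𝓝[≠] 0) (𝓝 (C * |l x|)) :=
    ((hl.continuousAt.tendsto.comp hT).abs).const_mul C
  have h3 : |m x| ≤ C * |l x| := by
    refine le_of_tendsto_of_tendsto h1 h2 ?_
    filter_upwards [hne, hT.eventually hb] with s h1 h2 using h2 h1
  rw [h0, abs_zero, mul_zero] at h3
  exact abs_nonpos_iff.1 h3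

/-- If m(x) ≠ 0, then `l` would have constant sign near x, hence a local extremum at its zero x,
against dl ≠ 0. -/
theorem eq_zero_of_mul_nonneg (hm : ContinuousAt m x)
    (h0 : l x = 0) {u : EuclideanSpace ℝ (Fin 2)} (hu : fderiv ℝ l x u ≠ 0)
    (hb : ∀ᶠ y in 𝓝 x, 0 ≤ l y * m y) : m x = 0 := by
  rcases lt_trichotomy (m x) 0 with hneg | hz | hpos
  · have : IsLocalMax l x := by
      filter_upwards [hb, hm.eventually_lt_const hneg] with y h1 h2
      rw [h0]; by_contra! h3
      exact (mul_neg_of_pos_of_neg h3 h2).not_ge h1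
    rw [this.fderiv_eq_zero] at hu; simp at hu
  · exact hz
  · have : IsLocalMin l x := by
      filter_upwards [hb, hm.eventually_const_lt hpos] with y h1 h2
      rw [h0]; by_contra! h3
      exact (mul_neg_of_neg_of_pos h3 h2).not_ge h1
    rw [this.fderiv_eq_zero] at hu; simp at hu

/-- All five functions vanish at 0; divide the inequality by s² and let s → 0. Only first
derivatives are needed. -/
theorem deriv_det_ge {a b d e l : ℝ → ℝ} {a' b' d' e' l' δ : ℝ} (ha : HasDerivAt a a' 0)
    (hb : HasDerivAt b b' 0) (hd : HasDerivAt d d' 0) (he : HasDerivAt e e' 0)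
    (hl : HasDerivAt l l' 0) (ha0 : a 0 = 0) (hb0 : b 0 = 0) (hd0 : d 0 = 0) (he0 : e 0 = 0)
    (hl0 : l 0 = 0) (h : ∀ᶠ s in 𝓝[≠] 0, δ * l s ^ 2 ≤ a s * b s - d s * e s) :
    δ * l' ^ 2 ≤ a' * b' - d' * e' := by
  have T : ∀ {f : ℝ → ℝ} {f' : ℝ}, HasDerivAt f f' 0 → f 0 = 0 →
      Tendsto (fun s => s⁻¹ * f s) (𝓝[≠] 0) (𝓝 f') := fun h h0 => by
    simpa [h0] using h.tendsto_slope_zero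
  refine le_of_tendsto_of_tendsto (((T hl hl0).pow 2).const_mul δ)
    (((T ha ha0).mul (T hb hb0)).sub ((T hd hd0).mul (T he he0))) ?_
  filter_upwards [h] with s hs
  have := mul_le_mul_of_nonneg_left hs (sq_nonneg s⁻¹)
  linarith

end PlaneAnalysis

/-! ### The curvature inequality to second order at a point where h vanishes. -/

variable {Gm : EuclideanSpace ℝ (Fin 3) → Matrix (Fin 3) (Fin 3) ℝ}
  {F N : EuclideanSpace ℝ (Fin 2) → EuclideanSpace ℝ (Fin 3)} {x : EuclideanSpace ℝ (Fin 2)}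

/-- The determinant of the second fundamental form in the standard basis. -/
def detSff (Gm : EuclideanSpace ℝ (Fin 3) → Matrix (Fin 3) (Fin 3) ℝ)
    (F N : EuclideanSpace ℝ (Fin 2) → EuclideanSpace ℝ (Fin 3)) (x : EuclideanSpace ℝ (Fin 2)) :
    ℝ :=
  sff Gm F N x (EuclideanSpace.single 0 1) (EuclideanSpace.single 0 1) *
    sff Gm F N x (EuclideanSpace.single 1 1) (EuclideanSpace.single 1 1) -
  sff Gm F N x (EuclideanSpace.single 0 1) (EuclideanSpace.single 1 1) *
    sff Gm F N x (EuclideanSpace.single 1 1) (EuclideanSpace.single 0 1)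

theorem sff_det (ξ η : EuclideanSpace ℝ (Fin 2)) :
    sff Gm F N x ξ ξ * sff Gm F N x η η - sff Gm F N x ξ η * sff Gm F N x η ξ =
      det2 ξ η ^ 2 * detSff Gm F N x := by
  rw [euclidean_sum_single ξ, euclidean_sum_single η]
  simp only [Fin.sum_univ_two, sff_combination, detSff]
  simp [det2]
  ring

namespace IsLocalFront

theorem fderiv_sff (h : IsLocalFront Gm F N x) (u v w : EuclideanSpace ℝ (Fin 2)) :
    fderiv ℝ (fun z => sff Gm F N z u v) x w =
      - bil (Gm (F x)) (hess (fun y => bil (Gm y)) F x w u) (covN Gm F N x v)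
      - bil (Gm (F x)) (fderiv ℝ F x u)
        (cov (fun y => bil (Gm y)) F (fun z => covN Gm F N z v) x w) := by
  have h1 := fderiv_metric_eq_cov h.metric.isLocalMetric h.smooth.differentiableAt
    (h.smooth.fderiv.apply_const u).differentiableAt (h.smooth_covN v).differentiableAt w
  rw [cov_fderiv h.smooth] at h1
  have h2 : (fun z => sff Gm F N z u v) = fun z => -
      bil (Gm (F z)) (fderiv ℝ F z u) (covN Gm F N z v) := rfl
  rw [h2, fderiv_fun_neg, neg_apply, h1]; ring

/-- The sign of the singular curvature at a cuspidal edge along which the second fundamental form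
vanishes, near which the extrinsic curvature is at least `δ`. -/
theorem vol_mul_vol_nonpos (h : IsLocalFront Gm F N x) (h0 : density Gm F N x = 0)
    {ξ η : EuclideanSpace ℝ (Fin 2)} (hη : fderiv ℝ F x η = 0) (hd : det2 ξ η ≠ 0)
    (hξl : fderiv ℝ (density Gm F N) x ξ = 0) (hηl : fderiv ℝ (density Gm F N) x η ≠ 0)
    (hs : ∀ v w, sff Gm F N x v w = 0)
    (hs' : fderiv ℝ (fun z => sff Gm F N z ξ η) x ξ = 0) {δ : ℝ} (hδ : 0 ≤ δ)
    (hK : ∀ᶠ z in 𝓝 x, δ * density Gm F N z ^ 2 ≤ detSff Gm F N z) :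
    (det2 ξ η * fderiv ℝ (density Gm F N) x η) *
        vol (Gm (F x)) (fderiv ℝ F x ξ) (hess (fun y => bil (Gm y)) F x ξ ξ) (N x) ≤ 0 ∧
      (0 < δ → (det2 ξ η * fderiv ℝ (density Gm F N) x η) *
        vol (Gm (F x)) (fderiv ℝ F x ξ) (hess (fun y => bil (Gm y)) F x ξ ξ) (N x) < 0) := by
  have hη0 : η ≠ 0 := by rintro rfl; simp [det2] at hd
  have ha := bil_pos h.posDef (h.fderiv_ne_zero hη hd hηl)
  have hm := bil_pos h.posDef (h.covN_ne_zero hη hη0)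
  have hP0 : det2 ξ η * fderiv ℝ (density Gm F N) x η ≠ 0 := mul_ne_zero hd hηl
  have hP := h.fderiv_density hη ξ η
  have hξη := h.fderiv_density hη ξ ξ
  rw [hξl, mul_zero] at hξη
  have ds : ∀ u v, DifferentiableAt ℝ (fun z => sff Gm F N z u v) x := fun u v =>
    (h.smooth_sff u v).differentiableAt
  have hline := fun u v => hasDerivAt_line (ds u v) η
  have hl := (hasDerivAt_line h.smooth_density.differentiableAt η).const_mul (det2 ξ η)
  have key := deriv_det_ge (δ := δ) (hline ξ ξ) (hline η η) (hline ξ η) (hline η ξ) hl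
    (by simp [hs]) (by simp [hs]) (by simp [hs]) (by simp [hs]) (by simp [h0]) (by
      filter_upwards [(tendsto_line x η).eventually hK] with s hs
      rw [sff_det]
      have := mul_le_mul_of_nonneg_left hs (sq_nonneg (det2 ξ η))
      linarith)
  have hsym : fderiv ℝ (fun z => sff Gm F N z η ξ) x η =
      fderiv ℝ (fun z => sff Gm F N z ξ η) x η := by
    have : (fun z => sff Gm F N z η ξ) =ᶠ[𝓝 x] fun z => sff Gm F N z ξ η :=
      h.nearby.mono fun z hz => hz.sff_symm _ _
    rw [this.fderiv_eq]
  have hηη : fderiv ℝ (fun z => sff Gm F N z η η) x η =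
      - bil (Gm (F x)) (hess (fun y => bil (Gm y)) F x η η) (covN Gm F N x η) := by
    rw [h.fderiv_sff, hη]; simp
  -- dλ(ξ) = 0 and h(ξ, η) = 0 say that ∇dF(ξ, η) has no component across dF ξ within the tangent
  -- plane and none along N; so it is parallel to dF ξ, which is orthogonal to D_ξ N because h(ξ, ξ)
  -- = 0.
  have hzero : bil (Gm (F x)) (hess (fun y => bil (Gm y)) F x η ξ) (covN Gm F N x ξ) = 0 := by
    have h1 : bil (Gm (F x)) (hess (fun y => bil (Gm y)) F x ξ η) (N x) = 0 := by
      rw [← h.sff_eq_hess, hs]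
    have h2 : bil (Gm (F x)) (fderiv ℝ F x ξ) (covN Gm F N x ξ) = 0 := by
      have := hs ξ ξ
      rw [sff] at this; linarith
    have h3 := vol_mul_vol_of_unit h.posDef h.normal_unit (h.orth ξ) h1 (fderiv ℝ F x ξ)
      (covN Gm F N x ξ)
    rw [← hξη, zero_mul, h2, zero_mul, sub_zero] at h3
    rw [hess_symm h.metric.isLocalMetric h.smooth]
    exact (mul_eq_zero.1 h3.symm).resolve_left ha.ne'
  -- D_η D_ξ N is replaced by D_ξ D_η N, and ⟨dF ξ, D_ξ D_η N⟩ is then read off from ∂_ξ h(ξ, η) =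
  -- 0.
  have hξξ : fderiv ℝ (fun z => sff Gm F N z ξ ξ) x η =
      bil (Gm (F x)) (hess (fun y => bil (Gm y)) F x ξ ξ) (covN Gm F N x η) := by
    have hc := cov_cov_comm (A := N) h.metric.isLocalMetric h.smooth h.smooth_normal hη ξ
    rw [h.fderiv_sff] at hs'
    rw [h.fderiv_sff, hzero]
    change cov _ F (fun z => covN Gm F N z ξ) x η = cov _ F (fun z => covN Gm F N z η) x ξ at hc
    rw [hc]
    linarith
  have k1 := h.vol_covN_null hη ξ (hess (fun y => bil (Gm y)) F x η η)
  have k2 := h.vol_covN_null hη ξ (hess (fun y => bil (Gm y)) F x ξ ξ)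
  have k3 := h.vol_covN_null hη ξ (covN Gm F N x η)
  rw [← hP] at k1
  rw [hsym, hηη, hξξ] at key
  set P := det2 ξ η * fderiv ℝ (density Gm F N) x η
  set Q := vol (Gm (F x)) (fderiv ℝ F x ξ) (hess (fun y => bil (Gm y)) F x ξ ξ) (N x)
  set R := vol (Gm (F x)) (fderiv ℝ F x ξ) (covN Gm F N x η) (N x)
  set a := bil (Gm (F x)) (fderiv ℝ F x ξ) (fderiv ℝ F x ξ)
  set b := bil (Gm (F x)) (hess (fun y => bil (Gm y)) F x η η) (covN Gm F N x η)
  set d := bil (Gm (F x)) (hess (fun y => bil (Gm y)) F x ξ ξ) (covN Gm F N x η)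
  set e := fderiv ℝ (fun z => sff Gm F N z ξ η) x η
  have hRR : 0 < R * R := by rw [k3]; exact mul_pos ha hm
  -- `P` is the dλ(η) factor and `Q` the numerator of κ_s; `vol_covN_null` gives R P = a b and R Q =
  -- a d, so P Q has the sign of d b.
  have hPQ : (P * Q) * (R * R) = a ^ 2 * (d * b) := by
    calc (P * Q) * (R * R) = (R * P) * (R * Q) := by ring
      _ = _ := by rw [k1, k2]; ring
  -- The determinant inequality reads δP² ≤ −d b − e²; the mixed term only helps.
  have hdb : d * b ≤ - (δ * P ^ 2) := by nlinarith [mul_self_nonneg e]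
  constructor
  · by_contra! hc
    have h1 := mul_pos hc hRR
    rw [hPQ] at h1
    have h2 : 0 < d * b := (pos_iff_pos_of_mul_pos h1).1 (by positivity)
    have h3 : 0 ≤ δ * P ^ 2 := by positivity
    linarith
  · intro hδ0
    have h3 : 0 < δ * P ^ 2 := by positivity
    by_contra! hc
    have h1 := mul_nonneg hc hRR.le
    rw [hPQ] at h1
    have h2 : a ^ 2 * (d * b) < 0 := mul_neg_of_pos_of_neg (by positivity) (by linarith)
    linarith

end IsLocalFront

/-! ### Singular curves in coordinates: sign and blow-up of the singular curvature. -/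

section LocalCurve

theorem SmoothNear.fderiv_comp_apply_one {V W : Type*} [NormedAddCommGroup V] [NormedSpace ℝ V]
    [NormedAddCommGroup W] [NormedSpace ℝ W] {F : V → W} {c : ℝ → V} {t : ℝ}
    (hF : SmoothNear F (c t)) (hc : SmoothNear c t) :
    (fun s => _root_.fderiv ℝ (fun s => F (c s)) s 1) =ᶠ[𝓝 t]
      fun s => _root_.fderiv ℝ F (c s) (_root_.fderiv ℝ c s 1) := by
  filter_upwards [hc.continuousAt.eventually hF.nearby, hc.nearby] with s h1 h2
  exact fderiv_comp_apply h1.differentiableAt h2.differentiableAt 1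

theorem hess_comp_curve {V W : Type*} [NormedAddCommGroup V] [NormedSpace ℝ V]
    [NormedAddCommGroup W] [NormedSpace ℝ W] (G : W → W →L[ℝ] W →L[ℝ] ℝ) {F : V → W}
    {c : ℝ → V} {t : ℝ} (hF : SmoothNear F (c t)) (hc : SmoothNear c t) :
    hess G (fun s => F (c s)) t 1 1 = hess G F (c t) (fderiv ℝ c t 1) (fderiv ℝ c t 1) +
      fderiv ℝ F (c t) (fderiv ℝ (fderiv ℝ c) t 1 1) := by
  have hFc : SmoothNear (fun s => F (c s)) t := hF.comp hc
  have e := SmoothNear.fderiv_comp_apply_one hF hc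
  rw [hess, ← fderiv_clm_apply_const hFc.fderiv.differentiableAt, e.fderiv_eq,
    fderiv_clm_apply' (hF.fderiv.comp hc).differentiableAt
      (hc.fderiv.apply_const 1).differentiableAt,
    fderiv_comp_apply hF.fderiv.differentiableAt hc.differentiableAt,
    fderiv_clm_apply_const hc.fderiv.differentiableAt,
    fderiv_comp_apply hF.differentiableAt hc.differentiableAt, hess]
  abel

/-- A regular curve of non-degenerate singular points in coordinates, near a parameter. -/
structure IsLocalSingularCurve (Gm : EuclideanSpace ℝ (Fin 3) → Matrix (Fin 3) (Fin 3) ℝ)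
    (F N : EuclideanSpace ℝ (Fin 2) → EuclideanSpace ℝ (Fin 3)) (c : ℝ → EuclideanSpace ℝ (Fin 2))
    (t : ℝ) : Prop where
  front : IsLocalFront Gm F N (c t)
  smooth : SmoothNear c t
  regular : fderiv ℝ c t 1 ≠ 0
  singular : ∀ᶠ s in 𝓝 t, density Gm F N (c s) = 0
  nondegenerate : ∃ u, fderiv ℝ (density Gm F N) (c t) u ≠ 0

/-- The singular curvature in coordinates. -/
def localSingularCurvature (Gm : EuclideanSpace ℝ (Fin 3) → Matrix (Fin 3) (Fin 3) ℝ)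
    (F N : EuclideanSpace ℝ (Fin 2) → EuclideanSpace ℝ (Fin 3)) (c : ℝ → EuclideanSpace ℝ (Fin 2))
    (t : ℝ) (η : EuclideanSpace ℝ (Fin 2)) : ℝ :=
  Real.sign (det2 (fderiv ℝ c t 1) η * fderiv ℝ (density Gm F N) (c t) η) *
    (vol (Gm (F (c t))) (fderiv ℝ (fun s => F (c s)) t 1)
        (hess (fun y => bil (Gm y)) (fun s => F (c s)) t 1 1) (N (c t)) /
      √(bil (Gm (F (c t))) (fderiv ℝ (fun s => F (c s)) t 1)
        (fderiv ℝ (fun s => F (c s)) t 1)) ^ 3)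

variable {Gm : EuclideanSpace ℝ (Fin 3) → Matrix (Fin 3) (Fin 3) ℝ}
  {F N : EuclideanSpace ℝ (Fin 2) → EuclideanSpace ℝ (Fin 3)} {c : ℝ → EuclideanSpace ℝ (Fin 2)}
  {t : ℝ}

namespace IsLocalSingularCurve

theorem density_eq_zero (h : IsLocalSingularCurve Gm F N c t) : density Gm F N (c t) = 0 :=
  h.singular.self_of_nhds

theorem nearby (h : IsLocalSingularCurve Gm F N c t) :
    ∀ᶠ s in 𝓝 t, IsLocalSingularCurve Gm F N c s := by
  obtain ⟨u, hu⟩ := h.nondegenerate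
  have h1 : ContinuousAt (fun s => fderiv ℝ c s 1) t := (h.smooth.fderiv.apply_const 1).continuousAt
  have h2 : ContinuousAt (fun s => fderiv ℝ (density Gm F N) (c s) u) t :=
    (SmoothNear.comp (K := fun z => fderiv ℝ (density Gm F N) z u)
      (h.front.smooth_density.fderiv.apply_const u) h.smooth).continuousAt
  filter_upwards [h.smooth.continuousAt.eventually h.front.nearby, h.smooth.nearby,
    h1.eventually_ne h.regular, h.singular.eventually_nhds, h2.eventually_ne hu] with s a1 a2 a3 a4 a5
    using ⟨a1, a2, a3, a4, u, a5⟩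

theorem fderiv_density_velocity (h : IsLocalSingularCurve Gm F N c t) :
    fderiv ℝ (density Gm F N) (c t) (fderiv ℝ c t 1) = 0 := by
  have e : (fun s => density Gm F N (c s)) =ᶠ[𝓝 t] fun _ => 0 := h.singular
  rw [← fderiv_comp_apply h.front.smooth_density.differentiableAt h.smooth.differentiableAt,
    e.fderiv_eq]
  simp

theorem velocity_apply (h : IsLocalSingularCurve Gm F N c t) :
    fderiv ℝ (fun s => F (c s)) t 1 = fderiv ℝ F (c t) (fderiv ℝ c t 1) :=
  fderiv_comp_apply h.front.smooth.differentiableAt h.smooth.differentiableAt 1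

/-- dλ kills the velocity, so by non-degeneracy it is nonzero on every transversal vector. -/
theorem fderiv_density_ne_zero (h : IsLocalSingularCurve Gm F N c t)
    {η : EuclideanSpace ℝ (Fin 2)} (hd : det2 (fderiv ℝ c t 1) η ≠ 0) :
    fderiv ℝ (density Gm F N) (c t) η ≠ 0 := by
  intro h0
  obtain ⟨u, hu⟩ := h.nondegenerate
  apply hu
  rw [eq_det2_combination hd u, map_add, map_smul, map_smul, h0, h.fderiv_density_velocity]
  simp

/-- The normal density vanishes along `c` if the extrinsic curvature is nonnegative near `c`. -/
theorem normalDensity_eq_zero (h : IsLocalSingularCurve Gm F N c t)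
    (hK : ∀ᶠ z in 𝓝 (c t), 0 ≤ detSff Gm F N z) : normalDensity Gm F N (c t) = 0 := by
  obtain ⟨u, hu⟩ := h.nondegenerate
  refine eq_zero_of_mul_nonneg h.front.smooth_normalDensity.continuousAt h.density_eq_zero hu ?_
  filter_upwards [hK, h.front.nearby] with z h1 h2
  rw [h2.density_mul_normalDensity]; exact h1

/-- The curvature bound makes h vanish along the whole curve near t, not only at c(t); this supplies
the derivative of h along the curve that `vol_mul_vol_nonpos` needs. -/
theorem localSingularCurvature_nonpos (h : IsLocalSingularCurve Gm F N c t) {δ : ℝ} (hδ : 0 ≤ δ)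
    (hK : ∀ᶠ z in 𝓝 (c t), density Gm F N z ≠ 0 →
      δ * density Gm F N z ^ 2 ≤ detSff Gm F N z)
    {η : EuclideanSpace ℝ (Fin 2)} (hη : fderiv ℝ F (c t) η = 0)
    (hd : det2 (fderiv ℝ c t 1) η ≠ 0) :
    localSingularCurvature Gm F N c t η ≤ 0 ∧
      (0 < δ → localSingularCurvature Gm F N c t η < 0) := by
  -- At singular points the inequality is 0 ≤ 0, since det h = λμ.
  have hK' : ∀ᶠ z in 𝓝 (c t), δ * density Gm F N z ^ 2 ≤ detSff Gm F N z := by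
    filter_upwards [hK, h.front.nearby] with z h1 h2
    by_cases h0 : density Gm F N z = 0
    · have := h2.density_mul_normalDensity
      rw [h0, zero_mul] at this
      rw [detSff, ← this, h0]; simp
    · exact h1 h0
  have hs : ∀ᶠ s in 𝓝 t, ∀ v w, sff Gm F N (c s) v w = 0 := by
    filter_upwards [h.nearby, h.smooth.continuousAt.eventually hK'.eventually_nhds] with s h1 h2
    obtain ⟨u, hu⟩ := h1.nondegenerate
    refine (h1.front.normalDensity_eq_zero_iff h1.density_eq_zero hu).1
      (h1.normalDensity_eq_zero (h2.mono fun z hz => le_trans ?_ hz))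
    positivity
  have hs' : fderiv ℝ (fun z => sff Gm F N z (fderiv ℝ c t 1) η) (c t) (fderiv ℝ c t 1) = 0 := by
    have e : (fun s => sff Gm F N (c s) (fderiv ℝ c t 1) η) =ᶠ[𝓝 t] fun _ => 0 :=
      hs.mono fun s hs => hs _ _
    rw [← fderiv_comp_apply (K := fun z => sff Gm F N z (fderiv ℝ c t 1) η)
      (h.front.smooth_sff _ _).differentiableAt h.smooth.differentiableAt, e.fderiv_eq]
    simp
  have hηl := h.fderiv_density_ne_zero hd
  have key := h.front.vol_mul_vol_nonpos h.density_eq_zero hη hd h.fderiv_density_velocity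
    hηl hs.self_of_nhds hs' hδ hK'
  have ha := bil_pos h.front.posDef (h.front.fderiv_ne_zero hη hd hηl)
  -- The acceleration of F ∘ c differs from ∇dF(c', c') by dF(c''), and the volume of two tangent
  -- vectors with the normal is a multiple of λ = 0.
  have hvol : vol (Gm (F (c t))) (fderiv ℝ (fun s => F (c s)) t 1)
        (hess (fun y => bil (Gm y)) (fun s => F (c s)) t 1 1) (N (c t)) =
      vol (Gm (F (c t))) (fderiv ℝ F (c t) (fderiv ℝ c t 1))
        (hess (fun y => bil (Gm y)) F (c t) (fderiv ℝ c t 1) (fderiv ℝ c t 1)) (N (c t)) := by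
    rw [h.velocity_apply, hess_comp_curve _ h.front.smooth h.smooth, vol_add_middle, vol_fderiv,
      h.density_eq_zero]
    ring
  rw [localSingularCurvature, hvol, h.velocity_apply]
  set P := det2 (fderiv ℝ c t 1) η * fderiv ℝ (density Gm F N) (c t) η
  set Q := vol (Gm (F (c t))) (fderiv ℝ F (c t) (fderiv ℝ c t 1))
        (hess (fun y => bil (Gm y)) F (c t) (fderiv ℝ c t 1) (fderiv ℝ c t 1)) (N (c t))
  have hW : 0 < √(bil (Gm (F (c t))) (fderiv ℝ F (c t) (fderiv ℝ c t 1))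
    (fderiv ℝ F (c t) (fderiv ℝ c t 1))) ^ 3 := pow_pos (Real.sqrt_pos.2 ha) 3
  have hP : P ≠ 0 := mul_ne_zero hd hηl
  rw [← mul_div_assoc]
  rcases lt_or_gt_of_ne hP with hP | hP
  · rw [Real.sign_of_neg hP]
    refine ⟨div_nonpos_of_nonpos_of_nonneg ?_ hW.le, fun hδ0 => div_neg_of_neg_of_pos ?_ hW⟩
    · by_contra! hc
      exact (mul_pos_of_neg_of_neg hP (by linarith)).not_ge key.1
    · by_contra! hc
      exact (mul_nonneg_of_nonpos_of_nonpos hP.le (by linarith)).not_gt (key.2 hδ0)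
  · rw [Real.sign_of_pos hP]
    refine ⟨div_nonpos_of_nonpos_of_nonneg ?_ hW.le, fun hδ0 => div_neg_of_neg_of_pos ?_ hW⟩
    · by_contra! hc
      exact (mul_pos hP (by linarith)).not_ge key.1
    · by_contra! hc
      exact (mul_nonneg hP.le (by linarith)).not_gt (key.2 hδ0)

/-- The singular curvature in terms of the speed `a` of the image curve in the direction of
`DF ξ`. -/
theorem exists_speed (h : IsLocalSingularCurve Gm F N c t) {ξ : EuclideanSpace ℝ (Fin 2)}
    (hw : fderiv ℝ F (c t) ξ ≠ 0) :
    ∃ a : ℝ → ℝ, ContinuousAt a t ∧ a t • fderiv ℝ F (c t) ξ = fderiv ℝ F (c t) (fderiv ℝ c t 1) ∧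
      ∀ᶠ s in 𝓝 t, fderiv ℝ F (c s) ξ ≠ 0 ∧
        fderiv ℝ (fun s => F (c s)) s 1 = a s • fderiv ℝ F (c s) ξ ∧
        vol (Gm (F (c s))) (fderiv ℝ (fun s => F (c s)) s 1)
          (hess (fun y => bil (Gm y)) (fun s => F (c s)) s 1 1) (N (c s)) =
        a s ^ 2 * vol (Gm (F (c s))) (fderiv ℝ F (c s) ξ)
          (hess (fun y => bil (Gm y)) F (c s) (fderiv ℝ c s 1) ξ) (N (c s)) := by
  have sw : SmoothNear (fun s => fderiv ℝ F (c s) ξ) t :=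
    SmoothNear.comp (K := fun z => fderiv ℝ F z ξ) (h.front.smooth.fderiv.apply_const ξ) h.smooth
  have sG : SmoothNear (fun s => bil (Gm (F (c s)))) t :=
    SmoothNear.comp (K := fun z => bil (Gm (F z))) h.front.smooth_metric h.smooth
  have sv : SmoothNear (fun s => fderiv ℝ F (c s) (fderiv ℝ c s 1)) t := by
    filter_upwards [h.front.smooth.fderiv.comp h.smooth, h.smooth.fderiv.apply_const 1]
      with s h1 h2 using h1.clm_apply h2
  have hne := sw.continuousAt.eventually_ne hw
  -- The coefficient is defined by orthogonal projection, which makes its smoothness evident without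
  -- a smooth choice of null vectors. The image of dF along the curve is the line of dF ξ, so the
  -- projection is exact.
  let a : ℝ → ℝ := fun s => bil (Gm (F (c s))) (fderiv ℝ F (c s) (fderiv ℝ c s 1))
    (fderiv ℝ F (c s) ξ) / bil (Gm (F (c s))) (fderiv ℝ F (c s) ξ) (fderiv ℝ F (c s) ξ)
  have sa : SmoothNear a t := by
    filter_upwards [sw, sG, sv, hne, h.nearby] with s h1 h2 h3 h4 h5
    exact ((h2.clm_apply h3).clm_apply h1).div ((h2.clm_apply h1).clm_apply h1)
      (bil_pos h5.front.posDef h4).ne'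
  have hv : ∀ᶠ s in 𝓝 t, fderiv ℝ F (c s) (fderiv ℝ c s 1) = a s • fderiv ℝ F (c s) ξ := by
    filter_upwards [h.nearby, hne] with s h1 h2
    obtain ⟨η, hη0, hη⟩ := h1.front.exists_null h1.density_eq_zero
    have hd : det2 ξ η ≠ 0 := by
      intro h0
      obtain ⟨v, hv⟩ := exists_det2_ne_zero hη0
      apply h2
      have := congrArg (fderiv ℝ F (c s)) (det2_smul_eq v η ξ)
      rw [h0, map_add, map_smul, map_smul, map_smul, hη, zero_smul, smul_zero, add_zero] at this
      exact (smul_eq_zero.1 this).resolve_left hv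
    have h3 : fderiv ℝ F (c s) (fderiv ℝ c s 1) =
        (det2 (fderiv ℝ c s 1) η / det2 ξ η) • fderiv ℝ F (c s) ξ := by
      conv_lhs => rw [eq_det2_combination hd (fderiv ℝ c s 1)]
      rw [map_add, map_smul, map_smul, hη, smul_zero, add_zero]
    have h4 : a s = det2 (fderiv ℝ c s 1) η / det2 ξ η := by
      simp only [a]
      rw [h3, map_smul, smul_apply, smul_eq_mul,
        mul_div_cancel_right₀ _ (bil_pos h1.front.posDef h2).ne']
    rw [h4, h3]
  refine ⟨a, sa.continuousAt, hv.self_of_nhds.symm, ?_⟩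
  filter_upwards [h.nearby, hne, hv.eventually_nhds, sa.nearby, sw.nearby] with s h1 h2 h3 h4 h5
  have e : (fun r => fderiv ℝ (fun s => F (c s)) r 1) =ᶠ[𝓝 s]
      fun r => a r • fderiv ℝ F (c r) ξ := by
    filter_upwards [SmoothNear.fderiv_comp_apply_one h1.front.smooth h1.smooth, h3] with r e1 e2
    rw [e1, e2]
  refine ⟨h2, e.self_of_nhds, ?_⟩
  have hFc : SmoothNear (fun s => F (c s)) s := SmoothNear.comp h1.front.smooth h1.smooth
  -- The product rule for a·dF ξ: the a' term is parallel to the velocity and drops out of the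
  -- volume, leaving one factor a from each of velocity and acceleration.
  have hh : hess (fun y => bil (Gm y)) (fun s => F (c s)) s 1 1 =
      (fderiv ℝ a s 1) • fderiv ℝ F (c s) ξ +
        a s • hess (fun y => bil (Gm y)) F (c s) (fderiv ℝ c s 1) ξ := by
    rw [hess, ← fderiv_clm_apply_const hFc.fderiv.differentiableAt, e.fderiv_eq,
      fderiv_fun_smul h4.differentiableAt h5.differentiableAt]
    have e1 : fderiv ℝ (fun s => F (c s)) s 1 = a s • fderiv ℝ F (c s) ξ := e.self_of_nhds
    have e2 := h1.velocity_apply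
    have e3 : fderiv ℝ (fun r => fderiv ℝ F (c r) ξ) s 1 =
        fderiv ℝ (fderiv ℝ F) (c s) (fderiv ℝ c s 1) ξ := by
      rw [fderiv_comp_apply (K := fun z => fderiv ℝ F z ξ)
        (h1.front.smooth.fderiv.apply_const ξ).differentiableAt h1.smooth.differentiableAt,
        fderiv_clm_apply_const h1.front.smooth.fderiv.differentiableAt]
    nth_rewrite 2 [e1]
    rw [e2, map_smul, hess]
    simp only [add_apply, smul_apply, ContinuousLinearMap.smulRight_apply, e3, smul_add]
    abel
  have e1 : fderiv ℝ (fun s => F (c s)) s 1 = a s • fderiv ℝ F (c s) ξ := e.self_of_nhds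
  rw [hh, e1, vol_add_middle, vol_smul_middle, vol_smul_middle, vol_smul_left,
    vol_smul_left, vol_self]
  ring

/-- The singular curvature tends to `-∞` at a point whose null direction is tangent to the
singular curve. -/
theorem eventually_localSingularCurvature_lt (h : IsLocalSingularCurve Gm F N c t)
    (hnull : fderiv ℝ F (c t) (fderiv ℝ c t 1) = 0) (C : ℝ) :
    ∀ᶠ s in 𝓝 t, ∀ η, fderiv ℝ F (c s) η = 0 → det2 (fderiv ℝ c s 1) η ≠ 0 →
      localSingularCurvature Gm F N c s η < C := by
  obtain ⟨u, hu⟩ := h.nondegenerate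
  obtain ⟨ξ, hξ⟩ := exists_det2_ne_zero h.regular
  have hw := h.front.fderiv_ne_zero hnull hξ hu
  obtain ⟨a, ha, hat, hev⟩ := h.exists_speed hw
  have ha0 : a t = 0 := by
    rw [hnull] at hat
    exact (smul_eq_zero.1 hat).resolve_right hw
  have hξ' : det2 (fderiv ℝ c t 1) ξ = - det2 ξ (fderiv ℝ c t 1) := by simp only [det2]; ring
  have hξ2 : det2 (fderiv ℝ c t 1) ξ ≠ 0 := by rw [hξ']; exact neg_ne_zero.2 hξ
  have hlξ := h.fderiv_density_ne_zero hξ2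
  let m : ℝ → ℝ := fun s => vol (Gm (F (c s))) (fderiv ℝ F (c s) ξ)
    (hess (fun y => bil (Gm y)) F (c s) (fderiv ℝ c s 1) ξ) (N (c s))
  let q : ℝ → ℝ := fun s => fderiv ℝ (density Gm F N) (c s) ξ * det2 (fderiv ℝ c s 1) ξ
  let W : ℝ → ℝ := fun s => √(bil (Gm (F (c s))) (fderiv ℝ F (c s) ξ) (fderiv ℝ F (c s) ξ)) ^ 3
  -- At t the velocity is itself a null vector, so `fderiv_density` with η = c'(t) expresses dλ(ξ)
  -- through the volume `m`. The minus sign is det(c', ξ) = −det(ξ, c'), and it is what sends κ_s to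
  -- −∞ instead of +∞.
  have hqm : q t = - m t := by
    have := h.front.fderiv_density hnull ξ ξ
    rw [hess_symm h.front.metric.isLocalMetric h.front.smooth] at this
    simp only [q, m]
    rw [← this, hξ']; ring
  have hm0 : m t ≠ 0 := by
    intro h0
    rw [h0, neg_zero] at hqm
    exact mul_ne_zero hlξ hξ2 hqm
  have sw : SmoothNear (fun s => fderiv ℝ F (c s) ξ) t :=
    SmoothNear.comp (K := fun z => fderiv ℝ F z ξ) (h.front.smooth.fderiv.apply_const ξ) h.smooth
  have sG : SmoothNear (fun s => bil (Gm (F (c s)))) t :=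
    SmoothNear.comp (K := fun z => bil (Gm (F z))) h.front.smooth_metric h.smooth
  have sc := h.smooth.fderiv.apply_const 1
  have sh : SmoothNear (fun s => hess (fun y => bil (Gm y)) F (c s) (fderiv ℝ c s 1) ξ) t := by
    have s1 : SmoothNear (fun s => levi (fun y => bil (Gm y)) (F (c s))) t :=
      SmoothNear.comp (K := fun z => levi (fun y => bil (Gm y)) (F z))
        (SmoothNear.comp (K := levi fun y => bil (Gm y))
          h.front.metric.isLocalMetric.smooth_levi h.front.smooth) h.smooth
    filter_upwards [s1, h.front.smooth.fderiv.comp h.smooth,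
      h.front.smooth.fderiv.fderiv.comp h.smooth, sc, sw] with s h1 h2 h3 h4 h5
    exact ((h3.clm_apply h4).clm_apply contDiffAt_const).add
      ((h1.clm_apply (h2.clm_apply h4)).clm_apply h5)
  have hmc : ContinuousAt m t := by
    refine (SmoothNear.vol (A := fun s => Gm (F (c s))) (fun i j => ?_) ?_ sw sh ?_).continuousAt
    · exact SmoothNear.comp (K := fun z => Gm (F z) i j) (h.front.metric_entries i j) h.smooth
    · exact h.nearby.mono fun s hs => hs.front.posDef
    · exact SmoothNear.comp h.front.smooth_normal h.smooth
  have hqc : ContinuousAt q t := by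
    have h1 : ContinuousAt (fun s => fderiv ℝ (density Gm F N) (c s) ξ) t :=
      (SmoothNear.comp (K := fun z => fderiv ℝ (density Gm F N) z ξ)
        (h.front.smooth_density.fderiv.apply_const ξ) h.smooth).continuousAt
    have h2 : ∀ i, ContinuousAt (fun s => (fderiv ℝ c s 1) i) t := fun i =>
      (coordL i).continuous.continuousAt.comp sc.continuousAt
    simp only [q, det2]
    exact h1.mul (((h2 0).mul continuousAt_const).sub ((h2 1).mul continuousAt_const))
  have hWc : ContinuousAt W t := by
    have : ContinuousAt (fun s => bil (Gm (F (c s))) (fderiv ℝ F (c s) ξ) (fderiv ℝ F (c s) ξ)) t :=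
      ((sG.continuousAt.clm_apply sw.continuousAt).clm_apply sw.continuousAt)
    exact this.sqrt.pow 3
  -- |a| W is the denominator of κ_s after cancelling a², and it tends to 0.
  have hsmall : ∀ᶠ s in 𝓝 t, |C| * (|a s| * W s) < |m t| / 2 := by
    have : ContinuousAt (fun s => |C| * (|a s| * W s)) t :=
      continuousAt_const.mul (ha.abs.mul hWc)
    refine this.eventually_lt_const ?_
    simpa [ha0] using hm0
  -- Multiplying by the sign of m(t) treats both signs at once: `m` stays away from 0, and `q` keeps
  -- the opposite sign.
  have hmq : ∀ᶠ s in 𝓝 t, |m t| / 2 < m s * SignType.sign (m t) ∧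
      q s * SignType.sign (m t) < 0 := by
    have h1 : ContinuousAt (fun s => m s * SignType.sign (m t)) t := hmc.mul continuousAt_const
    have h2 : ContinuousAt (fun s => q s * SignType.sign (m t)) t := hqc.mul continuousAt_const
    have h3 : m t * SignType.sign (m t) = |m t| := self_mul_sign _
    have h4 := abs_pos.2 hm0
    refine (h1.eventually_const_lt ?_).and (h2.eventually_lt_const ?_)
    · change |m t| / 2 < m t * SignType.sign (m t)
      rw [h3]; linarith
    · change q t * SignType.sign (m t) < 0
      rw [hqm, neg_mul, h3]; linarith
  filter_upwards [h.nearby, hev, hsmall, hmq] with s hs he h1 h2 η hη hd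
  obtain ⟨hws, hvel, hvol⟩ := he
  have hWs : 0 < W s := pow_pos (Real.sqrt_pos.2 (bil_pos hs.front.posDef hws)) 3
  have has : a s ≠ 0 := by
    intro h0
    rw [hs.velocity_apply, h0, zero_smul] at hvel
    apply hws
    rw [eq_det2_combination hd ξ, map_add, map_smul, map_smul, hη, hvel]
    simp
  -- As dλ(c') = 0, dλ is a multiple of det(c', ·); hence the sign in κ_s can be computed with the
  -- fixed vector ξ in place of η.
  have hrel : det2 (fderiv ℝ c s 1) η * fderiv ℝ (density Gm F N) (c s) η *
      det2 (fderiv ℝ c s 1) ξ ^ 2 = q s * det2 (fderiv ℝ c s 1) η ^ 2 := by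
    have e := congrArg (fderiv ℝ (density Gm F N) (c s)) (det2_smul_eq ξ η (fderiv ℝ c s 1))
    rw [map_smul, map_add, map_smul, map_smul, hs.fderiv_density_velocity] at e
    have e2 : det2 ξ (fderiv ℝ c s 1) = - det2 (fderiv ℝ c s 1) ξ := by simp only [det2]; ring
    rw [e2] at e
    simp only [smul_eq_mul, mul_zero] at e
    simp only [q]
    linear_combination (det2 (fderiv ℝ c s 1) η * det2 (fderiv ℝ c s 1) ξ) * e
  set X := det2 (fderiv ℝ c s 1) η * fderiv ℝ (density Gm F N) (c s) η
  have hd2 : 0 < det2 (fderiv ℝ c s 1) η ^ 2 := by positivity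
  have hval : localSingularCurvature Gm F N c s η = Real.sign X * m s / (|a s| * W s) := by
    rw [localSingularCurvature, hvol, hvel]
    simp only [map_smul, smul_apply, smul_eq_mul]
    rw [← mul_assoc, Real.sqrt_mul (mul_self_nonneg _), Real.sqrt_mul_self_eq_abs, mul_pow,
      show |a s| ^ 3 = |a s| * a s ^ 2 by rw [← sq_abs (a s)]; ring]
    change Real.sign X * (a s ^ 2 * m s / (|a s| * a s ^ 2 * W s)) = _
    have := abs_pos.2 has
    field_simp
  have hsign : Real.sign X * m s < - (|m t| / 2) := by
    rcases lt_or_gt_of_ne hm0 with hneg | hpos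
    · rw [sign_neg hneg] at h2
      simp only [SignType.coe_neg_one, mul_neg, mul_one] at h2
      have hX : 0 < X := by
        have : 0 < X * det2 (fderiv ℝ c s 1) ξ ^ 2 := by
          rw [hrel]; exact mul_pos (by linarith) hd2
        exact pos_of_mul_pos_left this (sq_nonneg _)
      rw [Real.sign_of_pos hX]; linarith
    · rw [sign_pos hpos] at h2
      simp only [SignType.coe_one, mul_one] at h2
      have hX : X < 0 := by
        have : X * det2 (fderiv ℝ c s 1) ξ ^ 2 < 0 := by
          rw [hrel]; exact mul_neg_of_neg_of_pos (by linarith) hd2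
        exact neg_of_mul_neg_left this (sq_nonneg _)
      rw [Real.sign_of_neg hX]; linarith
  have haW : 0 < |a s| * W s := mul_pos (abs_pos.2 has) hWs
  rw [hval, div_lt_iff₀ haW]
  have : - |C| * (|a s| * W s) ≤ C * (|a s| * W s) :=
    mul_le_mul_of_nonneg_right (neg_abs_le C) haW.le
  linarith

end IsLocalSingularCurve
end LocalCurve

/-! ### Tangent vectors and derivatives in charts of a manifold. -/

section ChartCalculus

variable {n : ℕ} {M : Type*} [TopologicalSpace M] [ChartedSpace (EuclideanSpace ℝ (Fin n)) M]
  [IsManifold (𝓡 n) ∞ M]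

/-- The inverse of the map `components q₀ q`. -/
def frame (q₀ q : M) : EuclideanSpace ℝ (Fin n) →L[ℝ] TangentSpace (𝓡 n) q :=
  mfderiv (𝓡 n) (𝓡 n) (fun x : EuclideanSpace ℝ (Fin n) => (extChartAt (𝓡 n) q₀).symm x)
    (extChartAt (𝓡 n) q₀ q)

theorem components_frame {q₀ q : M} (hq : q ∈ (extChartAt (𝓡 n) q₀).source)
    (u : EuclideanSpace ℝ (Fin n)) : components q₀ q (frame q₀ q u) = u := by
  have h := mfderiv_extChartAt_comp_mfderivWithin_extChartAt_symm (I := 𝓡 n)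
    ((extChartAt (𝓡 n) q₀).map_source hq)
  rw [ModelWithCorners.range_eq_univ, mfderivWithin_univ,
    (extChartAt (𝓡 n) q₀).left_inv hq] at h
  exact DFunLike.congr_fun h u

theorem frame_components {q₀ q : M} (hq : q ∈ (extChartAt (𝓡 n) q₀).source)
    (X : TangentSpace (𝓡 n) q) : frame q₀ q (components q₀ q X) = X := by
  have h := mfderivWithin_extChartAt_symm_comp_mfderiv_extChartAt (I := 𝓡 n)
    ((extChartAt (𝓡 n) q₀).map_source hq)
  rw [ModelWithCorners.range_eq_univ, mfderivWithin_univ,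
    (extChartAt (𝓡 n) q₀).left_inv hq] at h
  exact DFunLike.congr_fun h X

theorem components_zero (q₀ q : M) : components q₀ q (0 : TangentSpace (𝓡 n) q) = 0 :=
  map_zero (mfderiv (𝓡 n) (𝓡 n) (fun y : M => extChartAt (𝓡 n) q₀ y) q)

theorem components_coordVec {q₀ q : M} (hq : q ∈ (extChartAt (𝓡 n) q₀).source) (i : Fin n) :
    components q₀ q (coordVec q₀ i q) = EuclideanSpace.single i 1 :=
  components_frame hq _

theorem components_eq_zero_iff {q₀ q : M} (hq : q ∈ (extChartAt (𝓡 n) q₀).source)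
    {X : TangentSpace (𝓡 n) q} : components q₀ q X = 0 ↔ X = 0 := by
  constructor
  · intro h
    rw [← frame_components hq X, h, map_zero]
  · rintro rfl; exact components_zero _ _

theorem chart_target_mem_nhds {q₀ q : M} (hq : q ∈ (extChartAt (𝓡 n) q₀).source) :
    (extChartAt (𝓡 n) q₀).target ∈ 𝓝 (extChartAt (𝓡 n) q₀ q) :=
  (isOpen_extChartAt_target (I := 𝓡 n) q₀).mem_nhds ((extChartAt (𝓡 n) q₀).map_source hq)

theorem chart_source_mem_nhds {q₀ q : M} (hq : q ∈ (extChartAt (𝓡 n) q₀).source) :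
    (extChartAt (𝓡 n) q₀).source ∈ 𝓝 q :=
  (isOpen_extChartAt_source (I := 𝓡 n) q₀).mem_nhds hq

theorem contMDiffAt_chart {q₀ q : M} (hq : q ∈ (extChartAt (𝓡 n) q₀).source) :
    ContMDiffAt (𝓡 n) (𝓡 n) ∞ (extChartAt (𝓡 n) q₀) q :=
  contMDiffAt_extChartAt' (by simpa using hq)

theorem contMDiffAt_chart_symm {q₀ : M} {x : EuclideanSpace ℝ (Fin n)}
    (hx : x ∈ (extChartAt (𝓡 n) q₀).target) :
    ContMDiffAt (𝓡 n) (𝓡 n) ∞ (extChartAt (𝓡 n) q₀).symm x :=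
  (contMDiffOn_extChartAt_symm q₀).contMDiffAt
    ((isOpen_extChartAt_target (I := 𝓡 n) q₀).mem_nhds hx)

theorem mfderiv_eq_fderiv_chart {E' : Type*} [NormedAddCommGroup E'] [NormedSpace ℝ E']
    {u : M → E'} {q₀ q : M} (hq : q ∈ (extChartAt (𝓡 n) q₀).source)
    (hu : MDifferentiableAt (𝓡 n) 𝓘(ℝ, E') u q) (X : TangentSpace (𝓡 n) q) :
    mfderiv (𝓡 n) 𝓘(ℝ, E') u q X =
      fderiv ℝ (fun x => u ((extChartAt (𝓡 n) q₀).symm x)) (extChartAt (𝓡 n) q₀ q)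
        (components q₀ q X) := by
  have hx := (extChartAt (𝓡 n) q₀).map_source hq
  have h1 := (contMDiffAt_chart_symm hx).mdifferentiableAt (by simp)
  have hl := (extChartAt (𝓡 n) q₀).left_inv hq
  rw [← hl] at hu
  have := mfderiv_comp (extChartAt (𝓡 n) q₀ q) hu h1
  have e : mfderiv (𝓡 n) 𝓘(ℝ, E') (fun x => u ((extChartAt (𝓡 n) q₀).symm x))
      (extChartAt (𝓡 n) q₀ q) (components q₀ q X) = mfderiv (𝓡 n) 𝓘(ℝ, E') u
        ((extChartAt (𝓡 n) q₀).symm (extChartAt (𝓡 n) q₀ q)) (frame q₀ q (components q₀ q X)) :=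
    DFunLike.congr_fun this (components q₀ q X)
  rw [← mfderiv_eq_fderiv]
  refine Eq.trans ?_ e.symm
  rw [frame_components hq]
  congr 2
  exact hl.symm

theorem components_mfderiv {E H : Type*} [NormedAddCommGroup E] [NormedSpace ℝ E]
    [TopologicalSpace H] {J : ModelWithCorners ℝ E H} {P : Type*} [TopologicalSpace P]
    [ChartedSpace H P] {c : P → M} {s : P} {q₀ : M}
    (hq : c s ∈ (extChartAt (𝓡 n) q₀).source) (hc : MDifferentiableAt J (𝓡 n) c s)
    (X : TangentSpace J s) :
    components q₀ (c s) (mfderiv J (𝓡 n) c s X) =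
      mfderiv J (𝓡 n) (fun r => extChartAt (𝓡 n) q₀ (c r)) s X := by
  have := mfderiv_comp s ((contMDiffAt_chart hq).mdifferentiableAt (by simp)) hc
  exact (DFunLike.congr_fun this X).symm

end ChartCalculus

/-! ### Smoothness in the tangent bundle and the ambient metric in charts. -/

section AmbientMetric

section Sections

variable {n : ℕ} {M : Type*} [TopologicalSpace M] [ChartedSpace (EuclideanSpace ℝ (Fin n)) M]
  [IsManifold (𝓡 n) ∞ M]
  {E H : Type*} [NormedAddCommGroup E] [NormedSpace ℝ E]
  [TopologicalSpace H] {J : ModelWithCorners ℝ E H} {P : Type*} [TopologicalSpace P]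
  [ChartedSpace H P] {c : P → M} {s : P} {q₀ : M}

/-- The fibre coordinate of the tangent-bundle trivialization at `q₀` is `components q₀`. -/
theorem contMDiffAt_lift_iff {V : ∀ r, TangentSpace (𝓡 n) (c r)}
    (hq : c s ∈ (extChartAt (𝓡 n) q₀).source) :
    ContMDiffAt J (𝓡 n).tangent ∞ (fun r => (⟨c r, V r⟩ : TangentBundle (𝓡 n) M)) s ↔
      ContMDiffAt J (𝓡 n) ∞ c s ∧
        ContMDiffAt J 𝓘(ℝ, EuclideanSpace ℝ (Fin n)) ∞ (fun r => components q₀ (c r) (V r)) s := by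
  let e := trivializationAt (EuclideanSpace ℝ (Fin n)) (TangentSpace (𝓡 n) : M → Type _) q₀
  have hs : c s ∈ (chartAt (EuclideanSpace ℝ (Fin n)) q₀).source := by simpa using hq
  have he : (⟨c s, V s⟩ : TangentBundle (𝓡 n) M) ∈ e.source := by
    rw [e.mem_source]; simpa [e] using hs
  refine (e.contMDiffAt_iff (f := fun r => (⟨c r, V r⟩ : TangentBundle (𝓡 n) M)) he).trans
    (and_congr_right fun hc => ?_)
  have hnear : (fun r => (e (⟨c r, V r⟩ : TangentBundle (𝓡 n) M)).2) =ᶠ[𝓝 s]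
      fun r => components q₀ (c r) (V r) := by
    filter_upwards [hc.continuousAt.preimage_mem_nhds
      ((chartAt (EuclideanSpace ℝ (Fin n)) q₀).open_source.mem_nhds hs)] with r hr
    have hr : c r ∈ (chartAt (EuclideanSpace ℝ (Fin n)) q₀).source := hr
    have h1 := TangentBundle.continuousLinearMapAt_trivializationAt (I := 𝓡 n) hr
    have h2 : c r ∈ e.baseSet := by simpa [e] using hr
    have h3 := congrFun (Trivialization.continuousLinearMapAt_apply ℝ e (c r)) (V r)
    rw [e.coe_linearMapAt_of_mem h2] at h3
    exact h3.symm.trans (by rw [h1]; rfl)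
  exact ⟨fun h => h.congr_of_eventuallyEq hnear.symm, fun h => h.congr_of_eventuallyEq hnear⟩

theorem contMDiffAt_coordVec (i : Fin n) (hc : ContMDiffAt J (𝓡 n) ∞ c s)
    (hq : c s ∈ (extChartAt (𝓡 n) q₀).source) :
    ContMDiffAt J (𝓡 n).tangent ∞
      (fun r => (⟨c r, coordVec q₀ i (c r)⟩ : TangentBundle (𝓡 n) M)) s := by
  rw [contMDiffAt_lift_iff hq]
  refine ⟨hc, (contMDiffAt_const (c := EuclideanSpace.single i (1 : ℝ))).congr_of_eventuallyEq ?_⟩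
  filter_upwards [hc.continuousAt.eventually (chart_source_mem_nhds hq)] with r hr
  exact components_coordVec hr i

theorem components_eq_fderiv_transition {q₁ q : M} (h₀ : q ∈ (extChartAt (𝓡 n) q₀).source)
    (h₁ : q ∈ (extChartAt (𝓡 n) q₁).source) (X : TangentSpace (𝓡 n) q) :
    components q₁ q X =
      fderiv ℝ (fun x => extChartAt (𝓡 n) q₁ ((extChartAt (𝓡 n) q₀).symm x))
        (extChartAt (𝓡 n) q₀ q) (components q₀ q X) :=
  mfderiv_eq_fderiv_chart h₀ ((contMDiffAt_chart h₁).mdifferentiableAt (by simp)) X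

theorem smoothNear_of_contMDiffAt {E' : Type*} [NormedAddCommGroup E'] [NormedSpace ℝ E']
    {u : M → E'} {q : M} (hq : q ∈ (extChartAt (𝓡 n) q₀).source)
    (hu : ∀ᶠ r in 𝓝 q, ContMDiffAt (𝓡 n) 𝓘(ℝ, E') ∞ u r) :
    SmoothNear (fun x => u ((extChartAt (𝓡 n) q₀).symm x)) (extChartAt (𝓡 n) q₀ q) := by
  have hx := (extChartAt (𝓡 n) q₀).map_source hq
  have hl := (extChartAt (𝓡 n) q₀).left_inv hq
  have hcont : Tendsto (extChartAt (𝓡 n) q₀).symm (𝓝 (extChartAt (𝓡 n) q₀ q)) (𝓝 q) := by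
    have := (contMDiffAt_chart_symm hx).continuousAt.tendsto
    rwa [hl] at this
  filter_upwards [hcont.eventually hu, chart_target_mem_nhds hq] with x h1 h2
  exact contMDiffAt_iff_contDiffAt.1 (h1.comp x (contMDiffAt_chart_symm h2))

theorem smoothNear_transition {q₁ q : M} (h₀ : q ∈ (extChartAt (𝓡 n) q₀).source)
    (h₁ : q ∈ (extChartAt (𝓡 n) q₁).source) :
    SmoothNear (fun x => extChartAt (𝓡 n) q₁ ((extChartAt (𝓡 n) q₀).symm x))
      (extChartAt (𝓡 n) q₀ q) :=
  smoothNear_of_contMDiffAt h₀ (by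
    filter_upwards [chart_source_mem_nhds h₁] with r hr using contMDiffAt_chart hr)

end Sections

variable {N : Type*} [TopologicalSpace N] [ChartedSpace (EuclideanSpace ℝ (Fin 3)) N]
  [IsManifold (𝓡 3) ∞ N]
  (g : ContMDiffRiemannianMetric (𝓡 3) ∞ (EuclideanSpace ℝ (Fin 3))
    (fun y : N => TangentSpace (𝓡 3) y))
  {E H : Type*} [NormedAddCommGroup E] [NormedSpace ℝ E]
  [TopologicalSpace H] {J : ModelWithCorners ℝ E H} {P : Type*} [TopologicalSpace P]
  [ChartedSpace H P] {c : P → N} {s : P} {y₀ : N}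

theorem contMDiffAt_inner {A B : ∀ r, TangentSpace (𝓡 3) (c r)}
    (hc : ContMDiffAt J (𝓡 3) ∞ c s)
    (hA : ContMDiffAt J (𝓡 3).tangent ∞ (fun r => (⟨c r, A r⟩ : TangentBundle (𝓡 3) N)) s)
    (hB : ContMDiffAt J (𝓡 3).tangent ∞ (fun r => (⟨c r, B r⟩ : TangentBundle (𝓡 3) N)) s) :
    ContMDiffAt J 𝓘(ℝ, ℝ) ∞ (fun r => g.inner (c r) (A r) (B r)) s := by
  have : ContMDiffAt J ((𝓡 3).prod 𝓘(ℝ, ℝ)) ∞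
      (fun r => TotalSpace.mk' ℝ (E := Bundle.Trivial N ℝ) (c r) (g.inner (c r) (A r) (B r))) s := by
    apply ContMDiffAt.clm_bundle_apply₂ (F₁ := EuclideanSpace ℝ (Fin 3))
      (F₂ := EuclideanSpace ℝ (Fin 3))
    · exact ContMDiffAt.comp s g.contMDiff.contMDiffAt hc
    · exact hA
    · exact hB
  simp only [contMDiffAt_totalSpace] at this
  exact this.2

theorem inner_eq_bil {y : N} (hy : y ∈ (extChartAt (𝓡 3) y₀).source) (X Y : TangentSpace (𝓡 3) y) :
    g.inner y X Y = bil (metricMatrix g y₀ (extChartAt (𝓡 3) y₀ y)) (components y₀ y X)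
      (components y₀ y Y) := by
  have hl := (extChartAt (𝓡 3) y₀).left_inv hy
  have hm : ∀ i j, metricMatrix g y₀ (extChartAt (𝓡 3) y₀ y) i j =
      g.inner y (coordVec y₀ i y) (coordVec y₀ j y) := fun i j => by
    simp only [metricMatrix, chartMatrix, Matrix.of_apply]
    rw [hl]
  rw [bil_apply]
  simp only [hm]
  conv_lhs => rw [← frame_components hy X, ← frame_components hy Y,
    euclidean_sum_single (components y₀ y X), euclidean_sum_single (components y₀ y Y)]
  have hf : ∀ i : Fin 3, frame y₀ y (EuclideanSpace.single i 1) = coordVec y₀ i y := fun _ => rfl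
  simp only [map_sum, map_smul, sum_apply, smul_apply, smul_eq_mul, hf]
  simp only [Finset.mul_sum]
  rw [Finset.sum_comm]
  refine Finset.sum_congr rfl fun i _ => Finset.sum_congr rfl fun j _ => ?_
  ring

theorem isMatrixMetric_metricMatrix {y : N} (hy : y ∈ (extChartAt (𝓡 3) y₀).source) :
    IsMatrixMetric (metricMatrix g y₀) (extChartAt (𝓡 3) y₀ y) := by
  filter_upwards [chart_target_mem_nhds hy] with z hz
  constructor
  · intro i j
    have h1 := contMDiffAt_chart_symm hz
    have h2 := (extChartAt (𝓡 3) y₀).map_target hz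
    exact contMDiffAt_iff_contDiffAt.1
      (contMDiffAt_inner g h1 (contMDiffAt_coordVec i h1 h2) (contMDiffAt_coordVec j h1 h2))
  · have h2 := (extChartAt (𝓡 3) y₀).map_target hz
    refine posDef_of_bil (fun i j => ?_) (fun u hu => ?_)
    · simp only [metricMatrix, chartMatrix, Matrix.of_apply]
      exact g.symm _ _ _
    · have h3 := inner_eq_bil g h2 (frame y₀ _ u) (frame y₀ _ u)
      rw [(extChartAt (𝓡 3) y₀).right_inv hz, components_frame h2] at h3
      rw [← h3]
      refine g.pos _ _ fun h0 => hu ?_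
      rw [← components_frame h2 u, h0, components_zero]

end AmbientMetric

/-! ### Derivatives of vector-valued functions on a manifold. -/

section VectorDerivative

variable {E H : Type*} [NormedAddCommGroup E] [NormedSpace ℝ E]
  [TopologicalSpace H] (J : ModelWithCorners ℝ E H) {P : Type*} [TopologicalSpace P]
  [ChartedSpace H P] {V W : Type*} [NormedAddCommGroup V] [NormedSpace ℝ V]
  [NormedAddCommGroup W] [NormedSpace ℝ W]

/-- The derivative of a vector-valued function in the direction of a tangent vector. -/
def vecDeriv (u : P → V) (s : P) (X : TangentSpace J s) : V := mfderiv J 𝓘(ℝ, V) u s X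

variable {J}

theorem vecDeriv_congr {u v : P → V} {s : P} (h : u =ᶠ[𝓝 s] v) (X : TangentSpace J s) :
    vecDeriv J u s X = vecDeriv J v s X :=
  DFunLike.congr_fun h.mfderiv_eq X

theorem vecDeriv_comp {u : P → V} {s : P} {K : V → W} (hK : DifferentiableAt ℝ K (u s))
    (hu : MDifferentiableAt J 𝓘(ℝ, V) u s) (X : TangentSpace J s) :
    vecDeriv J (fun r => K (u r)) s X = fderiv ℝ K (u s) (vecDeriv J u s X) := by
  have := (hK.hasFDerivAt.hasMFDerivAt.comp s hu.hasMFDerivAt).mfderiv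
  exact DFunLike.congr_fun this X

theorem vecDeriv_clm_apply {K : P → V →L[ℝ] W} {u : P → V} {s : P}
    (hK : MDifferentiableAt J 𝓘(ℝ, V →L[ℝ] W) K s) (hu : MDifferentiableAt J 𝓘(ℝ, V) u s)
    (X : TangentSpace J s) :
    vecDeriv J (fun r => K r (u r)) s X = vecDeriv J K s X (u s) + K s (vecDeriv J u s X) := by
  have h := hK.hasMFDerivAt.2.clm_apply hu.hasMFDerivAt.2
  have h' : HasMFDerivAt J 𝓘(ℝ, W) (fun r => K r (u r)) s _ :=
    ⟨(hK.continuousAt.clm_apply hu.continuousAt), h⟩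
  refine (DFunLike.congr_fun h'.mfderiv X).trans ?_
  simp [vecDeriv, writtenInExtChartAt]
  exact add_comm _ _

end VectorDerivative

/-! ### Chart independence of the covariant derivative along a map. -/

section CovariantDerivative

variable {N : Type*} [TopologicalSpace N] [ChartedSpace (EuclideanSpace ℝ (Fin 3)) N]
  [IsManifold (𝓡 3) ∞ N]
  (g : ContMDiffRiemannianMetric (𝓡 3) ∞ (EuclideanSpace ℝ (Fin 3))
    (fun y : N => TangentSpace (𝓡 3) y))
  {E H : Type*} [NormedAddCommGroup E] [NormedSpace ℝ E]
  [TopologicalSpace H] {J : ModelWithCorners ℝ E H} {P : Type*} [TopologicalSpace P]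
  [ChartedSpace H P] {c : P → N} {s : P} {y₀ : N}

theorem components_sum_coordVec {y : N} (hy : y ∈ (extChartAt (𝓡 3) y₀).source) (a : Fin 3 → ℝ) :
    components y₀ y (∑ k, a k • coordVec y₀ k y) = ∑ k, a k • EuclideanSpace.single k (1 : ℝ) := by
  have h := map_sum (mfderiv (𝓡 3) (𝓡 3) (fun y : N => extChartAt (𝓡 3) y₀ y) y)
    (fun k => a k • coordVec y₀ k y) Finset.univ
  refine Eq.trans h (Finset.sum_congr rfl fun k _ => ?_)
  rw [map_smul]
  exact congrArg (a k • ·) (components_coordVec hy k)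

theorem isPullbackNear_transition {y y₁ : N} (h₀ : y ∈ (extChartAt (𝓡 3) y₀).source)
    (h₁ : y ∈ (extChartAt (𝓡 3) y₁).source) :
    IsPullbackNear (fun z => bil (metricMatrix g y₀ z))
      (fun x => extChartAt (𝓡 3) y₀ ((extChartAt (𝓡 3) y₁).symm x))
      (fun z => bil (metricMatrix g y₁ z)) (extChartAt (𝓡 3) y₁ y) := by
  have hx := (extChartAt (𝓡 3) y₁).map_source h₁
  have hl := (extChartAt (𝓡 3) y₁).left_inv h₁
  have hcont : Tendsto (extChartAt (𝓡 3) y₁).symm (𝓝 (extChartAt (𝓡 3) y₁ y)) (𝓝 y) := by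
    have := (contMDiffAt_chart_symm hx).continuousAt.tendsto
    rwa [hl] at this
  filter_upwards [chart_target_mem_nhds h₁, hcont.eventually (chart_source_mem_nhds h₀)]
    with z hz hz0 u v
  have h2 := (extChartAt (𝓡 3) y₁).map_target hz
  have h3 := inner_eq_bil g h2 (frame y₁ _ u) (frame y₁ _ v)
  have h4 := inner_eq_bil g hz0 (frame y₁ _ u) (frame y₁ _ v)
  rw [components_eq_fderiv_transition h2 hz0, components_eq_fderiv_transition h2 hz0] at h4
  rw [components_frame h2, components_frame h2, (extChartAt (𝓡 3) y₁).right_inv hz] at h3 h4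
  rw [← h3, h4]

/-- The transformation law of the Christoffel symbols: the transition map is an isometry of the
coordinate metrics, so `christ1_pullback` compares both sides against every vector dτ(w), and dτ is
onto. -/
theorem levi_transition {y y₁ : N} (h₀ : y ∈ (extChartAt (𝓡 3) y₀).source)
    (h₁ : y ∈ (extChartAt (𝓡 3) y₁).source) (u v : EuclideanSpace ℝ (Fin 3)) :
    fderiv ℝ (fun x => extChartAt (𝓡 3) y₀ ((extChartAt (𝓡 3) y₁).symm x))
        (extChartAt (𝓡 3) y₁ y)
        (levi (fun z => bil (metricMatrix g y₁ z)) (extChartAt (𝓡 3) y₁ y) u v) =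
      hess (fun z => bil (metricMatrix g y₀ z))
        (fun x => extChartAt (𝓡 3) y₀ ((extChartAt (𝓡 3) y₁).symm x))
        (extChartAt (𝓡 3) y₁ y) u v := by
  set τ := fun x => extChartAt (𝓡 3) y₀ ((extChartAt (𝓡 3) y₁).symm x) with hτ
  set p := extChartAt (𝓡 3) y₁ y with hp
  have hτp : τ p = extChartAt (𝓡 3) y₀ y := by
    simp only [hτ, hp]; rw [(extChartAt (𝓡 3) y₁).left_inv h₁]
  have hG1 := (isMatrixMetric_metricMatrix g h₁).isLocalMetric
  have hG0 : IsLocalMetric (fun z => bil (metricMatrix g y₀ z)) (τ p) := by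
    rw [hτp]; exact (isMatrixMetric_metricMatrix g h₀).isLocalMetric
  have hpull := isPullbackNear_transition g h₀ h₁
  have key := christ1_pullback hG0 (smoothNear_transition h₁ h₀) hG1.smooth.differentiableAt
    hpull u v
  refine hG0.injective fun w => ?_
  have hw : fderiv ℝ τ p (components y₁ y (frame y₀ y w)) = w := by
    rw [← components_eq_fderiv_transition h₁ h₀, components_frame h₀]
  rw [← hw, ← key, ← hG1.levi_spec]
  exact (hpull.self_of_nhds _ _).symm

theorem components_covDerivAlong_self (V : ∀ r, TangentSpace (𝓡 3) (c r))
    (hV : MDifferentiableAt J 𝓘(ℝ, EuclideanSpace ℝ (Fin 3))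
      (fun r => components (c s) (c r) (V r)) s) (X : TangentSpace J s) :
    components (c s) (c s) (covDerivAlong g J c V s X) =
      vecDeriv J (fun r => components (c s) (c r) (V r)) s X +
        levi (fun z => bil (metricMatrix g (c s) z)) (extChartAt (𝓡 3) (c s) (c s))
          (components (c s) (c s) (mfderiv J (𝓡 3) c s X)) (components (c s) (c s) (V s)) := by
  have hs : c s ∈ (extChartAt (𝓡 3) (c s)).source := mem_extChartAt_source (c s)
  have hdir : ∀ k, dirDeriv J (fun r : P => components (c s) (c r) (V r) k) s X =
      vecDeriv J (fun r => components (c s) (c r) (V r)) s X k := by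
    intro k
    rw [← coordL_apply k, ← (coordL (n := 3) k).fderiv (x := components (c s) (c s) (V s)),
      ← vecDeriv_comp (coordL k).differentiableAt hV]
    rfl
  have hsum : components (c s) (c s) (covDerivAlong g J c V s X) =
      ∑ k, (dirDeriv J (fun r : P => components (c s) (c r) (V r) k) s X
        + ∑ i, ∑ j, christoffel (metricMatrix g (c s)) k i j (extChartAt (𝓡 3) (c s) (c s))
          * components (c s) (c s) (mfderiv J (𝓡 3) c s X) i
          * components (c s) (c s) (V s) j) • EuclideanSpace.single k (1 : ℝ) := by
    exact components_sum_coordVec hs _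
  rw [hsum]
  conv_rhs => rw [euclidean_sum_single (_ + _)]
  refine Finset.sum_congr rfl fun k _ => ?_
  rw [PiLp.add_apply, levi_apply (isMatrixMetric_metricMatrix g hs), hdir]

/-- The covariant derivative along a map, computed in an arbitrary chart. -/
theorem components_covDerivAlong (hy : c s ∈ (extChartAt (𝓡 3) y₀).source)
    (hc : MDifferentiableAt J (𝓡 3) c s) (V : ∀ r, TangentSpace (𝓡 3) (c r))
    (hV : MDifferentiableAt J 𝓘(ℝ, EuclideanSpace ℝ (Fin 3))
      (fun r => components (c s) (c r) (V r)) s) (X : TangentSpace J s) :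
    components y₀ (c s) (covDerivAlong g J c V s X) =
      vecDeriv J (fun r => components y₀ (c r) (V r)) s X +
        levi (fun z => bil (metricMatrix g y₀ z)) (extChartAt (𝓡 3) y₀ (c s))
          (components y₀ (c s) (mfderiv J (𝓡 3) c s X)) (components y₀ (c s) (V s)) := by
  have hs : c s ∈ (extChartAt (𝓡 3) (c s)).source := mem_extChartAt_source (c s)
  set τ := fun x => extChartAt (𝓡 3) y₀ ((extChartAt (𝓡 3) (c s)).symm x) with hτ
  set p := extChartAt (𝓡 3) (c s) (c s) with hp
  have hτs : SmoothNear τ p := smoothNear_transition hs hy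
  have e : (fun r => components y₀ (c r) (V r)) =ᶠ[𝓝 s]
      fun r => fderiv ℝ τ (extChartAt (𝓡 3) (c s) (c r)) (components (c s) (c r) (V r)) := by
    filter_upwards [hc.continuousAt.preimage_mem_nhds (chart_source_mem_nhds hs),
      hc.continuousAt.preimage_mem_nhds (chart_source_mem_nhds hy)] with r h1 h2
    exact components_eq_fderiv_transition h1 h2 _
  have hψ : MDifferentiableAt J (𝓡 3) (fun r => extChartAt (𝓡 3) (c s) (c r)) s :=
    MDifferentiableAt.comp s ((contMDiffAt_chart hs).mdifferentiableAt (by simp)) hc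
  -- The product rule for dτ applied to the components of V yields a D²τ term, exactly the
  -- inhomogeneous term of `levi_transition`.
  have hder : vecDeriv J (fun r => components y₀ (c r) (V r)) s X =
      fderiv ℝ (fderiv ℝ τ) p (vecDeriv J (fun r => extChartAt (𝓡 3) (c s) (c r)) s X)
        (components (c s) (c s) (V s)) +
      fderiv ℝ τ p (vecDeriv J
        (fun r => components (c s) (c r) (V r)) s X) := by
    have h1 : MDifferentiableAt J 𝓘(ℝ, EuclideanSpace ℝ (Fin 3) →L[ℝ] EuclideanSpace ℝ (Fin 3))
        (fun r => fderiv ℝ τ (extChartAt (𝓡 3) (c s) (c r))) s :=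
      MDifferentiableAt.comp (g := fderiv ℝ τ) s hτs.fderiv.differentiableAt.mdifferentiableAt hψ
    rw [vecDeriv_congr e, vecDeriv_clm_apply h1 hV,
      vecDeriv_comp (K := fderiv ℝ τ) (u := fun r => extChartAt (𝓡 3) (c s) (c r))
        hτs.fderiv.differentiableAt hψ]
  have e1 : components (c s) (c s) (mfderiv J (𝓡 3) c s X) =
      vecDeriv J (fun r => extChartAt (𝓡 3) (c s) (c r)) s X := components_mfderiv hs hc X
  rw [components_eq_fderiv_transition hs hy, components_covDerivAlong_self g V hV, map_add,
    levi_transition g hy hs, hder, components_eq_fderiv_transition hs hy,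
    components_eq_fderiv_transition hs hy, hess, (extChartAt (𝓡 3) (c s)).left_inv hs, e1]
  abel

end CovariantDerivative

/-! ### A front on manifolds read in charts. -/

section CoordinateFront

variable {M : Type*} [TopologicalSpace M] [ChartedSpace (EuclideanSpace ℝ (Fin 2)) M]
  [IsManifold (𝓡 2) ∞ M]
  {N : Type*} [TopologicalSpace N] [ChartedSpace (EuclideanSpace ℝ (Fin 3)) N]
  [IsManifold (𝓡 3) ∞ N]
  {g : ContMDiffRiemannianMetric (𝓡 3) ∞ (EuclideanSpace ℝ (Fin 3))
    (fun y : N => TangentSpace (𝓡 3) y)}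
  {f : M → N} {ν : ∀ q : M, TangentSpace (𝓡 3) (f q)}
  {p q : M} {y : N}

/-- The expression of a map in the charts at `p` and `y`. -/
def coordMap (p : M) (y : N) (f : M → N) (x : EuclideanSpace ℝ (Fin 2)) :
    EuclideanSpace ℝ (Fin 3) :=
  extChartAt (𝓡 3) y (f ((extChartAt (𝓡 2) p).symm x))

/-- The components of a vector field along a map in the charts at `p` and `y`. -/
def coordField (p : M) (y : N) (f : M → N) (V : ∀ q : M, TangentSpace (𝓡 3) (f q))
    (x : EuclideanSpace ℝ (Fin 2)) : EuclideanSpace ℝ (Fin 3) :=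
  components y (f ((extChartAt (𝓡 2) p).symm x)) (V ((extChartAt (𝓡 2) p).symm x))

theorem coordMap_apply (hq : q ∈ (extChartAt (𝓡 2) p).source) :
    coordMap p y f (extChartAt (𝓡 2) p q) = extChartAt (𝓡 3) y (f q) := by
  rw [coordMap, (extChartAt (𝓡 2) p).left_inv hq]

theorem coordField_apply (V : ∀ q : M, TangentSpace (𝓡 3) (f q))
    (hq : q ∈ (extChartAt (𝓡 2) p).source) :
    coordField p y f V (extChartAt (𝓡 2) p q) = components y (f q) (V q) :=
  congrArg (fun r => components y (f r) (V r)) ((extChartAt (𝓡 2) p).left_inv hq)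

theorem tendsto_chart_symm (hq : q ∈ (extChartAt (𝓡 2) p).source) :
    Tendsto (extChartAt (𝓡 2) p).symm (𝓝 (extChartAt (𝓡 2) p q)) (𝓝 q) := by
  have := (contMDiffAt_chart_symm ((extChartAt (𝓡 2) p).map_source hq)).continuousAt.tendsto
  rwa [(extChartAt (𝓡 2) p).left_inv hq] at this

theorem eventually_chart {R : EuclideanSpace ℝ (Fin 2) → Prop}
    (hq : q ∈ (extChartAt (𝓡 2) p).source)
    (h : ∀ᶠ r in 𝓝 q, R (extChartAt (𝓡 2) p r)) : ∀ᶠ x in 𝓝 (extChartAt (𝓡 2) p q), R x := by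
  filter_upwards [(tendsto_chart_symm hq).eventually h, chart_target_mem_nhds hq] with x h1 h2
  rwa [(extChartAt (𝓡 2) p).right_inv h2] at h1

theorem components_mfderiv_eq_fderiv (hf : MDifferentiableAt (𝓡 2) (𝓡 3) f q)
    (hq : q ∈ (extChartAt (𝓡 2) p).source) (hy : f q ∈ (extChartAt (𝓡 3) y).source)
    (X : TangentSpace (𝓡 2) q) :
    components y (f q) (mfderiv (𝓡 2) (𝓡 3) f q X) =
      fderiv ℝ (coordMap p y f) (extChartAt (𝓡 2) p q) (components p q X) := by
  rw [components_mfderiv hy hf]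
  exact mfderiv_eq_fderiv_chart hq
    (MDifferentiableAt.comp q ((contMDiffAt_chart hy).mdifferentiableAt (by simp)) hf) X

namespace IsFront

theorem mdifferentiableAt (h : IsFront g f ν) (q : M) : MDifferentiableAt (𝓡 2) (𝓡 3) f q :=
  h.smooth.contMDiffAt.mdifferentiableAt (by simp)

theorem eventually_mem_source (h : IsFront g f ν) (hy : f q ∈ (extChartAt (𝓡 3) y).source) :
    ∀ᶠ r in 𝓝 q, f r ∈ (extChartAt (𝓡 3) y).source :=
  h.smooth.continuous.continuousAt.eventually (chart_source_mem_nhds hy)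

theorem contMDiffAt_normal (h : IsFront g f ν) (hy : f q ∈ (extChartAt (𝓡 3) y).source) :
    ContMDiffAt (𝓡 2) 𝓘(ℝ, EuclideanSpace ℝ (Fin 3)) ∞ (fun r => components y (f r) (ν r)) q :=
  ((contMDiffAt_lift_iff hy).1 h.smooth_lift.contMDiffAt).2

theorem smoothNear_coordMap (h : IsFront g f ν) (hq : q ∈ (extChartAt (𝓡 2) p).source)
    (hy : f q ∈ (extChartAt (𝓡 3) y).source) :
    SmoothNear (coordMap p y f) (extChartAt (𝓡 2) p q) :=
  smoothNear_of_contMDiffAt (u := fun r => extChartAt (𝓡 3) y (f r)) hq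
    ((h.eventually_mem_source hy).mono fun _ hr =>
      (contMDiffAt_chart hr).comp _ h.smooth.contMDiffAt)

theorem smoothNear_coordField (h : IsFront g f ν) (hq : q ∈ (extChartAt (𝓡 2) p).source)
    (hy : f q ∈ (extChartAt (𝓡 3) y).source) :
    SmoothNear (coordField p y f ν) (extChartAt (𝓡 2) p q) :=
  smoothNear_of_contMDiffAt (u := fun r => components y (f r) (ν r)) hq
    ((h.eventually_mem_source hy).mono fun _ hr => h.contMDiffAt_normal hr)

theorem components_df (h : IsFront g f ν) (hq : q ∈ (extChartAt (𝓡 2) p).source)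
    (hy : f q ∈ (extChartAt (𝓡 3) y).source) (X : TangentSpace (𝓡 2) q) :
    components y (f q) (mfderiv (𝓡 2) (𝓡 3) f q X) =
      fderiv ℝ (coordMap p y f) (extChartAt (𝓡 2) p q) (components p q X) :=
  components_mfderiv_eq_fderiv (h.mdifferentiableAt q) hq hy X

/-- Through the inverse trivialization the lift is the pair (f, components of ν), so its
differential vanishes where both differentials do. This carries the immersion hypothesis into
coordinates. -/
theorem mfderiv_lift_eq_zero (h : IsFront g f ν) (hy : f q ∈ (extChartAt (𝓡 3) y).source)
    {X : TangentSpace (𝓡 2) q} (h1 : mfderiv (𝓡 2) (𝓡 3) f q X = 0)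
    (h2 : vecDeriv (𝓡 2) (fun r => components y (f r) (ν r)) q X = 0) :
    mfderiv (𝓡 2) (𝓡 3).tangent (lift f ν) q X = 0 := by
  let e := trivializationAt (EuclideanSpace ℝ (Fin 3)) (TangentSpace (𝓡 3) : N → Type _) y
  have hs : f q ∈ e.baseSet := by simpa [e] using hy
  have hmem : ∀ r, f r ∈ (extChartAt (𝓡 3) y).source →
      e (lift f ν r) = (f r, components y (f r) (ν r)) := by
    intro r hr
    have hr' : f r ∈ (chartAt (EuclideanSpace ℝ (Fin 3)) y).source := by simpa using hr
    have hb : f r ∈ e.baseSet := by simpa [e] using hr'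
    have a1 := TangentBundle.continuousLinearMapAt_trivializationAt (I := 𝓡 3) hr'
    have a3 := congrFun (Trivialization.continuousLinearMapAt_apply ℝ e (f r)) (ν r)
    rw [e.coe_linearMapAt_of_mem hb] at a3
    refine Prod.ext (e.coe_fst (by rw [e.mem_source]; exact hb)) ?_
    exact a3.symm.trans (by rw [a1]; rfl)
  have hev : lift f ν =ᶠ[𝓝 q] fun r => e.toOpenPartialHomeomorph.symm
      (f r, components y (f r) (ν r)) := by
    filter_upwards [h.eventually_mem_source hy] with r hr
    rw [← hmem r hr]
    refine (e.toOpenPartialHomeomorph.left_inv ?_).symm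
    exact e.mem_source.2 (by simpa [e, lift] using hr)
  have ht : (f q, components y (f q) (ν q)) ∈ e.target := by
    rw [e.mem_target]; exact hs
  have hsymm : MDifferentiableAt ((𝓡 3).prod 𝓘(ℝ, EuclideanSpace ℝ (Fin 3))) (𝓡 3).tangent
      e.toOpenPartialHomeomorph.symm (f q, components y (f q) (ν q)) :=
    ((e.contMDiffOn_symm (IB := 𝓡 3) (n := ∞)).contMDiffAt
      (e.open_target.mem_nhds ht)).mdifferentiableAt (by simp)
  have hpair := (h.mdifferentiableAt q).hasMFDerivAt.prodMk
    ((h.contMDiffAt_normal hy).mdifferentiableAt (by simp)).hasMFDerivAt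
  have := ((hsymm.hasMFDerivAt.comp q hpair).congr_of_eventuallyEq hev).mfderiv
  refine (DFunLike.congr_fun this X).trans ?_
  refine Eq.trans (congrArg (mfderiv ((𝓡 3).prod 𝓘(ℝ, EuclideanSpace ℝ (Fin 3))) (𝓡 3).tangent
      e.toOpenPartialHomeomorph.symm (f q, components y (f q) (ν q))) ?_) (map_zero _)
  exact Prod.ext h1 h2

theorem isLocalFront (h : IsFront g f ν) (hq : q ∈ (extChartAt (𝓡 2) p).source)
    (hy : f q ∈ (extChartAt (𝓡 3) y).source) :
    IsLocalFront (metricMatrix g y) (coordMap p y f) (coordField p y f ν)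
      (extChartAt (𝓡 2) p q) where
  metric := by rw [coordMap_apply hq]; exact isMatrixMetric_metricMatrix g hy
  smooth := h.smoothNear_coordMap hq hy
  smooth_normal := h.smoothNear_coordField hq hy
  unit := by
    refine eventually_chart hq ?_
    filter_upwards [chart_source_mem_nhds hq, h.eventually_mem_source hy] with r h1 h2
    rw [coordMap_apply h1, coordField_apply ν h1, ← inner_eq_bil g h2, h.unit]
  orthogonal := by
    refine eventually_chart hq ?_
    filter_upwards [chart_source_mem_nhds hq, h.eventually_mem_source hy] with r h1 h2 u
    rw [← components_frame h1 u, ← h.components_df h1 h2, coordMap_apply h1,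
      coordField_apply ν h1, ← inner_eq_bil g h2, h.orthogonal]
  immersion := by
    refine eventually_chart hq ?_
    filter_upwards [chart_source_mem_nhds hq, h.eventually_mem_source hy] with r h1 h2 u hu hu'
    rw [← components_frame h1 u] at hu hu'
    rw [← h.components_df h1 h2, components_eq_zero_iff h2] at hu
    have h3 : vecDeriv (𝓡 2) (fun r => components y (f r) (ν r)) r (frame p r u) = 0 :=
      (mfderiv_eq_fderiv_chart h1 ((h.contMDiffAt_normal h2).mdifferentiableAt (by simp)) _).trans
        hu'
    have h4 := h.immersion r ((h.mfderiv_lift_eq_zero h2 hu h3).trans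
      (map_zero (mfderiv (𝓡 2) (𝓡 3).tangent (lift f ν) r)).symm)
    rw [← components_frame h1 u, h4, components_zero]

theorem firstForm_eq (h : IsFront g f ν) (hq : q ∈ (extChartAt (𝓡 2) p).source)
    (hy : f q ∈ (extChartAt (𝓡 3) y).source) (X Y : TangentSpace (𝓡 2) q) :
    firstForm g f q X Y = bil (metricMatrix g y (coordMap p y f (extChartAt (𝓡 2) p q)))
      (fderiv ℝ (coordMap p y f) (extChartAt (𝓡 2) p q) (components p q X))
      (fderiv ℝ (coordMap p y f) (extChartAt (𝓡 2) p q) (components p q Y)) := by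
  rw [firstForm, inner_eq_bil g hy, h.components_df hq hy, h.components_df hq hy,
    coordMap_apply hq]

theorem components_dnormal (h : IsFront g f ν) (hq : q ∈ (extChartAt (𝓡 2) p).source)
    (hy : f q ∈ (extChartAt (𝓡 3) y).source) (X : TangentSpace (𝓡 2) q) :
    components y (f q) (covDerivAlong g (𝓡 2) f ν q X) =
      covN (metricMatrix g y) (coordMap p y f) (coordField p y f ν) (extChartAt (𝓡 2) p q)
        (components p q X) := by
  rw [components_covDerivAlong g hy (h.mdifferentiableAt q) ν
    ((h.contMDiffAt_normal (mem_extChartAt_source (f q))).mdifferentiableAt (by simp)),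
    h.components_df hq hy, covN, cov, coordMap_apply hq, coordField_apply ν hq]
  congr 1
  exact mfderiv_eq_fderiv_chart hq ((h.contMDiffAt_normal hy).mdifferentiableAt (by simp)) X

theorem secondForm_eq (h : IsFront g f ν) (hq : q ∈ (extChartAt (𝓡 2) p).source)
    (hy : f q ∈ (extChartAt (𝓡 3) y).source) (X Y : TangentSpace (𝓡 2) q) :
    secondForm g f ν q X Y = sff (metricMatrix g y) (coordMap p y f) (coordField p y f ν)
      (extChartAt (𝓡 2) p q) (components p q X) (components p q Y) := by
  rw [secondForm, inner_eq_bil g hy, h.components_df hq hy, h.components_dnormal hq hy, sff,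
    coordMap_apply hq]

theorem isSingularPoint_iff (h : IsFront g f ν) (hq : q ∈ (extChartAt (𝓡 2) p).source)
    (hy : f q ∈ (extChartAt (𝓡 3) y).source) :
    IsSingularPoint f q ↔ density (metricMatrix g y) (coordMap p y f) (coordField p y f ν)
      (extChartAt (𝓡 2) p q) = 0 := by
  rw [(h.isLocalFront hq hy).density_eq_zero_iff, IsSingularPoint, not_iff_not]
  have hinj : Function.Injective (mfderiv (𝓡 2) (𝓡 3) f q) ↔
      ∀ X, mfderiv (𝓡 2) (𝓡 3) f q X = 0 → X = 0 :=
    injective_iff_map_eq_zero (mfderiv (𝓡 2) (𝓡 3) f q)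
  rw [hinj, injective_iff_map_eq_zero]
  constructor
  · intro hX u hu
    rw [← components_frame hq u, ← h.components_df hq hy, components_eq_zero_iff hy] at hu
    rw [← components_frame hq u, hX _ hu, components_zero]
  · intro hu X hX
    rw [← components_eq_zero_iff hq]
    refine hu _ ?_
    rw [← h.components_df hq hy, hX, components_zero]

end IsFront
end CoordinateFront

/-! ### The Gauss equation and the sectional curvature of the plane ν^⊥. -/

section GaussEquation

variable {G : EuclideanSpace ℝ (Fin 3) → EuclideanSpace ℝ (Fin 3) →L[ℝ] EuclideanSpace ℝ (Fin 3)
  →L[ℝ] ℝ} {y : EuclideanSpace ℝ (Fin 3)}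

theorem riem_swap {W : Type*} [NormedAddCommGroup W] [NormedSpace ℝ W]
    (G : W → W →L[ℝ] W →L[ℝ] ℝ) (y u v z w : W) :
    riem G y u v z w = - riem G y v u z w := by
  simp only [riem]; ring

theorem riem_sum_left (u v z w : EuclideanSpace ℝ (Fin 3)) :
    riem G y u v z w = ∑ i, ∑ j, u i * v j *
      riem G y (EuclideanSpace.single i 1) (EuclideanSpace.single j 1) z w := by
  conv_lhs => rw [euclidean_sum_single u, euclidean_sum_single v]
  simp only [riem, Fin.sum_univ_three, map_add, map_smul, add_apply, smul_apply, smul_eq_mul]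
  ring

theorem riem_sum_right (u v z w : EuclideanSpace ℝ (Fin 3)) :
    riem G y u v z w = ∑ i, ∑ j, z i * w j *
      riem G y u v (EuclideanSpace.single i 1) (EuclideanSpace.single j 1) := by
  conv_lhs => rw [euclidean_sum_single z, euclidean_sum_single w]
  simp only [riem, Fin.sum_univ_three, map_add, map_smul, add_apply, smul_apply, smul_eq_mul]
  ring

/-- An alternating form on `ℝ³`, given by its coefficients, evaluated on two vectors that are
annihilated by a covector `n`. -/
theorem alternating_eq_det3_mul {B : Fin 3 → Fin 3 → ℝ} (hB : ∀ i j, B i j = - B j i)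
    {a b c : EuclideanSpace ℝ (Fin 3)} {n : Fin 3 → ℝ} (ha : ∑ i, n i * a i = 0)
    (hb : ∑ i, n i * b i = 0) (hc : ∑ i, n i * c i = 1) :
    ∑ i, ∑ j, a i * b j * B i j = det3 a b c * ∑ k, n k * B (k + 1) (k + 2) := by
  have e0 : B 0 0 = 0 := by linarith [hB 0 0]
  have e1 : B 1 1 = 0 := by linarith [hB 1 1]
  have e2 : B 2 2 = 0 := by linarith [hB 2 2]
  rw [det3_eq]
  simp only [Fin.sum_univ_three] at ha hb hc ⊢
  -- Addition in `Fin 3` is modulo 3, so (k+1, k+2) runs through the cyclic pairs.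
  have f1 : (0 : Fin 3) + 1 = 1 := rfl
  have f2 : (0 : Fin 3) + 2 = 2 := rfl
  have f3 : (1 : Fin 3) + 1 = 2 := rfl
  have f4 : (1 : Fin 3) + 2 = 0 := rfl
  have f5 : (2 : Fin 3) + 1 = 0 := rfl
  have f6 : (2 : Fin 3) + 2 = 1 := rfl
  rw [f1, f2, f3, f4, f5, f6, e0, e1, e2, hB 1 0, hB 2 1, hB 0 2]
  -- Componentwise this is a × b = det(a, b, c)·n, by Cramer's rule.
  linear_combination B 1 2 * (-(a 1 * b 2 - a 2 * b 1) * hc - (c 1 * a 2 - c 2 * a 1) * hb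
      + (c 1 * b 2 - c 2 * b 1) * ha)
    + B 2 0 * (-(a 2 * b 0 - a 0 * b 2) * hc - (c 2 * a 0 - c 0 * a 2) * hb
      + (c 2 * b 0 - c 0 * b 2) * ha)
    + B 0 1 * (-(a 0 * b 1 - a 1 * b 0) * hc - (c 0 * a 1 - c 1 * a 0) * hb
      + (c 0 * b 1 - c 1 * b 0) * ha)

/-- The sectional curvature of the plane orthogonal to a unit vector `c`, as a function
depending smoothly on `c`. -/
def planeCurvature (Gm : EuclideanSpace ℝ (Fin 3) → Matrix (Fin 3) (Fin 3) ℝ)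
    (y c : EuclideanSpace ℝ (Fin 3)) : ℝ :=
  (∑ k, ∑ l, bil (Gm y) c (EuclideanSpace.single k 1) * bil (Gm y) c (EuclideanSpace.single l 1) *
    riem (fun y => bil (Gm y)) y (EuclideanSpace.single (k + 1) 1) (EuclideanSpace.single (k + 2) 1)
      (EuclideanSpace.single (l + 2) 1) (EuclideanSpace.single (l + 1) 1)) / (Gm y).det

variable {Gm : EuclideanSpace ℝ (Fin 3) → Matrix (Fin 3) (Fin 3) ℝ}

theorem bil_sum_right (A : Matrix (Fin 3) (Fin 3) ℝ) (c a : EuclideanSpace ℝ (Fin 3)) :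
    ∑ i, bil A c (EuclideanSpace.single i 1) * a i = bil A c a := by
  conv_rhs => rw [euclidean_sum_single a, map_sum]
  simp only [map_smul, smul_eq_mul, mul_comm]

/-- The curvature alternates in each pair, so `alternating_eq_det3_mul` applies twice, with the
covector ⟨c, ·⟩. Nothing requires a, b to be independent; the dependence on them is the squared
volume alone. -/
theorem riem_eq_planeCurvature (hG : IsMatrixMetric Gm y) {a b c : EuclideanSpace ℝ (Fin 3)}
    (ha : bil (Gm y) a c = 0) (hb : bil (Gm y) b c = 0) (hc : bil (Gm y) c c = 1) :
    riem (fun y => bil (Gm y)) y a b b a = planeCurvature Gm y c * vol (Gm y) a b c ^ 2 := by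
  have hdet := hG.posDef.det_pos
  have ha' : ∑ i, bil (Gm y) c (EuclideanSpace.single i 1) * a i = 0 := by
    rw [bil_sum_right, bil_symm hG.posDef, ha]
  have hb' : ∑ i, bil (Gm y) c (EuclideanSpace.single i 1) * b i = 0 := by
    rw [bil_sum_right, bil_symm hG.posDef, hb]
  have hc' : ∑ i, bil (Gm y) c (EuclideanSpace.single i 1) * c i = 1 := by
    rw [bil_sum_right, hc]
  set G := fun y => bil (Gm y) with hGdef
  have h1 : ∀ z w, riem G y a b z w = det3 a b c * ∑ k, bil (Gm y) c (EuclideanSpace.single k 1) *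
      riem G y (EuclideanSpace.single (k + 1) 1) (EuclideanSpace.single (k + 2) 1) z w := by
    intro z w
    rw [riem_sum_left]
    exact alternating_eq_det3_mul (B := fun i j =>
      riem G y (EuclideanSpace.single i 1) (EuclideanSpace.single j 1) z w)
      (fun i j => riem_swap _ _ _ _ _ _) ha' hb' hc'
  have h2 : ∀ u v, riem G y u v b a = det3 a b c * ∑ k, bil (Gm y) c (EuclideanSpace.single k 1) *
      riem G y u v (EuclideanSpace.single (k + 2) 1) (EuclideanSpace.single (k + 1) 1) := by
    intro u v
    rw [riem_add_swap hG.isLocalMetric, riem_sum_right]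
    rw [alternating_eq_det3_mul (B := fun i j =>
      riem G y u v (EuclideanSpace.single i 1) (EuclideanSpace.single j 1))
      (fun i j => riem_add_swap hG.isLocalMetric) ha' hb' hc', ← mul_neg, ← Finset.sum_neg_distrib]
    congr 1
    refine Finset.sum_congr rfl fun k _ => ?_
    rw [riem_add_swap hG.isLocalMetric (z := EuclideanSpace.single (k + 1) 1)]
    ring
  rw [h1]
  simp only [h2]
  rw [planeCurvature, vol, mul_pow, Real.sq_sqrt hdet.le, ← hGdef]
  field_simp
  simp only [Finset.mul_sum]
  refine Finset.sum_congr rfl fun k _ => Finset.sum_congr rfl fun l _ => ?_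
  ring

/-- A zero row in the Gram matrix makes every volume containing w vanish, hence w itself. -/
theorem eq_zero_of_vol_eq_zero {A : Matrix (Fin 3) (Fin 3) ℝ} (hA : A.PosDef)
    {a b c w : EuclideanSpace ℝ (Fin 3)} (h : vol A a b c ≠ 0) (ha : bil A w a = 0)
    (hb : bil A w b = 0) (hc : bil A w c = 0) : w = 0 := by
  have h0 : ∀ b' c', vol A w b' c' = 0 := by
    intro b' c'
    have := vol_mul_vol hA w b' c' a b c
    rw [ha, hb, hc] at this
    simpa [h] using this
  have hs : √A.det ≠ 0 := (Real.sqrt_pos.2 hA.det_pos).ne'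
  have e : ∀ b' c', det3 w b' c' = 0 := fun b' c' => by simpa [vol, hs] using h0 b' c'
  have e0 := e (EuclideanSpace.single 1 1) (EuclideanSpace.single 2 1)
  have e1 := e (EuclideanSpace.single 2 1) (EuclideanSpace.single 0 1)
  have e2 := e (EuclideanSpace.single 0 1) (EuclideanSpace.single 1 1)
  simp [det3_eq] at e0 e1 e2
  ext i; fin_cases i <;> simp [e0, e1, e2]

variable {F N : EuclideanSpace ℝ (Fin 2) → EuclideanSpace ℝ (Fin 3)}
  {x : EuclideanSpace ℝ (Fin 2)} {Im : EuclideanSpace ℝ (Fin 2) → Matrix (Fin 2) (Fin 2) ℝ}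

/-- The Gauss formula. -/
theorem IsLocalFront.hess_eq (h : IsLocalFront Gm F N x) (h0 : density Gm F N x ≠ 0)
    (hI : IsMatrixMetric Im x)
    (hp : IsPullbackNear (fun y => bil (Gm y)) F (fun z => bil (Im z)) x)
    (u v : EuclideanSpace ℝ (Fin 2)) :
    hess (fun y => bil (Gm y)) F x u v =
      fderiv ℝ F x (levi (fun z => bil (Im z)) x u v) + sff Gm F N x u v • N x := by
  rw [← sub_eq_zero]
  -- At a regular point the two columns of dF and N form a basis, so it suffices to compare inner
  -- products: tangentially by `christ1_pullback`, normally by `sff_eq_hess`.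
  have ht : ∀ z, bil (Gm (F x)) (hess (fun y => bil (Gm y)) F x u v -
      (fderiv ℝ F x (levi (fun z => bil (Im z)) x u v) + sff Gm F N x u v • N x))
      (fderiv ℝ F x z) = 0 := by
    intro z
    have h1 := christ1_pullback h.metric.isLocalMetric h.smooth
      hI.isLocalMetric.smooth.differentiableAt hp u v z
    rw [← hI.isLocalMetric.levi_spec, hp.self_of_nhds] at h1
    simp only [map_sub, map_add, map_smul, sub_apply, add_apply, smul_apply, smul_eq_mul]
    rw [h1, bil_symm h.posDef (N x), h.orth]
    ring
  refine eq_zero_of_vol_eq_zero h.posDef h0 (ht _) (ht _) ?_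
  simp only [map_sub, map_add, map_smul, sub_apply, add_apply, smul_apply, smul_eq_mul]
  rw [h.orth, h.normal_unit, h.sff_eq_hess]
  ring

/-- The Gauss equation. -/
theorem IsLocalFront.gauss_equation (h : IsLocalFront Gm F N x) (h0 : density Gm F N x ≠ 0)
    (hI : IsMatrixMetric Im x)
    (hp : IsPullbackNear (fun y => bil (Gm y)) F (fun z => bil (Im z)) x) :
    coordGaussCurvature Im x = detSff Gm F N x / density Gm F N x ^ 2 +
      planeCurvature Gm (F x) (N x) := by
  have hdet : (Im x).det = density Gm F N x ^ 2 := by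
    have hb : ∀ i j, Im x i j = bil (Gm (F x)) (fderiv ℝ F x (EuclideanSpace.single i 1))
        (fderiv ℝ F x (EuclideanSpace.single j 1)) := fun i j => by
      rw [← bil_single (Im x)]; exact hp.self_of_nhds _ _
    rw [Matrix.det_fin_two, h.sq_density, hb, hb, hb, hb]
  have hr : bil (Gm (F x)) (N x) (N x) = 1 := h.normal_unit
  have ho : ∀ u, bil (Gm (F x)) (N x) (fderiv ℝ F x u) = 0 := fun u => by
    rw [bil_symm h.posDef, h.orth]
  rw [coordGaussCurvature, sum_curvatureCoeff hI, riem_pullback h.metric.isLocalMetric h.smooth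
    hI.isLocalMetric hp, hdet, riem_eq_planeCurvature h.metric (h.orth _) (h.orth _) h.normal_unit]
  simp only [h.hess_eq h0 hI hp, map_add, map_smul, add_apply, smul_apply, smul_eq_mul, hr, ho,
    h.orth]
  simp only [← hp.self_of_nhds _ _]
  change (planeCurvature Gm (F x) (N x) * density Gm F N x ^ 2 + _ - _ - _ + _) / _ = _
  rw [detSff]
  field_simp
  ring

theorem IsMatrixMetric.smooth_riem {n : ℕ} {Gm : EuclideanSpace ℝ (Fin n) → Matrix (Fin n) (Fin n) ℝ}
    {y : EuclideanSpace ℝ (Fin n)} (h : IsMatrixMetric Gm y) (u v z w : EuclideanSpace ℝ (Fin n)) :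
    SmoothNear (fun y => riem (fun y => bil (Gm y)) y u v z w) y := by
  have hC := h.isLocalMetric.smooth_christ1
  have hL := h.isLocalMetric.smooth_levi
  filter_upwards [hC, hC.fderiv, hL] with r h1 h2 h3
  have c0 : ∀ u v z w, ContDiffAt ℝ ∞ (fun y => fderiv ℝ (christ1 fun y => bil (Gm y)) y u v z w) r :=
    fun u v z w => (((h2.clm_apply contDiffAt_const).clm_apply contDiffAt_const).clm_apply
      contDiffAt_const).clm_apply contDiffAt_const
  have c1 : ∀ u v z w, ContDiffAt ℝ ∞
      (fun y => christ1 (fun y => bil (Gm y)) y u v (levi (fun y => bil (Gm y)) y z w)) r :=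
    fun u v z w => ((h1.clm_apply contDiffAt_const).clm_apply contDiffAt_const).clm_apply
      ((h3.clm_apply contDiffAt_const).clm_apply contDiffAt_const)
  exact (((c0 _ _ _ _).sub (c0 _ _ _ _)).sub (c1 _ _ _ _)).add (c1 _ _ _ _)

/-- Because the ambient term is written through the normal, it has no singularity where dF
degenerates; it therefore does not affect boundedness of K. -/
theorem IsLocalFront.continuousAt_planeCurvature (h : IsLocalFront Gm F N x) :
    ContinuousAt (fun z => planeCurvature Gm (F z) (N z)) x := by
  have h1 : ∀ u v z w, ContinuousAt (fun r => riem (fun y => bil (Gm y)) (F r) u v z w) x :=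
    fun u v z w => (SmoothNear.comp (K := fun y => riem (fun y => bil (Gm y)) y u v z w)
      (h.metric.smooth_riem u v z w) h.smooth).continuousAt
  have h2 : ∀ u, ContinuousAt (fun z => bil (Gm (F z)) (N z) u) x := fun u =>
    (h.smooth_metric.continuousAt.clm_apply h.smooth_normal.continuousAt).clm_apply
      continuousAt_const
  have h3 : ContinuousAt (fun z => (Gm (F z)).det) x :=
    (differentiableAt_det (A := fun z => Gm (F z))
      fun i j => (h.metric_entries i j).differentiableAt).continuousAt
  refine ContinuousAt.div ?_ h3 h.posDef.det_pos.ne'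
  exact tendsto_finsetSum _ fun k _ => tendsto_finsetSum _ fun l _ =>
    ((h2 _).mul (h2 _)).mul (h1 _ _ _ _)

end GaussEquation

/-! ### Extrinsic and Gaussian curvature in arbitrary charts. -/

section Curvatures

theorem det2_clm_apply (T : EuclideanSpace ℝ (Fin 2) →L[ℝ] EuclideanSpace ℝ (Fin 2))
    (u v : EuclideanSpace ℝ (Fin 2)) : det2 (T u) (T v) =
      det2 u v * det2 (T (EuclideanSpace.single 0 1)) (T (EuclideanSpace.single 1 1)) := by
  conv_lhs => rw [euclidean_sum_single u, euclidean_sum_single v]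
  simp only [Fin.sum_univ_two, map_add, map_smul, det2, PiLp.add_apply, PiLp.smul_apply,
    smul_eq_mul]
  ring

theorem bil_eq_comp {A : Matrix (Fin 2) (Fin 2) ℝ} {B : Matrix (Fin 3) (Fin 3) ℝ}
    {T : EuclideanSpace ℝ (Fin 2) →L[ℝ] EuclideanSpace ℝ (Fin 3)}
    (h : ∀ i j, A i j = bil B (T (EuclideanSpace.single i 1)) (T (EuclideanSpace.single j 1)))
    (u v : EuclideanSpace ℝ (Fin 2)) : bil A u v = bil B (T u) (T v) := by
  conv_rhs => rw [euclidean_sum_single u, euclidean_sum_single v]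
  simp only [bil_apply A, Fin.sum_univ_two, map_add, map_smul, add_apply, smul_apply, smul_eq_mul, h]
  ring

variable {M : Type*} [TopologicalSpace M] [ChartedSpace (EuclideanSpace ℝ (Fin 2)) M]
  [IsManifold (𝓡 2) ∞ M]
  {N : Type*} [TopologicalSpace N] [ChartedSpace (EuclideanSpace ℝ (Fin 3)) N]
  [IsManifold (𝓡 3) ∞ N]
  {g : ContMDiffRiemannianMetric (𝓡 3) ∞ (EuclideanSpace ℝ (Fin 3))
    (fun y : N => TangentSpace (𝓡 3) y)}
  {f : M → N} {ν : ∀ q : M, TangentSpace (𝓡 3) (f q)}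
  {p q : M} {y : N}

theorem chartMatrix_apply (B : ∀ q : M, TangentSpace (𝓡 2) q → TangentSpace (𝓡 2) q → ℝ)
    (hq : q ∈ (extChartAt (𝓡 2) p).source) (i j : Fin 2) :
    chartMatrix B p (extChartAt (𝓡 2) p q) i j = B q (coordVec p i q) (coordVec p j q) := by
  simp only [chartMatrix, Matrix.of_apply]
  rw [(extChartAt (𝓡 2) p).left_inv hq]

theorem det2_components_coordVec_ne_zero (hq : q ∈ (extChartAt (𝓡 2) p).source) :
    det2 (components p q (coordVec q 0 q)) (components p q (coordVec q 1 q)) ≠ 0 := by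
  have hs : q ∈ (extChartAt (𝓡 2) q).source := mem_extChartAt_source q
  intro h0
  have h := det2_clm_apply (fderiv ℝ (fun x => extChartAt (𝓡 2) q ((extChartAt (𝓡 2) p).symm x))
    (extChartAt (𝓡 2) p q)) (components p q (coordVec q 0 q)) (components p q (coordVec q 1 q))
  rw [← components_eq_fderiv_transition hq hs, ← components_eq_fderiv_transition hq hs,
    components_coordVec hs, components_coordVec hs, h0, zero_mul] at h
  simp [det2] at h

namespace IsFront

theorem det_firstForm (h : IsFront g f ν) (hq : q ∈ (extChartAt (𝓡 2) p).source)
    (hy : f q ∈ (extChartAt (𝓡 3) y).source) (X Y : TangentSpace (𝓡 2) q) :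
    firstForm g f q X X * firstForm g f q Y Y - firstForm g f q X Y * firstForm g f q Y X =
      (det2 (components p q X) (components p q Y) *
        density (metricMatrix g y) (coordMap p y f) (coordField p y f ν)
          (extChartAt (𝓡 2) p q)) ^ 2 := by
  have hl := h.isLocalFront hq hy
  rw [← vol_fderiv, sq, vol_mul_vol_of_unit hl.posDef hl.normal_unit (hl.orth _) (hl.orth _)]
  simp only [h.firstForm_eq hq hy]

/-- The definition uses the chart at q itself; passing to the chart at p multiplies det h and det
ds² by the same squared determinant. -/
theorem extrinsicCurvature_eq (h : IsFront g f ν) (hq : q ∈ (extChartAt (𝓡 2) p).source)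
    (hy : f q ∈ (extChartAt (𝓡 3) y).source) :
    extrinsicCurvature g f ν q =
      detSff (metricMatrix g y) (coordMap p y f) (coordField p y f ν) (extChartAt (𝓡 2) p q) /
      density (metricMatrix g y) (coordMap p y f) (coordField p y f ν)
        (extChartAt (𝓡 2) p q) ^ 2 := by
  have hs : q ∈ (extChartAt (𝓡 2) q).source := mem_extChartAt_source q
  rw [extrinsicCurvature, shapeOperator, Matrix.det_mul, Matrix.det_nonsing_inv,
    Ring.inverse_eq_inv', Matrix.det_fin_two, Matrix.det_fin_two]
  simp only [chartMatrix_apply _ hs]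
  rw [h.det_firstForm hq hy]
  simp only [h.secondForm_eq hq hy]
  rw [sff_det, mul_pow, mul_inv]
  have := det2_components_coordVec_ne_zero hq
  field_simp

/-- The Gauss equation with the ambient chart `y` left free, so that it can stay fixed while q
approaches a singular point. -/
theorem gaussCurvature_eq (h : IsFront g f ν) (hy : f q ∈ (extChartAt (𝓡 3) y).source)
    (hr : ¬ IsSingularPoint f q) :
    gaussCurvature g f q = extrinsicCurvature g f ν q +
      planeCurvature (metricMatrix g y) (extChartAt (𝓡 3) y (f q)) (components y (f q) (ν q)) := by
  have hs : q ∈ (extChartAt (𝓡 2) q).source := mem_extChartAt_source q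
  have hl := h.isLocalFront hs hy
  rw [h.isSingularPoint_iff hs hy] at hr
  have hp : IsPullbackNear (fun z => bil (metricMatrix g y z)) (coordMap q y f)
      (fun z => bil (chartMatrix (firstForm g f) q z)) (extChartAt (𝓡 2) q q) := by
    refine eventually_chart hs ?_
    filter_upwards [chart_source_mem_nhds hs, h.eventually_mem_source hy] with r h1 h2
    refine bil_eq_comp fun i j => ?_
    rw [chartMatrix_apply _ h1, h.firstForm_eq h1 h2, components_coordVec h1,
      components_coordVec h1]
  have hI : IsMatrixMetric (chartMatrix (firstForm g f) q) (extChartAt (𝓡 2) q q) := by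
    filter_upwards [hp.eventually_nhds, hl.nearby,
      hl.smooth_density.continuousAt.eventually_ne hr] with z h1 h2 h3
    constructor
    · intro i j
      have : (fun z => chartMatrix (firstForm g f) q z i j) =ᶠ[𝓝 z] fun z =>
          bil (metricMatrix g y (coordMap q y f z))
            (fderiv ℝ (coordMap q y f) z (EuclideanSpace.single i 1))
            (fderiv ℝ (coordMap q y f) z (EuclideanSpace.single j 1)) := by
        filter_upwards [h1] with w hw
        rw [← hw, bil_single]
      refine ContDiffAt.congr_of_eventuallyEq ?_ this
      exact (h2.smooth_metric.contDiffAt.clm_apply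
        (h2.smooth.fderiv.apply_const _).contDiffAt).clm_apply
        (h2.smooth.fderiv.apply_const _).contDiffAt
    · have h4 := h1.self_of_nhds
      refine posDef_of_bil (fun i j => ?_) fun u hu => ?_
      · rw [← bil_single (chartMatrix (firstForm g f) q z), h4, bil_symm h2.posDef, ← h4,
          bil_single]
      · rw [h4]
        refine bil_pos h2.posDef fun h0 => ?_
        have := (not_congr h2.density_eq_zero_iff).1 h3
        rw [not_not, injective_iff_map_eq_zero] at this
        exact hu (this u h0)
  rw [gaussCurvature, hl.gauss_equation hr hI hp, h.extrinsicCurvature_eq hs hy, coordMap_apply hs,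
    coordField_apply ν hs]

end IsFront
end Curvatures

/-! ### Chart independence of the singular curvature. -/

section SingularCurvature

variable {M : Type*} [TopologicalSpace M] [ChartedSpace (EuclideanSpace ℝ (Fin 2)) M]
  [IsManifold (𝓡 2) ∞ M]
  {N : Type*} [TopologicalSpace N] [ChartedSpace (EuclideanSpace ℝ (Fin 3)) N]
  [IsManifold (𝓡 3) ∞ N]
  {g : ContMDiffRiemannianMetric (𝓡 3) ∞ (EuclideanSpace ℝ (Fin 3))
    (fun y : N => TangentSpace (𝓡 3) y)}
  {f : M → N} {ν : ∀ q : M, TangentSpace (𝓡 3) (f q)}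
  {p q : M} {y : N}

theorem volumeElement_eq (p y : N) (a b c : TangentSpace (𝓡 3) y) :
    volumeElement g p y a b c = vol (metricMatrix g p (extChartAt (𝓡 3) p y))
      (components p y a) (components p y b) (components p y c) := rfl

/-- A single volume depends on the orientation of the chart, but a product of two is a Gram
determinant and hence invariant. -/
theorem vol_components_mul {y z : N} (hy : z ∈ (extChartAt (𝓡 3) y).source) {y' : N}
    (hy' : z ∈ (extChartAt (𝓡 3) y').source) (a b c a' b' c' : TangentSpace (𝓡 3) z) :
    volumeElement g y z a b c * volumeElement g y z a' b' c' =
      volumeElement g y' z a b c * volumeElement g y' z a' b' c' := by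
  have h1 := (isMatrixMetric_metricMatrix g hy).posDef
  have h2 := (isMatrixMetric_metricMatrix g hy').posDef
  simp only [volumeElement_eq, vol_mul_vol h1, vol_mul_vol h2, ← inner_eq_bil g hy,
    ← inner_eq_bil g hy']

theorem IsFront.signedAreaDensity_eq (h : IsFront g f ν) (hq : q ∈ (extChartAt (𝓡 2) p).source)
    (hy : f q ∈ (extChartAt (𝓡 3) (f p)).source) :
    signedAreaDensity g f ν p q = density (metricMatrix g (f p)) (coordMap p (f p) f)
      (coordField p (f p) f ν) (extChartAt (𝓡 2) p q) := by
  rw [signedAreaDensity, volumeElement_eq, h.components_df hq hy, h.components_df hq hy,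
    components_coordVec hq, components_coordVec hq, density, coordMap_apply hq,
    coordField_apply ν hq]

theorem IsFront.dAreaDensity_eq (h : IsFront g f ν) (X : TangentSpace (𝓡 2) p) :
    dAreaDensity g f ν p X = fderiv ℝ (density (metricMatrix g (f p)) (coordMap p (f p) f)
      (coordField p (f p) f ν)) (extChartAt (𝓡 2) p p) (components p p X) := by
  have hq : p ∈ (extChartAt (𝓡 2) p).source := mem_extChartAt_source p
  have hy : f p ∈ (extChartAt (𝓡 3) (f p)).source := mem_extChartAt_source (f p)
  have e : signedAreaDensity g f ν p =ᶠ[𝓝 p] fun q => density (metricMatrix g (f p))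
      (coordMap p (f p) f) (coordField p (f p) f ν) (extChartAt (𝓡 2) p q) := by
    filter_upwards [chart_source_mem_nhds hq, h.eventually_mem_source hy] with r h1 h2
    exact h.signedAreaDensity_eq h1 h2
  have hd := (h.isLocalFront hq hy).smooth_density.differentiableAt
  refine (vecDeriv_congr (V := ℝ) e X).trans ?_
  refine (vecDeriv_comp (u := fun q => extChartAt (𝓡 2) p q) hd
    ((contMDiffAt_chart hq).mdifferentiableAt (by simp)) X).trans ?_
  rfl

/-- The vector field along `f` that is the image of the field with constant components `u` in the
chart at `p`. -/
def imageField (f : M → N) (p : M) (u : EuclideanSpace ℝ (Fin 2)) (q : M) :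
    TangentSpace (𝓡 3) (f q) :=
  mfderiv (𝓡 2) (𝓡 3) f q (frame p q u)

theorem IsFront.components_imageField (h : IsFront g f ν) {p' : M}
    (hq : q ∈ (extChartAt (𝓡 2) p).source) (hq' : q ∈ (extChartAt (𝓡 2) p').source)
    (hy : f q ∈ (extChartAt (𝓡 3) y).source) (u : EuclideanSpace ℝ (Fin 2)) :
    components y (f q) (imageField f p' u q) =
      fderiv ℝ (coordMap p y f) (extChartAt (𝓡 2) p q)
        (fderiv ℝ (fun x => extChartAt (𝓡 2) p ((extChartAt (𝓡 2) p').symm x))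
          (extChartAt (𝓡 2) p' q) u) := by
  rw [imageField, h.components_df hq hy, components_eq_fderiv_transition hq' hq,
    components_frame hq']

/-- The differential of the signed area density at a singular point in arbitrary charts. -/
theorem IsFront.fderiv_density_eq (h : IsFront g f ν) {p' : M}
    (hq : q ∈ (extChartAt (𝓡 2) p).source) (hq' : q ∈ (extChartAt (𝓡 2) p').source)
    (hy : f q ∈ (extChartAt (𝓡 3) y).source) (hs : IsSingularPoint f q)
    {η : TangentSpace (𝓡 2) q} (hη : mfderiv (𝓡 2) (𝓡 3) f q η = 0)
    (X Z : TangentSpace (𝓡 2) q) :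
    det2 (components p q X) (components p q η) *
      fderiv ℝ (density (metricMatrix g y) (coordMap p y f) (coordField p y f ν))
        (extChartAt (𝓡 2) p q) (components p q Z) =
    volumeElement g y (f q) (mfderiv (𝓡 2) (𝓡 3) f q X)
      (covDerivAlong g (𝓡 2) f (imageField f p' (components p' q η)) q Z) (ν q) := by
  have hl := h.isLocalFront hq hy
  set x := extChartAt (𝓡 2) p q with hx
  have hη' : fderiv ℝ (coordMap p y f) x (components p q η) = 0 := by
    rw [← h.components_df hq hy, hη, components_zero]
  have hd0 := (h.isSingularPoint_iff hq hy).1 hs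
  set τ := fun z => extChartAt (𝓡 2) p ((extChartAt (𝓡 2) p').symm z) with hτ
  set u := components p' q η with hu
  set B : M → EuclideanSpace ℝ (Fin 2) := fun r => fderiv ℝ τ (extChartAt (𝓡 2) p' r) u with hB
  have hBq : B q = components p q η := (components_eq_fderiv_transition hq' hq η).symm
  have hBd : MDifferentiableAt (𝓡 2) 𝓘(ℝ, EuclideanSpace ℝ (Fin 2)) B q :=
    MDifferentiableAt.comp (g := fun z => fderiv ℝ τ z u) q
      ((smoothNear_transition hq' hq).fderiv.apply_const u).differentiableAt.mdifferentiableAt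
      ((contMDiffAt_chart hq').mdifferentiableAt (by simp))
  have hV : ∀ y, f q ∈ (extChartAt (𝓡 3) y).source →
      ((fun r => components y (f r) (imageField f p' u r)) =ᶠ[𝓝 q]
        fun r => fderiv ℝ (coordMap p y f) (extChartAt (𝓡 2) p r) (B r)) ∧
      MDifferentiableAt (𝓡 2) 𝓘(ℝ, EuclideanSpace ℝ (Fin 2) →L[ℝ] EuclideanSpace ℝ (Fin 3))
        (fun r => fderiv ℝ (coordMap p y f) (extChartAt (𝓡 2) p r)) q := by
    intro y hy
    constructor
    · filter_upwards [chart_source_mem_nhds hq, chart_source_mem_nhds hq',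
        h.eventually_mem_source hy] with r h1 h2 h3
      exact h.components_imageField h1 h2 h3 u
    · exact MDifferentiableAt.comp (g := fderiv ℝ (coordMap p y f)) q
        (h.smoothNear_coordMap hq hy).fderiv.differentiableAt.mdifferentiableAt
        ((contMDiffAt_chart hq).mdifferentiableAt (by simp))
  obtain ⟨e1, d1⟩ := hV (f q) (mem_extChartAt_source (f q))
  obtain ⟨e2, d2⟩ := hV y hy
  -- A field with constant components in the chart at p' has variable components `B` in the chart at
  -- p. The derivative of `B` contributes only a tangent vector, which the volume ignores since λ =
  -- 0.
  have hW : components y (f q) (covDerivAlong g (𝓡 2) f (imageField f p' u) q Z) =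
      hess (fun z => bil (metricMatrix g y z)) (coordMap p y f) x (components p q Z)
        (components p q η) + fderiv ℝ (coordMap p y f) x (vecDeriv (𝓡 2) B q Z) := by
    have h0 : components y (f q) (imageField f p' u q) = 0 := by
      exact e2.self_of_nhds.trans ((congrArg (fderiv ℝ (coordMap p y f) x) hBq).trans hη')
    rw [components_covDerivAlong g hy (h.mdifferentiableAt q) _
      ((d1.clm_apply hBd).congr_of_eventuallyEq e1), vecDeriv_congr e2, vecDeriv_clm_apply d2 hBd,
      vecDeriv_comp (K := fderiv ℝ (coordMap p y f)) (u := fun r => extChartAt (𝓡 2) p r)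
        hl.smooth.fderiv.differentiableAt ((contMDiffAt_chart hq).mdifferentiableAt (by simp)),
      h0, IsLocalFront.hess_of_null hη', hBq, map_zero, add_zero]
    rfl
  rw [hl.fderiv_density hη', volumeElement_eq, h.components_df hq hy, hW, vol_add_middle,
    coordMap_apply hq, coordField_apply ν hq, ← coordMap_apply hq (y := y) (f := f),
    ← coordField_apply ν hq (y := y), vol_fderiv (Gm := metricMatrix g y), hd0, mul_zero, add_zero]

/-- The product `sgn(a) b` is determined by the products of `a` and `b`. -/
theorem sign_mul_eq_of_mul_eq {a b a' b' : ℝ} (h1 : a * a = a' * a') (h2 : a * b = a' * b') :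
    Real.sign a * b = Real.sign a' * b' := by
  rcases mul_self_eq_mul_self_iff.1 h1 with rfl | rfl
  · rcases eq_or_ne a 0 with rfl | h0
    · simp
    · rw [mul_left_cancel₀ h0 h2]
  · rcases eq_or_ne a' 0 with rfl | h0
    · simp
    · have : b' = -b := by
        apply mul_left_cancel₀ h0; linarith
      rw [this, Real.sign_neg]; ring

theorem sign_eq_sign_mul {a d : ℝ} (hd : 0 < d) : Real.sign a = Real.sign (d * a) := by
  rcases lt_trichotomy a 0 with h | rfl | h
  · rw [Real.sign_of_neg h, Real.sign_of_neg (mul_neg_of_pos_of_neg hd h)]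
  · simp
  · rw [Real.sign_of_pos h, Real.sign_of_pos (mul_pos hd h)]

variable {γ : ℝ → M} {t : ℝ}

theorem components_velocity (hγ : ContMDiffAt 𝓘(ℝ, ℝ) (𝓡 2) ∞ γ t)
    (hq : γ t ∈ (extChartAt (𝓡 2) p).source) :
    components p (γ t) (velocity γ t) = fderiv ℝ (fun s => extChartAt (𝓡 2) p (γ s)) t 1 := by
  rw [← mfderiv_eq_fderiv]
  exact components_mfderiv hq (hγ.mdifferentiableAt (by simp)) (1 : ℝ)

theorem smoothNear_chart_curve (hγ : ∀ᶠ s in 𝓝 t, ContMDiffAt 𝓘(ℝ, ℝ) (𝓡 2) ∞ γ s)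
    (hq : γ t ∈ (extChartAt (𝓡 2) p).source) :
    SmoothNear (fun s => extChartAt (𝓡 2) p (γ s)) t := by
  filter_upwards [hγ, hγ.self_of_nhds.continuousAt.eventually (chart_source_mem_nhds hq)]
    with s h1 h2
  exact contMDiffAt_iff_contDiffAt.1 ((contMDiffAt_chart h2).comp s h1)

theorem coordMap_comp_eq (hγ : ∀ᶠ s in 𝓝 t, ContMDiffAt 𝓘(ℝ, ℝ) (𝓡 2) ∞ γ s)
    (hq : γ t ∈ (extChartAt (𝓡 2) p).source) :
    (fun s => coordMap p y f (extChartAt (𝓡 2) p (γ s))) =ᶠ[𝓝 t]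
      fun s => extChartAt (𝓡 3) y (f (γ s)) := by
  filter_upwards [hγ.self_of_nhds.continuousAt.eventually (chart_source_mem_nhds hq)] with s hs
  exact coordMap_apply hs

theorem IsFront.components_imageVelocity (h : IsFront g f ν)
    (hγ : ∀ᶠ s in 𝓝 t, ContMDiffAt 𝓘(ℝ, ℝ) (𝓡 2) ∞ γ s)
    (hq : γ t ∈ (extChartAt (𝓡 2) p).source) (hy : f (γ t) ∈ (extChartAt (𝓡 3) y).source) :
    components y (f (γ t)) (imageVelocity f γ t) =
      fderiv ℝ (fun s => coordMap p y f (extChartAt (𝓡 2) p (γ s))) t 1 := by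
  rw [(coordMap_comp_eq hγ hq).fderiv_eq, ← mfderiv_eq_fderiv]
  exact components_mfderiv (c := fun s => f (γ s)) hy
    (MDifferentiableAt.comp t (h.mdifferentiableAt _) (hγ.self_of_nhds.mdifferentiableAt (by simp)))
    (1 : ℝ)

theorem IsFront.components_imageAcceleration (h : IsFront g f ν)
    (hγ : ∀ᶠ s in 𝓝 t, ContMDiffAt 𝓘(ℝ, ℝ) (𝓡 2) ∞ γ s)
    (hq : γ t ∈ (extChartAt (𝓡 2) p).source) (hy : f (γ t) ∈ (extChartAt (𝓡 3) y).source) :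
    components y (f (γ t)) (imageAcceleration g f γ t) =
      hess (fun z => bil (metricMatrix g y z))
        (fun s => coordMap p y f (extChartAt (𝓡 2) p (γ s))) t 1 1 := by
  have hc : MDifferentiableAt 𝓘(ℝ, ℝ) (𝓡 3) (fun s => f (γ s)) t :=
    MDifferentiableAt.comp t (h.mdifferentiableAt _) (hγ.self_of_nhds.mdifferentiableAt (by simp))
  have e : ∀ y, f (γ t) ∈ (extChartAt (𝓡 3) y).source →
      SmoothNear (fun s => coordMap p y f (extChartAt (𝓡 2) p (γ s))) t ∧
      (fun s => components y (f (γ s)) (imageVelocity f γ s)) =ᶠ[𝓝 t]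
        fun s => fderiv ℝ (fun s => coordMap p y f (extChartAt (𝓡 2) p (γ s))) s 1 := by
    intro y hy
    have hcont := hγ.self_of_nhds.continuousAt
    refine ⟨SmoothNear.comp (h.smoothNear_coordMap hq hy) (smoothNear_chart_curve hγ hq), ?_⟩
    filter_upwards [hγ.eventually_nhds, hcont.eventually (chart_source_mem_nhds hq),
      hcont.eventually (h.eventually_mem_source hy)] with s h1 h2 h3
    exact h.components_imageVelocity h1 h2 h3
  obtain ⟨s1, e1⟩ := e (f (γ t)) (mem_extChartAt_source _)
  obtain ⟨s2, e2⟩ := e y hy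
  have hvel := h.components_imageVelocity hγ hq hy
  have key := components_covDerivAlong g (c := fun s => f (γ s)) (J := 𝓘(ℝ, ℝ)) hy hc
    (imageVelocity f γ)
    ((s1.fderiv.apply_const 1).differentiableAt.mdifferentiableAt.congr_of_eventuallyEq e1) (1 : ℝ)
  refine key.trans ?_
  have hv : vecDeriv 𝓘(ℝ, ℝ) (fun s => components y (f (γ s)) (imageVelocity f γ s)) t (1 : ℝ) =
      fderiv ℝ (fderiv ℝ (fun s => coordMap p y f (extChartAt (𝓡 2) p (γ s)))) t 1 1 := by
    refine (vecDeriv_congr e2 _).trans ?_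
    rw [← fderiv_clm_apply_const s2.fderiv.differentiableAt, ← mfderiv_eq_fderiv]
    rfl
  rw [hv, hess, coordMap_apply hq]
  congr 1
  exact congrArg (fun w => levi (fun z => bil (metricMatrix g y z))
    (extChartAt (𝓡 3) y (f (γ t))) w w) hvel

/-- The singular curvature in arbitrary charts. -/
theorem IsFront.singularCurvature_eq (h : IsFront g f ν)
    (hγ : ∀ᶠ s in 𝓝 t, ContMDiffAt 𝓘(ℝ, ℝ) (𝓡 2) ∞ γ s)
    (hq : γ t ∈ (extChartAt (𝓡 2) p).source) (hy : f (γ t) ∈ (extChartAt (𝓡 3) y).source)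
    (hs : IsSingularPoint f (γ t)) {η : TangentSpace (𝓡 2) (γ t)}
    (hη : IsPositiveNullVector f γ t η) :
    singularCurvature g f ν γ t η =
      localSingularCurvature (metricMatrix g y) (coordMap p y f) (coordField p y f ν)
        (fun s => extChartAt (𝓡 2) p (γ s)) t (components p (γ t) η) := by
  have hq' : γ t ∈ (extChartAt (𝓡 2) (γ t)).source := mem_extChartAt_source _
  have hy' : f (γ t) ∈ (extChartAt (𝓡 3) (f (γ t))).source := mem_extChartAt_source _
  have hpos : 0 < det2 (components (γ t) (γ t) (velocity γ t)) (components (γ t) (γ t) η) := by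
    have := hη.2
    rw [PositivePair, Matrix.det_fin_two] at this
    exact this
  -- Both identities use the field defined by the chart at γ(t), so the right-hand sides are volumes
  -- of the same vectors in two ambient charts. The sign by which these differ also affects the
  -- numerator of κ_s and cancels.
  have k1 := h.fderiv_density_eq hq' hq' hy' hs hη.1 (velocity γ t) η
  have k2 := h.fderiv_density_eq hq hq' hy hs hη.1 (velocity γ t) η
  rw [singularCurvature, h.dAreaDensity_eq, sign_eq_sign_mul hpos, k1, localSingularCurvature,
    ← components_velocity hγ.self_of_nhds hq, k2, ← h.components_imageVelocity hγ hq hy,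
    ← h.components_imageAcceleration hγ hq hy, coordMap_apply hq, coordField_apply ν hq,
    ← inner_eq_bil g hy, ← volumeElement_eq, ← mul_div_assoc, ← mul_div_assoc]
  congr 1
  exact sign_mul_eq_of_mul_eq (vol_components_mul hy' hy _ _ _ _ _ _)
    (vol_components_mul hy' hy _ _ _ _ _ _)

theorem IsSingularCurve.isLocalSingularCurve (h : IsFront g f ν) {I : Set ℝ}
    (hγ : IsSingularCurve g f ν I γ) (ht : t ∈ I) :
    IsLocalSingularCurve (metricMatrix g (f (γ t))) (coordMap (γ t) (f (γ t)) f)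
      (coordField (γ t) (f (γ t)) f ν) (fun s => extChartAt (𝓡 2) (γ t) (γ s)) t := by
  have hq : γ t ∈ (extChartAt (𝓡 2) (γ t)).source := mem_extChartAt_source _
  have hy : f (γ t) ∈ (extChartAt (𝓡 3) (f (γ t))).source := mem_extChartAt_source _
  have hI : ∀ᶠ s in 𝓝 t, s ∈ I := hγ.isOpen.mem_nhds ht
  have hs : ∀ᶠ s in 𝓝 t, ContMDiffAt 𝓘(ℝ, ℝ) (𝓡 2) ∞ γ s :=
    hI.mono fun s hs => hγ.smooth.contMDiffAt (hγ.isOpen.mem_nhds hs)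
  refine ⟨h.isLocalFront hq hy, smoothNear_chart_curve hs hq, ?_, ?_, ?_⟩
  · rw [← components_velocity hs.self_of_nhds hq, ne_eq, components_eq_zero_iff hq]
    exact hγ.regular t ht
  · have hcont := hs.self_of_nhds.continuousAt
    filter_upwards [hI, hcont.eventually (chart_source_mem_nhds hq),
      hcont.eventually (h.eventually_mem_source hy)] with s h1 h2 h3
    exact (h.isSingularPoint_iff h2 h3).1 (hγ.nondegenerate s h1).1
  · obtain ⟨X, hX⟩ := (hγ.nondegenerate t ht).2
    rw [h.dAreaDensity_eq] at hX
    exact ⟨_, hX⟩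

end SingularCurvature

/-! ### Euclidean space: the ambient curvature term vanishes. -/

section Euclidean

theorem riem_eq_zero_of_const {W : Type*} [NormedAddCommGroup W] [NormedSpace ℝ W]
    (A : W →L[ℝ] W →L[ℝ] ℝ) (y u v z w : W) : riem (fun _ => A) y u v z w = 0 := by
  have h : christ1 (fun _ : W => A) = fun _ => 0 := by
    funext y; simp [christ1]
  simp [riem, h]

theorem metricMatrix_euclideanMetric (y : EuclideanSpace ℝ (Fin 3)) :
    metricMatrix euclideanMetric y = fun _ => 1 := by
  have hc : ∀ (i : Fin 3) (x : EuclideanSpace ℝ (Fin 3)),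
      coordVec y i x = EuclideanSpace.single i (1 : ℝ) := by
    intro i x
    have h : (fun x : EuclideanSpace ℝ (Fin 3) => (extChartAt (𝓡 3) y).symm x) = id := by
      funext z; rfl
    rw [coordVec, h]
    exact DFunLike.congr_fun (mfderiv_id (I := 𝓡 3) (x := extChartAt (𝓡 3) y x)) _
  funext x
  ext i j
  simp only [metricMatrix, chartMatrix, Matrix.of_apply, hc]
  change inner ℝ (EuclideanSpace.single i (1 : ℝ)) (EuclideanSpace.single j (1 : ℝ)) = _
  rw [EuclideanSpace.inner_single_left]
  simp [Matrix.one_apply]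

theorem planeCurvature_euclideanMetric (y z c : EuclideanSpace ℝ (Fin 3)) :
    planeCurvature (metricMatrix euclideanMetric y) z c = 0 := by
  rw [metricMatrix_euclideanMetric]
  simp [planeCurvature, riem_eq_zero_of_const]

end Euclidean

/-! ### The five claims for fronts on manifolds. -/

section Main

variable {M : Type*} [TopologicalSpace M] [ChartedSpace (EuclideanSpace ℝ (Fin 2)) M]
  [IsManifold (𝓡 2) ∞ M]
  {N : Type*} [TopologicalSpace N] [ChartedSpace (EuclideanSpace ℝ (Fin 3)) N]
  [IsManifold (𝓡 3) ∞ N]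
  {g : ContMDiffRiemannianMetric (𝓡 3) ∞ (EuclideanSpace ℝ (Fin 3))
    (fun y : N => TangentSpace (𝓡 3) y)}
  {f : M → N} {ν : ∀ q : M, TangentSpace (𝓡 3) (f q)}
  {I : Set ℝ} {γ : ℝ → M} {t : ℝ}

theorem IsSingularCurve.eventually_contMDiffAt (hγ : IsSingularCurve g f ν I γ) (ht : t ∈ I) :
    ∀ᶠ s in 𝓝 t, ContMDiffAt 𝓘(ℝ, ℝ) (𝓡 2) ∞ γ s := by
  filter_upwards [hγ.isOpen.mem_nhds ht] with s hs
  exact hγ.smooth.contMDiffAt (hγ.isOpen.mem_nhds hs)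

/-- The Gaussian curvature and the extrinsic curvature differ by a locally bounded function. -/
theorem IsFront.exists_abs_sub_le (h : IsFront g f ν) (q : M) :
    ∃ C, ∀ᶠ r in 𝓝 q, ¬ IsSingularPoint f r →
      |gaussCurvature g f r - extrinsicCurvature g f ν r| ≤ C := by
  have hq : q ∈ (extChartAt (𝓡 2) q).source := mem_extChartAt_source _
  have hy : f q ∈ (extChartAt (𝓡 3) (f q)).source := mem_extChartAt_source _
  have hc := (h.isLocalFront hq hy).continuousAt_planeCurvature.abs
  refine ⟨|planeCurvature (metricMatrix g (f q)) (coordMap q (f q) f (extChartAt (𝓡 2) q q))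
    (coordField q (f q) f ν (extChartAt (𝓡 2) q q))| + 1, ?_⟩
  filter_upwards [(contMDiffAt_chart hq).continuousAt.eventually
    (hc.eventually_lt_const (lt_add_one _)), chart_source_mem_nhds hq,
    h.eventually_mem_source hy] with r h1 h2 h3 hr
  rw [h.gaussCurvature_eq h3 hr, add_sub_cancel_left]
  rw [coordMap_apply h2, coordField_apply ν h2] at h1
  exact h1.le

/-- The extrinsic curvature in terms of the two area densities. -/
theorem IsFront.extrinsicCurvature_mul_density (h : IsFront g f ν) {p q : M} {y : N}
    (hq : q ∈ (extChartAt (𝓡 2) p).source) (hy : f q ∈ (extChartAt (𝓡 3) y).source)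
    (hr : ¬ IsSingularPoint f q) :
    extrinsicCurvature g f ν q *
        density (metricMatrix g y) (coordMap p y f) (coordField p y f ν) (extChartAt (𝓡 2) p q) =
      normalDensity (metricMatrix g y) (coordMap p y f) (coordField p y f ν)
        (extChartAt (𝓡 2) p q) := by
  rw [h.isSingularPoint_iff hq hy] at hr
  rw [h.extrinsicCurvature_eq hq hy, detSff, ← (h.isLocalFront hq hy).density_mul_normalDensity]
  field_simp

theorem IsSingularCurve.normalDensity_eq_zero_iff (h : IsFront g f ν)
    (hγ : IsSingularCurve g f ν I γ) (ht : t ∈ I) :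
    normalDensity (metricMatrix g (f (γ t))) (coordMap (γ t) (f (γ t)) f)
      (coordField (γ t) (f (γ t)) f ν) (extChartAt (𝓡 2) (γ t) (γ t)) = 0 ↔
    ∀ X Y : TangentSpace (𝓡 2) (γ t), secondForm g f ν (γ t) X Y = 0 := by
  have hq : γ t ∈ (extChartAt (𝓡 2) (γ t)).source := mem_extChartAt_source _
  have hy : f (γ t) ∈ (extChartAt (𝓡 3) (f (γ t))).source := mem_extChartAt_source _
  have hl := hγ.isLocalSingularCurve h ht
  obtain ⟨u, hu⟩ := hl.nondegenerate
  rw [hl.front.normalDensity_eq_zero_iff hl.density_eq_zero hu]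
  constructor
  · intro h0 X Y
    rw [h.secondForm_eq hq hy, h0]
  · intro h0 v w
    rw [← components_frame hq v, ← components_frame hq w, ← h.secondForm_eq hq hy, h0]

/-- A bound on K bounds K_ext = μ/λ, so |μ| ≤ (C + C')|λ| at regular points and μ vanishes on the
curve. -/
theorem IsSingularCurve.secondForm_eq_zero (h : IsFront g f ν)
    (hγ : IsSingularCurve g f ν I γ) (ht : t ∈ I) {C : ℝ}
    (hC : ∀ᶠ q in 𝓝 (γ t), ¬ IsSingularPoint f q → |gaussCurvature g f q| ≤ C)
    (X Y : TangentSpace (𝓡 2) (γ t)) : secondForm g f ν (γ t) X Y = 0 := by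
  have hq : γ t ∈ (extChartAt (𝓡 2) (γ t)).source := mem_extChartAt_source _
  have hy : f (γ t) ∈ (extChartAt (𝓡 3) (f (γ t))).source := mem_extChartAt_source _
  have hl := hγ.isLocalSingularCurve h ht
  obtain ⟨u, hu⟩ := hl.nondegenerate
  obtain ⟨C', hC'⟩ := h.exists_abs_sub_le (γ t)
  refine (hγ.normalDensity_eq_zero_iff h ht).1 ?_ X Y
  refine eq_zero_of_bounded_quotient hl.front.smooth_density.differentiableAt
    hl.front.smooth_normalDensity.continuousAt hl.density_eq_zero hu (C := C + C') ?_
  refine eventually_chart hq ?_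
  filter_upwards [hC, hC', chart_source_mem_nhds hq, h.eventually_mem_source hy]
    with q h1 h2 h3 h4 h5
  rw [ne_eq, ← h.isSingularPoint_iff h3 h4] at h5
  rw [← h.extrinsicCurvature_mul_density h3 h4 h5, abs_mul]
  refine mul_le_mul_of_nonneg_right ?_ (abs_nonneg _)
  have h6 := h1 h5
  have h7 := h2 h5
  have := abs_sub_abs_le_abs_sub (extrinsicCurvature g f ν q) (gaussCurvature g f q)
  rw [abs_sub_comm] at this
  linarith

/-- h = 0 along γ gives μ = 0 along γ, in the fixed charts at γ(t). Then |μ| ≤ C|λ| near γ(t), so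
K_ext is bounded, and K with it. -/
theorem IsSingularCurve.eventually_abs_gaussCurvature_le (h : IsFront g f ν)
    (hγ : IsSingularCurve g f ν I γ) (ht : t ∈ I)
    (h0 : ∀ t ∈ I, ∀ X Y : TangentSpace (𝓡 2) (γ t), secondForm g f ν (γ t) X Y = 0) :
    ∃ C, ∀ᶠ q in 𝓝 (γ t), ¬ IsSingularPoint f q → |gaussCurvature g f q| ≤ C := by
  have hq : γ t ∈ (extChartAt (𝓡 2) (γ t)).source := mem_extChartAt_source _
  have hy : f (γ t) ∈ (extChartAt (𝓡 3) (f (γ t))).source := mem_extChartAt_source _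
  have hl := hγ.isLocalSingularCurve h ht
  obtain ⟨u, hu⟩ := hl.nondegenerate
  obtain ⟨C', hC'⟩ := h.exists_abs_sub_le (γ t)
  have hcont := (hγ.eventually_contMDiffAt ht).self_of_nhds.continuousAt
  have hn : ∀ᶠ s in 𝓝 t, normalDensity (metricMatrix g (f (γ t))) (coordMap (γ t) (f (γ t)) f)
      (coordField (γ t) (f (γ t)) f ν) (extChartAt (𝓡 2) (γ t) (γ s)) = 0 := by
    filter_upwards [hl.nearby, hγ.isOpen.mem_nhds ht, hcont.eventually (chart_source_mem_nhds hq),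
      hcont.eventually (h.eventually_mem_source hy)] with s h1 h2 h3 h4
    obtain ⟨u, hu⟩ := h1.nondegenerate
    refine (h1.front.normalDensity_eq_zero_iff h1.density_eq_zero hu).2 fun v w => ?_
    rw [← components_frame h3 v, ← components_frame h3 w, ← h.secondForm_eq h3 h4, h0 s h2]
  obtain ⟨C, hC⟩ := exists_abs_le_of_eq_zero_on_curve hl.front.smooth_density.contDiffAt
    hl.front.smooth_normalDensity.contDiffAt hl.smooth.contDiffAt rfl
    (by rw [← fderiv_apply_one_eq_deriv]; exact hl.regular) hu hl.singular hn
  refine ⟨C + C', ?_⟩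
  filter_upwards [(contMDiffAt_chart hq).continuousAt.eventually hC, hC',
    chart_source_mem_nhds hq, h.eventually_mem_source hy] with q h1 h2 h3 h4 h5
  rw [← h.extrinsicCurvature_mul_density h3 h4 h5, abs_mul] at h1
  have h6 := (h.isSingularPoint_iff h3 h4).not.1 h5
  have h7 := le_of_mul_le_mul_right h1 (abs_pos.2 h6)
  have h8 := h2 h5
  have := abs_sub_abs_le_abs_sub (gaussCurvature g f q) (extrinsicCurvature g f ν q)
  linarith

theorem IsSingularCurve.exists_isOpen_gaussCurvature_le (hγ : IsSingularCurve g f ν I γ)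
    (hloc : ∀ t ∈ I, ∃ C, ∀ᶠ q in 𝓝 (γ t), ¬ IsSingularPoint f q → |gaussCurvature g f q| ≤ C)
    {J : Set ℝ} (hJ : J ⊆ I) (hJc : IsCompact J) :
    ∃ U : Set M, IsOpen U ∧ γ '' J ⊆ U ∧
      ∃ C : ℝ, ∀ q ∈ U, ¬ IsSingularPoint f q → |gaussCurvature g f q| ≤ C := by
  have hc : IsCompact (γ '' J) := hJc.image_of_continuousOn (hγ.smooth.continuousOn.mono hJ)
  refine hc.induction_on (p := fun S => ∃ U : Set M, IsOpen U ∧ S ⊆ U ∧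
      ∃ C : ℝ, ∀ q ∈ U, ¬ IsSingularPoint f q → |gaussCurvature g f q| ≤ C)
    ⟨∅, isOpen_empty, subset_rfl, 0, by simp⟩
    (fun S T hST ⟨U, hU, hTU, hC⟩ => ⟨U, hU, hST.trans hTU, hC⟩) ?_ ?_
  · rintro S T ⟨U, hU, hSU, C, hC⟩ ⟨V, hV, hTV, D, hD⟩
    refine ⟨U ∪ V, hU.union hV, union_subset_union hSU hTV, max C D, ?_⟩
    rintro q (hq | hq) hr
    · exact (hC q hq hr).trans (le_max_left _ _)
    · exact (hD q hq hr).trans (le_max_right _ _)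
  · rintro _ ⟨t, ht, rfl⟩
    obtain ⟨C, hC⟩ := hloc t (hJ ht)
    obtain ⟨U, hU, hUo, htU⟩ := mem_nhds_iff.1 hC
    exact ⟨U, mem_nhdsWithin_of_mem_nhds (hUo.mem_nhds htU), U, hUo, subset_rfl, C, hU⟩

theorem det2_velocity_ne_zero {p : M} {η : TangentSpace (𝓡 2) (γ t)}
    (hq : γ t ∈ (extChartAt (𝓡 2) p).source) (hη : PositivePair (velocity γ t) η) :
    det2 (components p (γ t) (velocity γ t)) (components p (γ t) η) ≠ 0 := by
  have hs : γ t ∈ (extChartAt (𝓡 2) (γ t)).source := mem_extChartAt_source _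
  have hpos : 0 < det2 (components (γ t) (γ t) (velocity γ t)) (components (γ t) (γ t) η) := by
    rw [PositivePair, Matrix.det_fin_two] at hη
    exact hη
  intro h0
  rw [components_eq_fderiv_transition hq hs, components_eq_fderiv_transition hq hs,
    det2_clm_apply, h0, zero_mul] at hpos
  exact lt_irrefl _ hpos

theorem IsSingularCurve.singularCurvature_nonpos (h : IsFront g f ν)
    (hγ : IsSingularCurve g f ν I γ) (ht : t ∈ I) {δ : ℝ} (hδ : 0 ≤ δ)
    (hK : ∀ᶠ q in 𝓝 (γ t), ¬ IsSingularPoint f q → δ ≤ extrinsicCurvature g f ν q)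
    {η : TangentSpace (𝓡 2) (γ t)} (hη : IsPositiveNullVector f γ t η) :
    singularCurvature g f ν γ t η ≤ 0 ∧ (0 < δ → singularCurvature g f ν γ t η < 0) := by
  have hq : γ t ∈ (extChartAt (𝓡 2) (γ t)).source := mem_extChartAt_source _
  have hy : f (γ t) ∈ (extChartAt (𝓡 3) (f (γ t))).source := mem_extChartAt_source _
  have hs := hγ.eventually_contMDiffAt ht
  rw [h.singularCurvature_eq hs hq hy (hγ.nondegenerate t ht).1 hη]
  refine (hγ.isLocalSingularCurve h ht).localSingularCurvature_nonpos hδ ?_ ?_ ?_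
  · refine eventually_chart hq ?_
    filter_upwards [hK, chart_source_mem_nhds hq, h.eventually_mem_source hy] with q h1 h2 h3 h4
    have h5 := h1 ((h.isSingularPoint_iff h2 h3).not.2 h4)
    rw [h.extrinsicCurvature_eq h2 h3, le_div_iff₀ (by positivity)] at h5
    exact h5
  · rw [← h.components_df hq hy, hη.1, components_zero]
  · rw [← components_velocity hs.self_of_nhds hq]
    exact det2_velocity_ne_zero hq hη.2

theorem IsSingularCurve.eventually_singularCurvature_lt (h : IsFront g f ν)
    (hγ : IsSingularCurve g f ν I γ) (ht : t ∈ I)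
    (hnull : mfderiv (𝓡 2) (𝓡 3) f (γ t) (velocity γ t) = 0) (C : ℝ) :
    ∀ᶠ s in 𝓝 t, ∀ η, IsPositiveNullVector f γ s η → singularCurvature g f ν γ s η < C := by
  have hq : γ t ∈ (extChartAt (𝓡 2) (γ t)).source := mem_extChartAt_source _
  have hy : f (γ t) ∈ (extChartAt (𝓡 3) (f (γ t))).source := mem_extChartAt_source _
  have hs := hγ.eventually_contMDiffAt ht
  have hcont := hs.self_of_nhds.continuousAt
  have hn : fderiv ℝ (coordMap (γ t) (f (γ t)) f) (extChartAt (𝓡 2) (γ t) (γ t))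
      (fderiv ℝ (fun s => extChartAt (𝓡 2) (γ t) (γ s)) t 1) = 0 := by
    rw [← components_velocity hs.self_of_nhds hq, ← h.components_df hq hy, hnull, components_zero]
  filter_upwards [(hγ.isLocalSingularCurve h ht).eventually_localSingularCurvature_lt hn C,
    hs.eventually_nhds, hγ.isOpen.mem_nhds ht, hcont.eventually (chart_source_mem_nhds hq),
    hcont.eventually (h.eventually_mem_source hy)] with s h1 h2 h3 h4 h5 η hη
  rw [h.singularCurvature_eq h2 h4 h5 (hγ.nondegenerate s h3).1 hη]
  refine h1 _ ?_ ?_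
  · rw [← h.components_df h4 h5, hη.1, components_zero]
  · rw [← components_velocity h2.self_of_nhds h4]
    exact det2_velocity_ne_zero h4 hη.2

end Main

end Front

end

theorem mainTheorem2 {M : Type*} [TopologicalSpace M]
    [ChartedSpace (EuclideanSpace ℝ (Fin 2)) M] [IsManifold (𝓡 2) ∞ M]
    {N : Type*} [TopologicalSpace N] [ChartedSpace (EuclideanSpace ℝ (Fin 3)) N]
    [IsManifold (𝓡 3) ∞ N]
    (g : ContMDiffRiemannianMetric (𝓡 3) ∞ (EuclideanSpace ℝ (Fin 3))
      (fun y : N => TangentSpace (𝓡 3) y)) :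
    (∀ (f : M → N) (ν : ∀ q : M, TangentSpace (𝓡 3) (f q)), Front.IsFront g f ν →
      ∀ (I : Set ℝ) (γ : ℝ → M), Front.IsSingularCurve g f ν I γ →
        -- the Gaussian curvature is bounded near `γ` iff `h` vanishes on `γ`
        ((∀ J ⊆ I, IsCompact J → ∃ U : Set M, IsOpen U ∧ γ '' J ⊆ U ∧
            ∃ C : ℝ, ∀ q ∈ U, ¬ Front.IsSingularPoint f q → |Front.gaussCurvature g f q| ≤ C) ↔
          ∀ t ∈ I, ∀ X Y : TangentSpace (𝓡 2) (γ t), Front.secondForm g f ν (γ t) X Y = 0) ∧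
        -- `K_ext ≥ 0` near a point of `γ` implies `κ_s ≤ 0`
        (∀ U : Set M, IsOpen U →
          (∀ q ∈ U, ¬ Front.IsSingularPoint f q → 0 ≤ Front.extrinsicCurvature g f ν q) →
          ∀ t ∈ I, γ t ∈ U → ∀ η, Front.IsPositiveNullVector f γ t η →
            Front.singularCurvature g f ν γ t η ≤ 0) ∧
        -- `K_ext ≥ δ > 0` near a point of `γ` implies `κ_s < 0`
        (∀ U : Set M, IsOpen U → ∀ δ : ℝ, 0 < δ →
          (∀ q ∈ U, ¬ Front.IsSingularPoint f q → δ ≤ Front.extrinsicCurvature g f ν q) →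
          ∀ t ∈ I, γ t ∈ U → ∀ η, Front.IsPositiveNullVector f γ t η →
            Front.singularCurvature g f ν γ t η < 0) ∧
        -- `κ_s` tends to `-∞` at the points of `γ` that are not cuspidal edges
        (∀ t₀ ∈ I, mfderiv (𝓡 2) (𝓡 3) f (γ t₀) (Front.velocity γ t₀) = 0 →
          ∀ C : ℝ, ∀ᶠ t in 𝓝 t₀, ∀ η, Front.IsPositiveNullVector f γ t η →
            Front.singularCurvature g f ν γ t η < C)) ∧
    -- fronts in Euclidean space: `K ≥ 0` near a point of `γ` implies `κ_s ≤ 0`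
    (∀ (f : M → EuclideanSpace ℝ (Fin 3)) (ν : ∀ q : M, TangentSpace (𝓡 3) (f q)),
      Front.IsFront Front.euclideanMetric f ν →
      ∀ (I : Set ℝ) (γ : ℝ → M), Front.IsSingularCurve Front.euclideanMetric f ν I γ →
        ∀ U : Set M, IsOpen U →
          (∀ q ∈ U, ¬ Front.IsSingularPoint f q →
            0 ≤ Front.gaussCurvature Front.euclideanMetric f q) →
          ∀ t ∈ I, γ t ∈ U → ∀ η, Front.IsPositiveNullVector f γ t η →
            Front.singularCurvature Front.euclideanMetric f ν γ t η ≤ 0) := by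
  refine ⟨fun f ν h I γ hγ => ⟨⟨fun hb t ht => ?_, fun h0 J hJ hJc => ?_⟩,
    fun U hU hK t ht htU η hη => ?_, fun U hU δ hδ hK t ht htU η hη => ?_,
    fun t ht hnull C => hγ.eventually_singularCurvature_lt h ht hnull C⟩,
    fun f ν h I γ hγ U hU hK t ht htU η hη => ?_⟩
  -- One-point sets J suffice here, as the vanishing of h is a pointwise conclusion.
  · obtain ⟨U, hU, htU, C, hC⟩ := hb {t} (singleton_subset_iff.2 ht) isCompact_singleton
    rw [image_singleton, singleton_subset_iff] at htU
    exact hγ.secondForm_eq_zero h ht (eventually_of_mem (hU.mem_nhds htU) hC)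
  · exact hγ.exists_isOpen_gaussCurvature_le
      (fun t ht => hγ.eventually_abs_gaussCurvature_le h ht h0) hJ hJc
  · exact (hγ.singularCurvature_nonpos h ht le_rfl (eventually_of_mem (hU.mem_nhds htU) hK) hη).1
  · exact (hγ.singularCurvature_nonpos h ht hδ.le
      (eventually_of_mem (hU.mem_nhds htU) hK) hη).2 hδ
  · refine (hγ.singularCurvature_nonpos h ht le_rfl
      (eventually_of_mem (hU.mem_nhds htU) fun q hq hr => ?_) hη).1
    -- In ℝ³ the Gauss equation reduces to K = K_ext, so this is the case δ = 0 of the extrinsic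
    -- statement.
    have := hK q hq hr
    rwa [h.gaussCurvature_eq (mem_extChartAt_source (f q)) hr,
      Front.planeCurvature_euclideanMetric, add_zero] at this
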